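/- Let $n\ge 3$. Let $(\cdot,\cdot)$ be the scalar product $x^0y^0+\dots+x^{n-1}y^{n-1}-x^ny^n-x^{n+1}y^{n+1}$ on $\mathbb R^{n+2}$ and $Q^n_1\subset P^{n+1}$ the quadric $(X,X)=0$. Let $R^n_1$ be $\mathbb R^n$ with the form $g=(x^1)^2+\dots+(x^{n-1})^2-(x^n)^2$. The pseudoconformal space $C^n_1$ (the conformal compactification of $R^n_1$) is identified with $Q^n_1$ by the Darboux map, which on $R^n_1$ is $x\mapsto[\tfrac{1-g(x,x)}2:x^1:\dots:x^n:\tfrac{1+g(x,x)}2]$; composing it with the isometries of $(\cdot,\cdot)$ gives conformal charts $R^n_1\to C^n_1$ that cover $C^n_1$. Isotropic lines of $C^n_1$ correspond to the projective lines lying in $Q^n_1$. Consider a smooth $(n-1)$-parameter family $S$ of such lines (parametrized by an open set $\Omega\subset\mathbb R^{n-1}$). A real or complex point $X$ of (the complexification of) a line of $S$ is called *singular* if the tangent subspace at $X$ of the ruled hypersurface swept out by the lines, i.e. the span of the velocities of the smooth local sections of the family of lines through $X$, has projective dimension less than $n$. $S$ is an *isotropic congruence* if each of its lines carries at least one real nonsingular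 point. An *adapted frame* is a smooth local family of frames $A_0,\dots,A_{n+1}$ of $\mathbb R^{n+2}$ over $S$ such that $A_0A_1$ is the line of $S$, $(A_0,A_{n+1})=(A_1,A_n)=-1$, the matrix $g_{ij}=(A_i,A_j)$, $i,j=2,\dots,n-1$, is positive definite, and all other scalar products vanish; write $dA_\xi=\omega_\xi^\eta A_\eta$. Up to a nonvanishing factor, $\omega_0^n$ does not depend on the adapted frame. Let $S$ be an isotropic congruence. 1. Every line of $S$ has, near it, an adapted frame for which $\omega_0^2,\dots,\omega_0^{n-1},\omega_0^n$ are basis forms (linearly independent) at that line. Every line of $S$ carries exactly $n-2$ singular points (real or complex) counted with multiplicity. More precisely, whenever an adapted frame is such that these forms are basis forms at the line, there are unique numbers $\lambda^i_j,\lambda^i$ with $\omega_1^i=\lambda^i_j\omega_0^j+\lambda^i\omega_0^n$ at the line ($i,j=2,\dots,n-1$); the singular points of the line are the points $A_1+xA_0$ with $\det(\lambda^i_j+x\delta^i_j)=0$, and the multiplicity of such a point, which is that of the root $x\in\mathbb C$, does not depend on the frame. 2. The singular points are the Darboux images of the singular points of the congruence in $C^n_1$: every point of a line of $S$ lies in a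 conformal chart, and it is singular if and only if, in the chart, the tangent subspace at the corresponding (real or complex) point of the set swept out by the lines has dimension less than $n$. 3. If the equation $\omega_0^n=0$ is completely integrable on $S$, i.e. $d\omega_0^n\wedge\omega_0^n=0$, then it stratifies $S$ into lightlike hypersurfaces: near each line, $\Omega$ has smooth coordinates $(y,c)\in\mathbb R^{n-2}\times\mathbb R$ such that the slices $c=\mathrm{const}$ are integral manifolds of $\omega_0^n=0$, and the submanifold of $C^n_1$ swept out by the lines of a slice is, at each of its points that is not singular for $S$, a lightlike hypersurface (its tangent space has dimension $n-1$, and the form $g$ of the chart restricted to it is positive semidefinite and vanishes exactly along one direction). Moreover, for every adapted frame with basis forms as in 1 the affinor $\lambda$ is symmetric, $g_{ik}\lambda^k_j=g_{jk}\lambda^k_i$, and all singular points are real. 4. In general the singular points need not be real. For every $n\ge4$ there are an isotropic congruence and a line of it carrying a non-real singular point, and for which $\lambda$ is not symmetric for every adapted frame with basis forms at the line. For every even $n\ge4$ there are an isotropic congruence and a line of it all of whose singular points are non-real. -/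

import Mathlib

open scoped ContDiff Matrix Topology LinearAlgebra.Projectivization

namespace IsotropicCongruence

noncomputable section

/-! ### The Darboux hyperquadric and the pseudoconformal space -/

/-- Homogeneous (polyspherical) coordinates `x^0, …, x^{n+1}` of points of `P^{n+1}`. -/
abbrev Vec (K : Type*) (n : ℕ) := Fin (n + 2) → K

/-- The scalar product `x^0 y^0 + … + x^{n-1} y^{n-1} - x^n y^n - x^{n+1} y^{n+1}`, of signature
`(n, 2)`. Its isotropic vectors represent the points of the Darboux hyperquadric `Q^n_1`. -/
def scal {n : ℕ} (x y : Vec ℝ n) : ℝ :=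
  ∑ ξ : Fin (n + 2), (if (ξ : ℕ) < n then 1 else -1) * (x ξ * y ξ)

/-- The Lorentzian form `x^1 y^1 + … + x^{n-1} y^{n-1} - x^n y^n` of the Minkowski space `R^n_1`
(coordinates are numbered from `0`), or its bilinear extension to complex vectors. -/
def mink {K : Type*} [Field K] {n : ℕ} (x y : Fin n → K) : K :=
  ∑ r : Fin n, (if (r : ℕ) + 1 < n then 1 else -1) * (x r * y r)

/-- The Darboux mapping on the Minkowski space: the point `x` goes to the point of `Q^n_1` with
coordinates `((1 - g(x,x))/2, x^1, …, x^n, (1 + g(x,x))/2)`. -/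
def darboux {K : Type*} [Field K] {n : ℕ} (x : Fin n → K) : Vec K n :=
  Fin.cons ((1 - mink x x) / 2) (Fin.snoc (α := fun _ => K) x ((1 + mink x x) / 2))

/-- Linear transformations preserving the scalar product; they induce the conformal
transformations of `C^n_1`. -/
def IsConformal {n : ℕ} (T : Matrix (Fin (n + 2)) (Fin (n + 2)) ℝ) : Prop :=
  ∀ x y : Vec ℝ n, scal (T *ᵥ x) (T *ᵥ y) = scal x y

/-- The Darboux mapping read in a conformal chart of `C^n_1`: the Minkowski space is embedded in
`Q^n_1` by the standard Darboux mapping followed by a conformal transformation `T`. The images of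
these charts cover `Q^n_1`. -/
def chart {K : Type*} [RCLike K] {n : ℕ} (T : Matrix (Fin (n + 2)) (Fin (n + 2)) ℝ)
    (x : Fin n → K) : Vec K n :=
  (T.map (algebraMap ℝ K)) *ᵥ darboux x

/-- Extension of scalars of a real subspace (the subspace itself for `K = ℝ`, its
complexification for `K = ℂ`). -/
def extend (K : Type*) [RCLike K] {n : ℕ} (L : Submodule ℝ (Vec ℝ n)) : Submodule K (Vec K n) :=
  Submodule.span K ((fun (x : Vec ℝ n) ξ => algebraMap ℝ K (x ξ)) '' (L : Set (Vec ℝ n)))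

/-! ### Ruled families and their singular points -/

/-- The linear subspace over the tangent subspace, at the point `X` of the line `ℓ u`, of the
submanifold of `P^{n+1}` swept out by the lines `ℓ v`: it is spanned by the velocities of the
smooth local sections `v ↦ Y v ∈ ℓ v` passing through `X`. -/
def ruledTangent (K : Type*) [RCLike K] {n : ℕ} {F : Type*} [NormedAddCommGroup F]
    [NormedSpace ℝ F] (ℓ : F → Submodule ℝ (Vec ℝ n)) (u : F) (X : Vec K n) :
    Submodule K (Vec K n) :=
  Submodule.span K {z | ∃ (Y : F → Vec K n) (w : F), ContDiffAt ℝ ∞ Y u ∧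
    (∀ᶠ v in 𝓝 u, Y v ∈ extend K (ℓ v)) ∧ Y u = X ∧ z = fderiv ℝ Y u w}

/-- The tangent subspace, at the point with Minkowski coordinates `x` in the conformal chart `T`,
of the submanifold of `C^n_1` swept out by the isotropic lines with Darboux images `ℓ v`. -/
def chartTangent (K : Type*) [RCLike K] {n : ℕ} {F : Type*} [NormedAddCommGroup F]
    [NormedSpace ℝ F] (ℓ : F → Submodule ℝ (Vec ℝ n))
    (T : Matrix (Fin (n + 2)) (Fin (n + 2)) ℝ) (u : F) (x : Fin n → K) :
    Submodule K (Fin n → K) :=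
  Submodule.span K {z | ∃ (y : F → Fin n → K) (w : F), ContDiffAt ℝ ∞ y u ∧
    (∀ᶠ v in 𝓝 u, chart T (y v) ∈ extend K (ℓ v)) ∧ y u = x ∧ z = fderiv ℝ y u w}

/-- The parameter space of an `(n-1)`-parameter family. -/
abbrev Param (n : ℕ) := Fin (n - 1) → ℝ

/-- `P` is a (real or complex) point of the line `ℓ u` at which the projective dimension of the
tangent subspace of the ruled hypersurface is less than `n`. -/
def IsSingularPoint {n : ℕ} (ℓ : Param n → Submodule ℝ (Vec ℝ n)) (u : Param n)
    (P : ℙ ℂ (Vec ℂ n)) : Prop :=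
  P.submodule ≤ extend ℂ (ℓ u) ∧ Module.finrank ℂ (ruledTangent ℂ ℓ u P.rep) < n + 1

/-- The point of `C^n_1` (real or complex) with Minkowski coordinates `x` in the conformal chart
`T` is a singular point of the congruence on the isotropic line `u`: the tangent subspace at `x`
of the set swept out by the lines has dimension less than `n`. -/
def IsSingularInChart {n : ℕ} (ℓ : Param n → Submodule ℝ (Vec ℝ n))
    (T : Matrix (Fin (n + 2)) (Fin (n + 2)) ℝ) (u : Param n) (x : Fin n → ℂ) : Prop :=
  chart T x ∈ extend ℂ (ℓ u) ∧ Module.finrank ℂ (chartTangent ℂ ℓ T u x) < n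

/-- A point of the complex projective space that has real homogeneous coordinates. -/
def IsRealPoint {n : ℕ} (P : ℙ ℂ (Vec ℂ n)) : Prop :=
  ∃ x : Vec ℝ n, x ≠ 0 ∧ (fun ξ => (x ξ : ℂ)) ∈ P.submodule

/-- An isotropic congruence, parametrized by an open set `Ω` of `ℝ^{n-1}`: a smooth
`(n-1)`-parameter family of rectilinear generators of `Q^n_1` (totally isotropic two-dimensional
subspaces), each of which carries a nonsingular real point. -/
structure IsCongruence {n : ℕ} (Ω : Set (Param n)) (ℓ : Param n → Submodule ℝ (Vec ℝ n)) :
    Prop where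
  isOpen : IsOpen Ω
  finrank_eq : ∀ u ∈ Ω, Module.finrank ℝ (ℓ u) = 2
  isotropic : ∀ u ∈ Ω, ∀ x ∈ ℓ u, ∀ y ∈ ℓ u, scal x y = 0
  smooth : ∀ u ∈ Ω, ∃ O ⊆ Ω, IsOpen O ∧ u ∈ O ∧ ∃ B C : Param n → Vec ℝ n,
    ContDiffOn ℝ ∞ B O ∧ ContDiffOn ℝ ∞ C O ∧ ∀ v ∈ O, ℓ v = Submodule.span ℝ {B v, C v}
  regular : ∀ u ∈ Ω, ∃ P : ℙ ℂ (Vec ℂ n),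
    IsRealPoint P ∧ P.submodule ≤ extend ℂ (ℓ u) ∧ ¬ IsSingularPoint ℓ u P

/-! ### Moving frames -/

/-- The index `i + 2`, for the frame elements `A_2, …, A_{n-1}`. -/
def mid {n : ℕ} (i : Fin (n - 2)) : Fin (n + 2) := ⟨i + 2, by omega⟩

/-- The index `n`. -/
def idxN (n : ℕ) : Fin (n + 2) := ⟨n, by omega⟩

/-- The matrix `g_{ij} = (A_i, A_j)`, `i, j = 2, …, n-1`. -/
def gMat {n : ℕ} (A : Fin (n + 2) → Param n → Vec ℝ n) (u : Param n) :
    Matrix (Fin (n - 2)) (Fin (n - 2)) ℝ :=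
  Matrix.of fun i j => scal (A (mid i) u) (A (mid j) u)

/-- A smooth family of frames `A_0, …, A_{n+1}` over the open set `O` such that `A_0 A_1` is the
line `ℓ u`, and the only nonzero scalar products are `(A_0, A_{n+1}) = (A_1, A_n) = -1` and
`(A_i, A_j) = g_{ij}`, `i, j = 2, …, n-1`, with `(g_{ij})` positive definite. -/
structure IsAdaptedFrame {n : ℕ} (ℓ : Param n → Submodule ℝ (Vec ℝ n)) (O : Set (Param n))
    (A : Fin (n + 2) → Param n → Vec ℝ n) : Prop where
  isOpen : IsOpen O
  smooth : ∀ ξ, ContDiffOn ℝ ∞ (A ξ) O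
  span_eq : ∀ u ∈ O, ℓ u = Submodule.span ℝ {A 0 u, A 1 u}
  s00 : ∀ u ∈ O, scal (A 0 u) (A 0 u) = 0
  s01 : ∀ u ∈ O, scal (A 0 u) (A 1 u) = 0
  s0i : ∀ u ∈ O, ∀ i, scal (A 0 u) (A (mid i) u) = 0
  s0n : ∀ u ∈ O, scal (A 0 u) (A (idxN n) u) = 0
  s0l : ∀ u ∈ O, scal (A 0 u) (A (Fin.last (n + 1)) u) = -1
  s11 : ∀ u ∈ O, scal (A 1 u) (A 1 u) = 0
  s1i : ∀ u ∈ O, ∀ i, scal (A 1 u) (A (mid i) u) = 0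
  s1n : ∀ u ∈ O, scal (A 1 u) (A (idxN n) u) = -1
  s1l : ∀ u ∈ O, scal (A 1 u) (A (Fin.last (n + 1)) u) = 0
  sij : ∀ u ∈ O, (gMat A u).PosDef
  sin : ∀ u ∈ O, ∀ i, scal (A (mid i) u) (A (idxN n) u) = 0
  sil : ∀ u ∈ O, ∀ i, scal (A (mid i) u) (A (Fin.last (n + 1)) u) = 0
  snn : ∀ u ∈ O, scal (A (idxN n) u) (A (idxN n) u) = 0
  snl : ∀ u ∈ O, scal (A (idxN n) u) (A (Fin.last (n + 1)) u) = 0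
  sll : ∀ u ∈ O, scal (A (Fin.last (n + 1)) u) (A (Fin.last (n + 1)) u) = 0

/-- The forms `ω_ξ^η` of the infinitesimal displacement `dA_ξ = ω_ξ^η A_η` of the frame, at the
point `u` and on the tangent vector `w`. -/
def conn {n : ℕ} (A : Fin (n + 2) → Param n → Vec ℝ n) (u w : Param n) :
    Matrix (Fin (n + 2)) (Fin (n + 2)) ℝ :=
  Matrix.of (fun ξ => fderiv ℝ (A ξ) u w) * (Matrix.of fun ξ => A ξ u)⁻¹

/-- The `n - 1` forms `ω_0^i` (`i = 2, …, n-1`) and `ω_0^n` are linearly independent at `u`,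
that is, they are basis forms: their common kernel on the `(n-1)`-dimensional tangent space is
zero. -/
def BasisForms {n : ℕ} (A : Fin (n + 2) → Param n → Vec ℝ n) (u : Param n) : Prop :=
  ∀ w, (∀ i : Fin (n - 2), conn A u w 0 (mid i) = 0) → conn A u w 0 (idxN n) = 0 → w = 0

/-- The equations `ω_1^i = λ^i_j ω_0^j + λ^i ω_0^n` at `u`; here `Λ i j` is `λ^i_j`. -/
def IsAffinor {n : ℕ} (A : Fin (n + 2) → Param n → Vec ℝ n) (u : Param n)
    (Λ : Matrix (Fin (n - 2)) (Fin (n - 2)) ℝ) (μ : Fin (n - 2) → ℝ) : Prop :=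
  ∀ w i, conn A u w 1 (mid i) =
    ∑ j, Λ i j * conn A u w 0 (mid j) + μ i * conn A u w 0 (idxN n)

/-- The affinor `λ^i_j` is symmetric with respect to `g`: `g_{ik} λ^k_j = g_{jk} λ^k_i`. -/
def IsSymmetricAffinor {n : ℕ} (A : Fin (n + 2) → Param n → Vec ℝ n) (u : Param n)
    (Λ : Matrix (Fin (n - 2)) (Fin (n - 2)) ℝ) : Prop :=
  (gMat A u * Λ).IsSymm

/-- The polynomial `det (λ^i_j + x δ^i_j)` in `x`, over the complex numbers. -/
def singularPoly {n : ℕ} (Λ : Matrix (Fin (n - 2)) (Fin (n - 2)) ℝ) : Polynomial ℂ :=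
  (Λ.map (fun a => Polynomial.C (a : ℂ)) +
    (Polynomial.X : Polynomial ℂ) • (1 : Matrix (Fin (n - 2)) (Fin (n - 2)) (Polynomial ℂ))).det

/-- The vector `A_1 + x A_0`, for complex `x`. -/
def pointOn {n : ℕ} (A : Fin (n + 2) → Param n → Vec ℝ n) (u : Param n) (x : ℂ) : Vec ℂ n :=
  fun ξ => (A 1 u ξ : ℂ) + x * (A 0 u ξ : ℂ)

/-- `D` is the multiset of the points `A_1 + x A_0`, where `x` runs through the complex roots of
`det (λ^i_j + x δ^i_j)` with their multiplicities. -/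
def IsRootDivisor {n : ℕ} (A : Fin (n + 2) → Param n → Vec ℝ n) (u : Param n)
    (Λ : Matrix (Fin (n - 2)) (Fin (n - 2)) ℝ) (D : Multiset (ℙ ℂ (Vec ℂ n))) : Prop :=
  D.map Projectivization.submodule =
    (singularPoly Λ).roots.map (fun x => Submodule.span ℂ {pointOn A u x})

/-! ### Complete integrability and lightlike hypersurfaces -/

/-- The exterior derivative at `u`, on the vectors `w₁, w₂`, of the 1-form `θ v w` (`v` the point,
`w` the vector). -/
def dForm {n : ℕ} (θ : Param n → Param n → ℝ) (u w₁ w₂ : Param n) : ℝ :=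
  fderiv ℝ (fun v => θ v w₂) u w₁ - fderiv ℝ (fun v => θ v w₁) u w₂

/-- `dθ ∧ θ = 0` at `u`. -/
def FrobeniusAt {n : ℕ} (θ : Param n → Param n → ℝ) (u : Param n) : Prop :=
  ∀ w₁ w₂ w₃, dForm θ u w₁ w₂ * θ u w₃ + dForm θ u w₂ w₃ * θ u w₁ + dForm θ u w₃ w₁ * θ u w₂ = 0

/-- The equation `ω_0^n = 0` is completely integrable on the congruence: `dω_0^n ∧ ω_0^n = 0`.
A change of the adapted frame multiplies `ω_0^n` by a nonvanishing function, so it suffices to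
require this for one adapted frame near each line. -/
def CompletelyIntegrable {n : ℕ} (Ω : Set (Param n)) (ℓ : Param n → Submodule ℝ (Vec ℝ n)) :
    Prop :=
  ∀ u ∈ Ω, ∃ O ⊆ Ω, u ∈ O ∧ ∃ A, IsAdaptedFrame ℓ O A ∧
    ∀ v ∈ O, FrobeniusAt (fun v w => conn A v w 0 (idxN n)) v

/-- A hyperplane of the Minkowski space tangent to the isotropic cone: the form restricted to it
is positive semidefinite of signature `(n-2, 0)`, vanishing along a single isotropic direction. -/
def IsLightlikeHyperplane {n : ℕ} (W : Submodule ℝ (Fin n → ℝ)) : Prop :=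
  Module.finrank ℝ W = n - 1 ∧
    ∃ z₀ ∈ W, z₀ ≠ 0 ∧ ∀ z ∈ W, 0 ≤ mink z z ∧ (mink z z = 0 ↔ z ∈ Submodule.span ℝ {z₀})

/-- The integral manifolds of `ω_0^n = 0` stratify the congruence into lightlike hypersurfaces:
near each line there are smooth coordinates `(y, c)`, with `y ∈ ℝ^{n-2}` and `c ∈ ℝ`, such that
the slices `c = const` are integral manifolds of `ω_0^n = 0`, and the submanifold of `C^n_1` swept
out by the lines of a slice is a lightlike hypersurface at each of its points that is not singular
for the congruence. -/
def StratifiedIntoLightlike {n : ℕ} (Ω : Set (Param n)) (ℓ : Param n → Submodule ℝ (Vec ℝ n)) :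
    Prop :=
  ∀ u ∈ Ω, ∃ Φ : OpenPartialHomeomorph ((Fin (n - 2) → ℝ) × ℝ) (Param n),
    u ∈ Φ.target ∧ Φ.target ⊆ Ω ∧
    ContDiffOn ℝ ∞ Φ Φ.source ∧ ContDiffOn ℝ ∞ Φ.symm Φ.target ∧
    ∀ y c, (y, c) ∈ Φ.source →
      (∀ O A, IsAdaptedFrame ℓ O A → Φ (y, c) ∈ O →
        ∀ η : Fin (n - 2) → ℝ,
          conn A (Φ (y, c)) (fderiv ℝ Φ (y, c) (η, 0)) 0 (idxN n) = 0) ∧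
      (∀ T, IsConformal T → ∀ x : Fin n → ℝ, chart T x ∈ ℓ (Φ (y, c)) →
        ¬ IsSingularInChart ℓ T (Φ (y, c)) (fun r => (x r : ℂ)) →
        IsLightlikeHyperplane (chartTangent ℝ (fun y' => ℓ (Φ (y', c))) T y x))

end

end IsotropicCongruence

/-! Differentiating the scalar products of an adapted frame gives ω_0^{n+1} = 0, ω_1^n = 0 and
ω_1^{n+1} = -ω_0^n. The tangent subspace at pA_0 + qA_1 is spanned by A_0, A_1 and the vectors p
dA_0 + q dA_1, whose A_n and A_{n+1} components are pω_0^n and -qω_0^n. Its dimension therefore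
drops exactly when some nonzero complex parameter vector is annihilated by ω_0^n and by every pω_0^i
+ qω_1^i (`finrank_ruledTangent_lt_iff`). At q = 0 this is dependence of the ω_0^i, ω_0^n, so a
frame with A_0 at a real nonsingular point has basis forms. In a frame with basis forms the
condition reads det(p + qλ) = 0, a binary form of degree n - 2 not vanishing at q = 0, hence n - 2
points with multiplicity. A second frame changes (A_0, A_1) by an invertible matrix (a, b; c, d),
and λ'C(a + bλ) = C(c + dλ) for a suitable C; the roots undergo the matching fractional linear
substitution, which yields the same points (`affinor_change`, `isRootDivisor_change`).

A section of the lines, divided by the linear functional that equals 1 on a chart, is a Darboux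
image. Velocities in the quadric thus differ from those in the chart only by multiples of the point
itself, and the two dimensions differ by exactly one (`finrank_ruledTangent_chart`).

Since ω_0^n = -(dA_0, A_1), on its kernel dω_0^n(w₁, w₂) is the antisymmetrization of g_ij ω_0^i(w₁)
ω_1^j(w₂). Integrability forces gλ to be symmetric, and an affinor self-adjoint for a positive
definite g has only real eigenvalues. The leaves come from the Frobenius theorem for one equation
(`exists_foliated_chart`), proved by solving the integral equation along rays with the inverse
function theorem in a space of continuous curves. Tangent vectors along a leaf have no A_n, A_{n+1}
components, so the form reduces on them to g on the middle components; only the direction of the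
line is null (`isLightlikeHyperplane_slice`).

For the examples, an explicit polynomial family of frames realizes an arbitrary constant matrix as λ
(`modelFrame`). A quarter turn in a coordinate plane produces a root i; a complex structure on
ℝ^{n-2}, available for even n, makes all roots non-real. -/

open scoped ContDiff Matrix Topology LinearAlgebra.Projectivization

namespace IsotropicCongruence

noncomputable section

/-! ### Smoothness of superposition operators -/

section Superposition

universe v

variable {K : Type*} [TopologicalSpace K] [CompactSpace K] {V W : Type v}
  [NormedAddCommGroup V] [NormedSpace ℝ V] [NormedAddCommGroup W] [NormedSpace ℝ W]

/-- Pointwise application of a continuous family of continuous linear maps. -/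
def pointwiseApply : C(K, V →L[ℝ] W) →L[ℝ] C(K, V) →L[ℝ] C(K, W) :=
  LinearMap.mkContinuous₂
    (LinearMap.mk₂ ℝ (fun (L : C(K, V →L[ℝ] W)) (h : C(K, V)) =>
        (⟨fun t => L t (h t), by fun_prop⟩ : C(K, W)))
      (by intros; ext; simp) (by intros; ext; simp) (by intros; ext; simp)
      (by intros; ext; simp)) 1 (by
      intro L h
      rw [ContinuousMap.norm_le _ (by positivity)]
      intro t
      simp only [LinearMap.mk₂_apply, ContinuousMap.coe_mk, one_mul]
      exact ((L t).le_opNorm _).trans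
        (mul_le_mul (L.norm_coe_le_norm t) (h.norm_coe_le_norm t) (norm_nonneg _) (by positivity)))

@[simp]
theorem pointwiseApply_apply (L : C(K, V →L[ℝ] W)) (h : C(K, V)) (t : K) :
    pointwiseApply L h t = L t (h t) := rfl

theorem contDiff_pointwiseApply {k : WithTop ℕ∞} :
    ContDiff ℝ k fun L : C(K, V →L[ℝ] W) => (pointwiseApply L : C(K, V) →L[ℝ] C(K, W)) :=
  ContinuousLinearMap.contDiff _

/-- The image of g is compact, so the derivative of f is uniformly continuous around it. The mean
value inequality on the segments [g t, g t + h t] then bounds the remainder by ε‖h‖, uniformly in t.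
-/
theorem hasFDerivAt_superposition {f : V → W} (hf : ContDiff ℝ 1 f) (g : C(K, V)) :
    HasFDerivAt (fun g : C(K, V) => (⟨f, hf.continuous⟩ : C(V, W)).comp g)
      (pointwiseApply ((⟨fderiv ℝ f, hf.continuous_fderiv one_ne_zero⟩ : C(V, V →L[ℝ] W)).comp g))
      g := by
  rw [hasFDerivAt_iff_isLittleO_nhds_zero, Asymptotics.isLittleO_iff]
  intro ε hε
  have hc : IsCompact (Set.range g) := isCompact_range g.continuous
  have hu := hc.uniformContinuousAt_of_continuousAt (fderiv ℝ f)
    (fun x _ => (hf.continuous_fderiv one_ne_zero).continuousAt) (Metric.dist_mem_uniformity hε)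
  obtain ⟨δ, hδ, hu⟩ := Metric.mem_uniformity_dist.1 hu
  filter_upwards [Metric.ball_mem_nhds (0 : C(K, V)) hδ] with h hh
  rw [mem_ball_zero_iff] at hh
  rw [ContinuousMap.norm_le _ (by positivity)]
  intro t
  have hb : ∀ y ∈ segment ℝ (g t) (g t + h t), ‖fderiv ℝ f y - fderiv ℝ f (g t)‖ ≤ ε := by
    intro y hy
    have hd : dist (g t) y < δ := by
      have : y ∈ Metric.closedBall (g t) ‖h t‖ :=
        (convex_closedBall _ _).segment_subset (by simp) (by simp) hy
      rw [dist_comm]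
      exact (Metric.mem_closedBall.1 this).trans_lt ((h.norm_coe_le_norm t).trans_lt hh)
    have := hu hd ⟨t, rfl⟩
    simp only [Set.mem_ofPred_eq] at this
    rw [dist_comm, dist_eq_norm] at this
    exact this.le
  have := (convex_segment (g t) (g t + h t)).norm_image_sub_le_of_norm_hasFDerivWithin_le'
    (fun y _ => ((hf.differentiable one_ne_zero) y).hasFDerivAt.hasFDerivWithinAt) hb
    (left_mem_segment _ _ _) (right_mem_segment _ _ _)
  simp only [add_sub_cancel_left] at this
  simp only [ContinuousMap.sub_apply, ContinuousMap.comp_apply, ContinuousMap.add_apply,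
    ContinuousMap.coe_mk, pointwiseApply_apply]
  exact this.trans (mul_le_mul_of_nonneg_left (h.norm_coe_le_norm t) hε.le)

/-- Induction on k: the derivative is the superposition operator of `fderiv ℝ f` followed by the
bounded linear map `pointwiseApply`. The target becomes V →L[ℝ] W, so the spaces are quantified
inside the induction and share one universe. -/
theorem contDiff_superposition_nat (k : ℕ) : ∀ {V W : Type v}
    [NormedAddCommGroup V] [NormedSpace ℝ V] [NormedAddCommGroup W] [NormedSpace ℝ W]
    {f : V → W} (hf : ContDiff ℝ ∞ f),
    ContDiff ℝ k (fun g : C(K, V) => (⟨f, hf.continuous⟩ : C(V, W)).comp g) := by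
  induction k with
  | zero =>
    intro V W _ _ _ _ f hf
    exact contDiff_zero.2 (ContinuousMap.continuous_postcomp _)
  | succ k ih =>
    intro V W _ _ _ _ f hf
    have hf' : ContDiff ℝ ∞ (fderiv ℝ f) := hf.fderiv_right (by simp)
    refine contDiff_succ_iff_hasFDerivAt.2
      ⟨fun g => pointwiseApply ((⟨fderiv ℝ f, hf'.continuous⟩ : C(V, V →L[ℝ] W)).comp g),
        contDiff_pointwiseApply.comp (ih hf'), fun g =>
        hasFDerivAt_superposition (hf.of_le (by simp)) g⟩

theorem contDiff_superposition {f : V → W} (hf : ContDiff ℝ ∞ f) :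
    ContDiff ℝ ∞ (fun g : C(K, V) => (⟨f, hf.continuous⟩ : C(V, W)).comp g) :=
  contDiff_infty.2 fun k => contDiff_superposition_nat k hf

end Superposition

/-! ### Local inverses and extensions of smooth maps -/

/-- The inverse function theorem gives smoothness of the inverse at one point only. Invertible
operators form an open set, so the source can be shrunk until the derivative is invertible
throughout, which makes the inverse smooth on the whole target. -/
theorem exists_smooth_local_inverse {E F : Type*} [NormedAddCommGroup E] [NormedSpace ℝ E]
    [CompleteSpace E] [NormedAddCommGroup F] [NormedSpace ℝ F] {f : E → F} {U : Set E}
    (hU : IsOpen U) (hf : ContDiffOn ℝ ∞ f U) {a : E} (ha : a ∈ U) (f' : E ≃L[ℝ] F)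
    (hf' : HasFDerivAt f (f' : E →L[ℝ] F) a) :
    ∃ Φ : OpenPartialHomeomorph E F, (Φ : E → F) = f ∧ a ∈ Φ.source ∧ Φ.source ⊆ U ∧
      ContDiffOn ℝ ∞ Φ.symm Φ.target := by
  have hfa : ContDiffAt ℝ ∞ f a := hf.contDiffAt (hU.mem_nhds ha)
  have hcont : ContinuousOn (fderiv ℝ f) U := hf.continuousOn_fderiv_of_isOpen hU (by simp)
  have hinv : {x ∈ U | ∃ e : E ≃L[ℝ] F, (e : E →L[ℝ] F) = fderiv ℝ f x} ∈ 𝓝 a := by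
    have h1 := (hcont.continuousAt (hU.mem_nhds ha)).preimage_mem_nhds
      (by rw [hf'.fderiv]; exact ContinuousLinearEquiv.nhds f')
    filter_upwards [hU.mem_nhds ha, h1] with x hx h2
    exact ⟨hx, h2⟩
  obtain ⟨V, hVs, hVo, haV⟩ := mem_nhds_iff.1 hinv
  let Φ₀ := hfa.toOpenPartialHomeomorph f hf' (by simp)
  let Φ := Φ₀.restrOpen V hVo
  have hsrc : Φ.source = Φ₀.source ∩ V := rfl
  have hcoe : (Φ : E → F) = f := rfl
  refine ⟨Φ, hcoe, ?_, fun x hx => (hVs hx.2).1, ?_⟩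
  · exact ⟨hfa.mem_toOpenPartialHomeomorph_source hf' (by simp), haV⟩
  · intro y hy
    have hx : Φ.symm y ∈ V := (Φ.map_target hy).2
    obtain ⟨hxU, e, he⟩ := hVs hx
    have hca : ContDiffAt ℝ ∞ f (Φ.symm y) := hf.contDiffAt (hU.mem_nhds hxU)
    refine (Φ.contDiffAt_symm (f₀' := e) hy ?_ ?_).contDiffWithinAt
    · rw [he, hcoe]
      exact (hca.differentiableAt (by simp)).hasFDerivAt
    · rw [hcoe]; exact hca

/-- Multiplication by a bump function supported inside U. It allows the ray equation to be treated
with globally defined coefficients. -/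
theorem exists_contDiff_eventuallyEq {E F : Type*} [NormedAddCommGroup E] [NormedSpace ℝ E]
    [FiniteDimensional ℝ E] [NormedAddCommGroup F] [NormedSpace ℝ F] {f : E → F} {U : Set E}
    (hU : IsOpen U) (hf : ContDiffOn ℝ ∞ f U) {a : E} (ha : a ∈ U) :
    ∃ g : E → F, ContDiff ℝ ∞ g ∧ g =ᶠ[𝓝 a] f := by
  obtain ⟨r, hr, hrU⟩ := Metric.isOpen_iff.1 hU a ha
  let χ : ContDiffBump a := ⟨r / 4, r / 2, by positivity, by linarith⟩
  refine ⟨fun x => χ x • f x, contDiff_iff_contDiffAt.2 fun x => ?_, ?_⟩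
  · by_cases hx : x ∈ U
    · exact χ.contDiff.contDiffAt.smul (hf.contDiffAt (hU.mem_nhds hx))
    · have hx' : x ∉ tsupport χ := by
        rw [χ.tsupport_eq]
        exact fun h => hx (hrU (Metric.closedBall_subset_ball (by simp [χ]; linarith) h))
      refine contDiffAt_const (c := (0 : F)) |>.congr_of_eventuallyEq ?_
      filter_upwards [(isClosed_tsupport χ).isOpen_compl.mem_nhds hx'] with y hy
      rw [image_eq_zero_of_notMem_tsupport hy, zero_smul]
  · filter_upwards [χ.eventuallyEq_one] with x hx
    simp [hx]

/-! ### The integral equation of a Pfaffian system along rays -/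

/-- The primitive vanishing at `0` of a continuous function on `[0, 1]`, as a function on `ℝ`. -/
def primitive (z : C(unitInterval, ℝ)) (t : ℝ) : ℝ :=
  ∫ s in (0 : ℝ)..t, Set.IccExtend zero_le_one z s

theorem hasDerivAt_primitive (z : C(unitInterval, ℝ)) (t : ℝ) :
    HasDerivAt (primitive z) (Set.IccExtend zero_le_one z t) t :=
  (z.continuous.Icc_extend' (h := zero_le_one)).integral_hasStrictDerivAt 0 t |>.hasDerivAt

/-- The primitive vanishing at `0`, as an operator on continuous functions on `[0, 1]`. -/
def primitiveCLM : C(unitInterval, ℝ) →L[ℝ] C(unitInterval, ℝ) :=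
  LinearMap.mkContinuous
    { toFun := fun z => ⟨fun t => primitive z t, by
        have : Continuous (primitive z) := continuous_iff_continuousAt.2
          fun t => (hasDerivAt_primitive z t).continuousAt
        fun_prop⟩
      map_add' := fun x y => by
        ext t
        simp only [ContinuousMap.coe_mk, ContinuousMap.add_apply, primitive]
        rw [← intervalIntegral.integral_add]
        · rfl
        · exact (x.continuous.Icc_extend' (h := zero_le_one)).intervalIntegrable _ _
        · exact (y.continuous.Icc_extend' (h := zero_le_one)).intervalIntegrable _ _
      map_smul' := fun c x => by
        ext t
        simp only [ContinuousMap.coe_mk, ContinuousMap.smul_apply, primitive, RingHom.id_apply]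
        rw [← intervalIntegral.integral_smul]
        rfl } 1 (by
    intro z
    rw [ContinuousMap.norm_le _ (by positivity)]
    intro t
    have := intervalIntegral.norm_integral_le_of_norm_le_const (a := 0) (b := (t : ℝ))
      (C := ‖z‖) (f := Set.IccExtend zero_le_one z) fun s _ => z.norm_coe_le_norm _
    refine this.trans ?_
    rw [sub_zero, abs_of_nonneg t.2.1, one_mul]
    exact mul_le_of_le_one_right (norm_nonneg z) t.2.2)

theorem primitiveCLM_apply (z : C(unitInterval, ℝ)) (t : unitInterval) :
    primitiveCLM z t = primitive z t := rfl

variable {W : Type} [NormedAddCommGroup W] [NormedSpace ℝ W]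

/-- The curve `t ↦ ((t y, z t), y)`. -/
def rayLift : W × C(unitInterval, ℝ) →L[ℝ] C(unitInterval, (W × ℝ) × W) :=
  LinearMap.mkContinuous
    { toFun := fun p => ⟨fun t => (((t : ℝ) • p.1, p.2 t), p.1), by fun_prop⟩
      map_add' := fun x y => by ext t <;> simp
      map_smul' := fun c x => by ext t <;> simp [smul_smul, mul_comm] } 1 (by
    intro p
    rw [ContinuousMap.norm_le _ (by positivity)]
    intro t
    simp only [LinearMap.coe_mk, AddHom.coe_mk, ContinuousMap.coe_mk, one_mul, Prod.norm_def,
      norm_smul, Real.norm_eq_abs, abs_of_nonneg t.2.1]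
    have h1 : (t : ℝ) * ‖p.1‖ ≤ ‖p.1‖ := mul_le_of_le_one_left (norm_nonneg _) t.2.2
    have h2 := p.2.norm_coe_le_norm t
    rw [Real.norm_eq_abs] at h2
    exact max_le (max_le (h1.trans (le_max_left _ _)) (h2.trans (le_max_right _ _)))
      (le_max_left _ _))

theorem contDiff_rayLift : ContDiff ℝ ∞ (rayLift (W := W)) :=
  ContinuousLinearMap.contDiff _

theorem hasFDerivAt_rayLift (p : W × C(unitInterval, ℝ)) :
    HasFDerivAt (rayLift (W := W)) rayLift p :=
  ContinuousLinearMap.hasFDerivAt _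

/-! ### The superposition operator along rays and its derivative. -/

section RayOperator

variable {a : W × ℝ → W →L[ℝ] ℝ}

theorem contDiff_eval_form (ha : ContDiff ℝ ∞ a) :
    ContDiff ℝ ∞ fun q : (W × ℝ) × W => a q.1 q.2 :=
  (ha.comp contDiff_fst).clm_apply contDiff_snd

theorem fderiv_eval_form (ha : ContDiff ℝ ∞ a) (q q' : (W × ℝ) × W) :
    fderiv ℝ (fun q : (W × ℝ) × W => a q.1 q.2) q q' = fderiv ℝ a q.1 q'.1 q.2 + a q.1 q'.2 := by
  have h1 : HasFDerivAt (fun q : (W × ℝ) × W => a q.1)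
      ((fderiv ℝ a q.1).comp (ContinuousLinearMap.fst ℝ (W × ℝ) W)) q :=
    (ha.differentiable (by simp) q.1).hasFDerivAt.comp q hasFDerivAt_fst
  have h2 := h1.clm_apply (hasFDerivAt_snd (𝕜 := ℝ) (p := q))
  rw [h2.fderiv]
  simp [add_comm]

/-- The operator `(y, z) ↦ (t ↦ a(t y, z t) y)`. -/
def rayOperator (ha : ContDiff ℝ ∞ a) (p : W × C(unitInterval, ℝ)) : C(unitInterval, ℝ) :=
  (⟨_, (contDiff_eval_form ha).continuous⟩ : C((W × ℝ) × W, ℝ)).comp (rayLift p)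

theorem contDiff_rayOperator (ha : ContDiff ℝ ∞ a) : ContDiff ℝ ∞ (rayOperator ha) :=
  (contDiff_superposition (contDiff_eval_form ha)).comp contDiff_rayLift

theorem fderiv_rayOperator (ha : ContDiff ℝ ∞ a) (p q : W × C(unitInterval, ℝ))
    (t : unitInterval) :
    fderiv ℝ (rayOperator ha) p q t =
      fderiv ℝ a ((t : ℝ) • p.1, p.2 t) ((t : ℝ) • q.1, q.2 t) p.1 +
        a ((t : ℝ) • p.1, p.2 t) q.1 := by
  have h := (hasFDerivAt_superposition ((contDiff_eval_form ha).of_le (by simp))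
    (rayLift p)).comp p (hasFDerivAt_rayLift p)
  have h' : HasFDerivAt (rayOperator ha) _ p := h
  rw [h'.fderiv]
  simp only [ContinuousLinearMap.comp_apply, pointwiseApply_apply, ContinuousMap.comp_apply,
    ContinuousMap.coe_mk]
  rw [fderiv_eval_form ha]
  rfl

end RayOperator

/-- Local solvability, with smooth dependence on `(y, c)`, of the equations
`z t = c + ∫₀ᵗ a(s y, z s) y ds`. -/
theorem exists_smooth_raySolution [CompleteSpace W] {a : W × ℝ → W →L[ℝ] ℝ}
    (ha : ContDiff ℝ ∞ a) :
    ∃ (U : Set (W × ℝ)) (Z : W × ℝ → C(unitInterval, ℝ)), IsOpen U ∧ 0 ∈ U ∧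
      ContDiffOn ℝ ∞ Z U ∧ Z 0 = 0 ∧
      ∀ q ∈ U, Z q = ContinuousMap.const _ q.2 + primitiveCLM (rayOperator ha (q.1, Z q)) := by
  let cst : ℝ →L[ℝ] C(unitInterval, ℝ) := ContinuousLinearMap.const ℝ unitInterval
  let N : (W × ℝ) × C(unitInterval, ℝ) → C(unitInterval, ℝ) :=
    fun p => rayOperator ha (p.1.1, p.2)
  have hN : ContDiff ℝ ∞ N := (contDiff_rayOperator ha).comp
    ((contDiff_fst.comp contDiff_fst).prodMk contDiff_snd)
  -- G keeps the parameters (y, c) and replaces the curve by its defect in the integral equation;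
  -- solutions are the preimages of points (q, 0).
  let G : (W × ℝ) × C(unitInterval, ℝ) → (W × ℝ) × C(unitInterval, ℝ) :=
    fun p => (p.1, p.2 - cst p.1.2 - primitiveCLM (N p))
  have hG : ContDiff ℝ ∞ G := contDiff_fst.prodMk ((contDiff_snd.sub
    (cst.contDiff.comp (contDiff_snd.comp contDiff_fst))).sub (primitiveCLM.contDiff.comp hN))
  let pr : (W × ℝ) × C(unitInterval, ℝ) →L[ℝ] W × C(unitInterval, ℝ) :=
    ((ContinuousLinearMap.fst ℝ W ℝ).comp (ContinuousLinearMap.fst ℝ _ _)).prod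
      (ContinuousLinearMap.snd ℝ _ _)
  -- The derivative of G at 0 is triangular, with identity diagonal blocks and B below the diagonal.
  let B : W × ℝ →L[ℝ] C(unitInterval, ℝ) :=
    - cst.comp (ContinuousLinearMap.snd ℝ W ℝ) -
      primitiveCLM.comp (((fderiv ℝ (rayOperator ha) 0).comp
        (ContinuousLinearMap.inl ℝ W _)).comp (ContinuousLinearMap.fst ℝ W ℝ))
  let e := ContinuousLinearEquiv.skewProd (ContinuousLinearEquiv.refl ℝ (W × ℝ))
    (ContinuousLinearEquiv.refl ℝ C(unitInterval, ℝ)) B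
  have hNd : HasFDerivAt N ((fderiv ℝ (rayOperator ha) 0).comp pr) 0 := by
    have h1 : HasFDerivAt (rayOperator ha) (fderiv ℝ (rayOperator ha) 0) (pr 0) := by
      rw [map_zero]
      exact ((contDiff_rayOperator ha).differentiable (by simp) 0).hasFDerivAt
    exact h1.comp 0 pr.hasFDerivAt
  have hGd : HasFDerivAt G (e : _ →L[ℝ] _) 0 := by
    have h := (hasFDerivAt_fst (𝕜 := ℝ) (p := (0 : (W × ℝ) × C(unitInterval, ℝ)))).prodMk
      (((hasFDerivAt_snd (𝕜 := ℝ)).sub (cst.hasFDerivAt.comp _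
        ((hasFDerivAt_snd (𝕜 := ℝ)).comp _ (hasFDerivAt_fst (𝕜 := ℝ))))).sub
          (primitiveCLM.hasFDerivAt.comp _ hNd))
    refine h.congr_fderiv ?_
    refine ContinuousLinearMap.ext fun p => Prod.ext rfl ?_
    -- The operator is linear in y through its last argument, so at y = 0 its derivative in the
    -- direction of the curve vanishes.
    have hsplit : fderiv ℝ (rayOperator ha) 0 (pr p) =
        fderiv ℝ (rayOperator ha) 0 (p.1.1, 0) := by
      refine ContinuousMap.ext fun t => ?_
      rw [fderiv_rayOperator, fderiv_rayOperator]
      simp [pr]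
    simp only [e, B, ContinuousLinearMap.prod_apply, _root_.sub_apply,
      ContinuousLinearMap.comp_apply, ContinuousLinearEquiv.coe_coe,
      ContinuousLinearEquiv.skewProd_apply, _root_.neg_apply,
      ContinuousLinearMap.inl_apply, ContinuousLinearMap.coe_fst', ContinuousLinearMap.coe_snd',
      hsplit, ContinuousLinearEquiv.refl_apply]
    abel
  obtain ⟨Φ, hΦ, h0, -, hsymm⟩ := exists_smooth_local_inverse isOpen_univ hG.contDiffOn
    (Set.mem_univ 0) e hGd
  have hG0 : G 0 = 0 := by
    refine Prod.ext rfl (ContinuousMap.ext fun t => ?_)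
    have : N 0 = 0 := ContinuousMap.ext fun t => by
      change a _ (0 : W) = 0
      simp
    simp [G, this]
  have h0' : (0 : (W × ℝ) × C(unitInterval, ℝ)) ∈ Φ.target := by
    have := Φ.map_source h0
    rwa [hΦ, hG0] at this
  have hcont : Continuous fun q : W × ℝ => (q, (0 : C(unitInterval, ℝ))) := by fun_prop
  refine ⟨(fun q => (q, (0 : C(unitInterval, ℝ)))) ⁻¹' Φ.target,
    fun q => (Φ.symm (q, 0)).2, Φ.open_target.preimage hcont, h0', ?_, ?_, ?_⟩
  · exact (contDiff_snd.comp_contDiffOn hsymm).comp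
      (contDiff_id.prodMk contDiff_const).contDiffOn fun q hq => hq
  · have := Φ.left_inv h0
    rw [hΦ, hG0] at this
    change (Φ.symm 0).2 = 0
    rw [this]; rfl
  · intro q hq
    have h := Φ.right_inv (show (q, 0) ∈ Φ.target from hq)
    rw [hΦ] at h
    have h1 : (Φ.symm (q, 0)).1 = q := congrArg Prod.fst h
    have h2 := congrArg Prod.snd h
    simp only [G, N, h1] at h2
    rw [sub_sub, sub_eq_zero] at h2
    exact h2

/-! ### Integration of an involutive Pfaffian equation -/

variable {W : Type} [NormedAddCommGroup W] [NormedSpace ℝ W]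

/-- The equations of variation of the integral equation along rays. -/
theorem fderiv_raySolution {a : W × ℝ → W →L[ℝ] ℝ} (ha : ContDiff ℝ ∞ a)
    {U : Set (W × ℝ)} {Z : W × ℝ → C(unitInterval, ℝ)} (hU : IsOpen U) (hZ : ContDiffOn ℝ ∞ Z U)
    (hsol : ∀ q ∈ U, Z q = ContinuousMap.const _ q.2 + primitiveCLM (rayOperator ha (q.1, Z q)))
    {q : W × ℝ} (hq : q ∈ U) (w : W × ℝ) :
    fderiv ℝ Z q w = ContinuousMap.const _ w.2 +
      primitiveCLM (fderiv ℝ (rayOperator ha) (q.1, Z q) (w.1, fderiv ℝ Z q w)) := by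
  let cst : ℝ →L[ℝ] C(unitInterval, ℝ) := ContinuousLinearMap.const ℝ unitInterval
  have hZq : HasFDerivAt Z (fderiv ℝ Z q) q :=
    ((hZ.contDiffAt (hU.mem_nhds hq)).differentiableAt (by simp)).hasFDerivAt
  have h1 : HasFDerivAt (fun q : W × ℝ => (q.1, Z q)) _ q :=
    (hasFDerivAt_fst (𝕜 := ℝ)).prodMk hZq
  have h2 : HasFDerivAt (rayOperator ha) (fderiv ℝ (rayOperator ha) (q.1, Z q)) (q.1, Z q) :=
    ((contDiff_rayOperator ha).differentiable (by simp) _).hasFDerivAt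
  have h3 := (cst.hasFDerivAt.comp q (hasFDerivAt_snd (𝕜 := ℝ))).add
    (primitiveCLM.hasFDerivAt.comp q (h2.comp q h1))
  have h4 : Z =ᶠ[𝓝 q] fun q => cst q.2 + primitiveCLM (rayOperator ha (q.1, Z q)) := by
    filter_upwards [hU.mem_nhds hq] with p hp using hsol p hp
  have h5 := hZq.unique (h3.congr_of_eventuallyEq h4)
  exact congrArg (fun L : W × ℝ →L[ℝ] C(unitInterval, ℝ) => L w) h5

/-- Let π be the variation of the solution in the direction η. The difference m(t) = π(t) - t a(ty,
z(t))η starts at 0, and the involutivity condition turns the equation of variation into m' = βm.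
Grönwall's inequality gives m = 0, and t = 1 is the assertion. -/
theorem fderiv_raySolution_eq {a : W × ℝ → W →L[ℝ] ℝ} (ha : ContDiff ℝ ∞ a)
    {U : Set (W × ℝ)} {Z : W × ℝ → C(unitInterval, ℝ)} (hU : IsOpen U) (hZ : ContDiffOn ℝ ∞ Z U)
    (hsol : ∀ q ∈ U, Z q = ContinuousMap.const _ q.2 + primitiveCLM (rayOperator ha (q.1, Z q)))
    {q : W × ℝ} (hq : q ∈ U)
    (hinv : ∀ t : unitInterval, ∀ η ζ,
      fderiv ℝ a ((t : ℝ) • q.1, Z q t) (η, a ((t : ℝ) • q.1, Z q t) η) ζ =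
        fderiv ℝ a ((t : ℝ) • q.1, Z q t) (ζ, a ((t : ℝ) • q.1, Z q t) ζ) η) (η : W) :
    fderiv ℝ Z q (η, 0) 1 = a (q.1, Z q 1) η := by
  obtain ⟨y, c⟩ := q
  set k := Z (y, c) with hk
  set P := fderiv ℝ Z (y, c) (η, 0) with hP
  have hPe := fderiv_raySolution ha hU hZ hsol hq (η, 0)
  rw [← hP, ← hk] at hPe
  have hke := hsol _ hq
  rw [← hk] at hke
  simp only at hPe hke hinv
  set n₁ := rayOperator ha (y, k) with hn₁
  set n₂ := fderiv ℝ (rayOperator ha) (y, k) (η, P) with hn₂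
  -- κ and π extend the curves k and P from [0, 1] to the real line, so that two-sided derivatives
  -- exist at the endpoints too.
  let κ : ℝ → ℝ := fun t => c + primitive n₁ t
  let π : ℝ → ℝ := fun t => primitive n₂ t
  have hκ : ∀ t : unitInterval, κ t = k t := fun t => by rw [hke]; rfl
  have hπ : ∀ t : unitInterval, π t = P t := fun t => by
    rw [hPe]; simp [π, primitiveCLM_apply]
  have hκd : ∀ t : unitInterval, HasDerivAt κ (a ((t : ℝ) • y, κ t) y) t := fun t => by
    have := (hasDerivAt_primitive n₁ t).const_add c
    rw [Set.IccExtend_val] at this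
    rw [hκ t]
    exact this
  have hπd : ∀ t : unitInterval, HasDerivAt π
      (fderiv ℝ a ((t : ℝ) • y, κ t) ((t : ℝ) • η, π t) y + a ((t : ℝ) • y, κ t) η) t := fun t => by
    have := hasDerivAt_primitive n₂ t
    rw [Set.IccExtend_val, hn₂, fderiv_rayOperator] at this
    rw [hκ t, hπ t]
    exact this
  have hκc : Continuous κ := continuous_const.add (continuous_iff_continuousAt.2
    fun t => (hasDerivAt_primitive n₁ t).continuousAt)
  have hπc : Continuous π := continuous_iff_continuousAt.2
    fun t => (hasDerivAt_primitive n₂ t).continuousAt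
  let m : ℝ → ℝ := fun t => π t - t * a (t • y, κ t) η
  let β : ℝ → ℝ := fun t => fderiv ℝ a (t • y, κ t) (0, 1) y
  have hcurve : Continuous fun t : ℝ => (t • y, κ t) := by fun_prop
  have hβc : Continuous β := by
    have := (ha.continuous_fderiv (by simp)).comp hcurve
    exact (this.clm_apply continuous_const).clm_apply continuous_const
  have hmc : Continuous m := by
    have := ha.continuous.comp hcurve
    exact hπc.sub (continuous_id.mul (this.clm_apply continuous_const))
  have hmd : ∀ t ∈ Set.Icc (0 : ℝ) 1, HasDerivAt m (β t * m t) t := by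
    intro t ht
    have e1 := hκd ⟨t, ht⟩
    have e2 := hπd ⟨t, ht⟩
    have e3 := hinv ⟨t, ht⟩ y η
    rw [← hκ ⟨t, ht⟩] at e3
    simp only at e1 e2 e3
    have hc : HasDerivAt (fun t : ℝ => (t • y, κ t)) (y, a (t • y, κ t) y) t := by
      have h1 : HasDerivAt (fun t : ℝ => t • y) y t := by
        simpa using (hasDerivAt_id t).smul_const y
      exact h1.prodMk e1
    have had : HasDerivAt (fun t : ℝ => a (t • y, κ t))
        (fderiv ℝ a (t • y, κ t) (y, a (t • y, κ t) y)) t :=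
      (ha.differentiable (by simp) _).hasFDerivAt.comp_hasDerivAt t hc
    have had' : HasDerivAt (fun t : ℝ => a (t • y, κ t) η)
        (fderiv ℝ a (t • y, κ t) (y, a (t • y, κ t) y) η) t := by
      simpa using had.clm_apply (hasDerivAt_const t η)
    have hm := e2.sub ((hasDerivAt_id t).mul had')
    refine hm.congr_deriv ?_
    have hlin : ∀ (v : W) (r : ℝ), fderiv ℝ a (t • y, κ t) (v, r) =
        fderiv ℝ a (t • y, κ t) (v, 0) + r • fderiv ℝ a (t • y, κ t) (0, 1) := by
      intro v r
      rw [← map_smul, ← map_add]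
      simp
    have hlin2 : fderiv ℝ a (t • y, κ t) (t • η, 0) = t • fderiv ℝ a (t • y, κ t) (η, 0) := by
      rw [← map_smul]; simp
    rw [e3, hlin (t • η), hlin2, hlin η (a (t • y, κ t) η)]
    simp only [m, β, _root_.add_apply, _root_.smul_apply, smul_eq_mul, id]
    ring
  -- A bound for β on [0, 1] is the constant in Grönwall's inequality.
  obtain ⟨C, hC⟩ := isCompact_Icc.exists_bound_of_continuousOn
    (s := Set.Icc (0 : ℝ) 1) hβc.continuousOn
  have hm0 := eq_zero_of_abs_deriv_le_mul_abs_self_of_eq_zero_right (K := C)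
    hmc.continuousOn (fun t ht => (hmd t ⟨ht.1, ht.2.le⟩).hasDerivWithinAt)
    (by simp [m, π, primitive]) (fun t ht => by
      rw [norm_mul]
      exact mul_le_mul_of_nonneg_right (hC t ⟨ht.1, ht.2.le⟩) (norm_nonneg _)) 1
    ⟨zero_le_one, le_rfl⟩
  have h1 := hπ 1
  have h2 := hκ 1
  simp only [Set.Icc.coe_one] at h1 h2
  rw [← h1, ← h2]
  simp only [m, one_smul, one_mul] at hm0
  linarith

/-- h(y, c) is the value at time 1 of the solution along the ray of y with initial value c. Its
graphs for fixed c are the integral manifolds, and the derivative 1 in c makes them foliate. -/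
theorem exists_integral_function [CompleteSpace W] {a : W × ℝ → W →L[ℝ] ℝ}
    (ha : ContDiff ℝ ∞ a)
    (hinv : ∀ᶠ p in 𝓝 (0 : W × ℝ), ∀ η ζ,
      fderiv ℝ a p (η, a p η) ζ = fderiv ℝ a p (ζ, a p ζ) η) :
    ∃ (U : Set (W × ℝ)) (h : W × ℝ → ℝ), IsOpen U ∧ 0 ∈ U ∧ ContDiffOn ℝ ∞ h U ∧ h 0 = 0 ∧
      fderiv ℝ h 0 (0, 1) = 1 ∧ ∀ q ∈ U, ∀ η, fderiv ℝ h q (η, 0) = a (q.1, h q) η := by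
  obtain ⟨U, Z, hU, h0U, hZ, hZ0, hsol⟩ := exists_smooth_raySolution ha
  obtain ⟨δ, hδ, hball⟩ := Metric.eventually_nhds_iff.1 hinv
  let V : Set (W × C(unitInterval, ℝ)) := Metric.ball 0 δ
  -- On U' the whole curve t ↦ (ty, Z q t) remains in the ball where involutivity is known, since
  -- ‖ty‖ ≤ ‖y‖ and the curve norm is a supremum.
  let U' := U ∩ (fun q : W × ℝ => (q.1, Z q)) ⁻¹' V
  have hU' : IsOpen U' := (continuous_fst.continuousOn.prodMk hZ.continuousOn).isOpen_inter_preimage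
    hU Metric.isOpen_ball
  have h0 : (0 : W × ℝ) ∈ U' := ⟨h0U, by
    simp only [Set.mem_preimage, hZ0, V]
    exact Metric.mem_ball_self hδ⟩
  let ev : C(unitInterval, ℝ) →L[ℝ] ℝ := ContinuousMap.evalCLM ℝ 1
  have hder : ∀ q ∈ U', ∀ w, fderiv ℝ (fun q => Z q 1) q w = fderiv ℝ Z q w 1 := by
    intro q hq w
    have hd := ((hZ.contDiffAt (hU.mem_nhds hq.1)).differentiableAt (by simp)).hasFDerivAt
    have := (ev.hasFDerivAt.comp q hd).fderiv
    exact congrArg (fun L : W × ℝ →L[ℝ] ℝ => L w) this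
  refine ⟨U', fun q => Z q 1, hU', h0, ?_, by simp [hZ0], ?_, ?_⟩
  · exact ev.contDiff.comp_contDiffOn (hZ.mono Set.inter_subset_left)
  · rw [hder 0 h0, fderiv_raySolution ha hU hZ hsol h0U]
    -- At y = 0 the integrand vanishes identically in the curve, so only the initial value c
    -- contributes to the derivative in c.
    have : fderiv ℝ (rayOperator ha) ((0 : W × ℝ).1, Z 0) ((0 : W), fderiv ℝ Z 0 (0, 1)) = 0 := by
      refine ContinuousMap.ext fun t => ?_
      rw [fderiv_rayOperator]
      simp
    simp only [this, map_zero]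
    simp
  · intro q hq η
    rw [hder q hq]
    refine fderiv_raySolution_eq ha hU hZ hsol hq.1 (fun t => hball ?_) η
    have h1 : ‖(q.1, Z q)‖ < δ := by simpa [V] using hq.2
    rw [Prod.norm_def, max_lt_iff] at h1
    rw [dist_zero_right, Prod.norm_def, max_lt_iff]
    refine ⟨?_, ((Z q).norm_coe_le_norm t).trans_lt h1.2⟩
    rw [norm_smul, Real.norm_eq_abs, abs_of_nonneg t.2.1]
    exact (mul_le_of_le_one_left (norm_nonneg _) t.2.2).trans_lt h1.1

/-- The theorem of Frobenius for one Pfaffian equation `θ = 0`. -/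
theorem exists_foliated_chart [FiniteDimensional ℝ W] {V : Type} [NormedAddCommGroup V]
    [NormedSpace ℝ V] {θ : V → V →L[ℝ] ℝ} {O : Set V} (hO : IsOpen O) (hθ : ContDiffOn ℝ ∞ θ O)
    {u : V} (hu : u ∈ O) (L : (W × ℝ) ≃L[ℝ] V) (hL : θ u (L (0, 1)) ≠ 0)
    (hinv : ∀ v ∈ O, ∀ w₁ w₂, θ v w₁ = 0 → θ v w₂ = 0 →
      fderiv ℝ θ v w₁ w₂ = fderiv ℝ θ v w₂ w₁) :
    ∃ Φ : OpenPartialHomeomorph (W × ℝ) V, u ∈ Φ.target ∧ Φ.target ⊆ O ∧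
      ContDiffOn ℝ ∞ Φ Φ.source ∧ ContDiffOn ℝ ∞ Φ.symm Φ.target ∧
      ∀ p ∈ Φ.source, ∀ η : W, θ (Φ p) (fderiv ℝ Φ p (η, 0)) = 0 := by
  have : CompleteSpace W := FiniteDimensional.complete ℝ W
  let e := L (0, 1)
  let ι : W →L[ℝ] V := (L : W × ℝ →L[ℝ] V).comp (ContinuousLinearMap.inl ℝ W ℝ)
  let τ : W × ℝ → V := fun p => u + L p
  have hτ : ContDiff ℝ ∞ τ := contDiff_const.add L.contDiff
  have hτ0 : τ 0 = u := by simp [τ]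
  let O₁ : Set (W × ℝ) := τ ⁻¹' (O ∩ (fun v => θ v e) ⁻¹' {0}ᶜ)
  have hθe : ContDiffOn ℝ ∞ (fun v => θ v e) O := hθ.clm_apply contDiffOn_const
  have hO₁ : IsOpen O₁ := (hθe.continuousOn.isOpen_inter_preimage hO
    isOpen_compl_singleton).preimage hτ.continuous
  have h0 : (0 : W × ℝ) ∈ O₁ := by
    change τ 0 ∈ O ∩ (fun v => θ v e) ⁻¹' {0}ᶜ
    rw [hτ0]; exact ⟨hu, hL⟩
  -- As θ(e) ≠ 0, the kernel of θ is the graph of a linear form b over W: θ(ι η) + b(η) θ(e) = 0.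
  let b : W × ℝ → W →L[ℝ] ℝ := fun p => -(θ (τ p) e)⁻¹ • (θ (τ p)).comp ι
  have hb : ContDiffOn ℝ ∞ b O₁ := by
    have hθτ : ContDiffOn ℝ ∞ (fun p => θ (τ p)) O₁ := hθ.comp hτ.contDiffOn fun p hp => hp.1
    exact ((hθτ.clm_apply contDiffOn_const).inv fun p hp => hp.2).neg.smul
      (hθτ.clm_comp contDiffOn_const)
  obtain ⟨a, ha, hab⟩ := exists_contDiff_eventuallyEq hO₁ hb h0
  -- the defining relation of the slope `b`
  have hrel : ∀ p ∈ O₁, ∀ η, θ (τ p) (L (η, b p η)) = 0 := by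
    intro p hp η
    have : L (η, b p η) = ι η + b p η • e := by
      rw [← map_smul L]
      simp only [ι, ContinuousLinearMap.comp_apply, ContinuousLinearMap.inl_apply,
        ContinuousLinearEquiv.coe_coe, ← map_add]
      simp
    rw [this, map_add, map_smul]
    have hne : θ (τ p) e ≠ 0 := hp.2
    simp only [b, _root_.smul_apply, ContinuousLinearMap.comp_apply, smul_eq_mul]
    field_simp
    ring
  -- The defining relation of b, differentiated: it expresses the derivative of b through that of θ,
  -- so closedness of θ on its kernel becomes involutivity of b.
  have hderiv : ∀ p ∈ O₁, ∀ (w : W × ℝ) (η : W),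
      fderiv ℝ θ (τ p) (L w) (L (η, b p η)) + fderiv ℝ b p w η * θ (τ p) e = 0 := by
    intro p hp w η
    have h1 : HasFDerivAt (fun p => θ (τ p)) ((fderiv ℝ θ (τ p)).comp (L : W × ℝ →L[ℝ] V)) p := by
      have hθd := ((hθ.contDiffAt (hO.mem_nhds hp.1)).differentiableAt (by simp)).hasFDerivAt
      exact hθd.comp p ((L.hasFDerivAt).const_add u)
    have h2 : HasFDerivAt b (fderiv ℝ b p) p :=
      ((hb.contDiffAt (hO₁.mem_nhds hp)).differentiableAt (by simp)).hasFDerivAt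
    have h3 : HasFDerivAt (fun p => L (η, b p η)) _ p :=
      L.hasFDerivAt.comp p ((hasFDerivAt_const η p).prodMk
        (h2.clm_apply (hasFDerivAt_const η p)))
    have h4 := h1.clm_apply h3
    have h5 : (fun p => θ (τ p) (L (η, b p η))) =ᶠ[𝓝 p] fun _ => 0 := by
      filter_upwards [hO₁.mem_nhds hp] with q hq using hrel q hq η
    have h6 := (h4.congr_of_eventuallyEq h5.symm).unique (hasFDerivAt_const (0 : ℝ) p)
    have h7 := congrArg (fun L : W × ℝ →L[ℝ] ℝ => L w) h6
    have h8 : L (0, fderiv ℝ b p w η) = fderiv ℝ b p w η • e := by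
      rw [← map_smul L]; simp
    simp at h7
    rw [h8, map_smul, smul_eq_mul] at h7
    linarith
  have hinv' : ∀ᶠ p in 𝓝 (0 : W × ℝ), ∀ η ζ,
      fderiv ℝ a p (η, a p η) ζ = fderiv ℝ a p (ζ, a p ζ) η := by
    filter_upwards [hab.eventuallyEq_nhds, hO₁.mem_nhds h0] with p hp hpO η ζ
    rw [hp.fderiv_eq, hp.eq_of_nhds]
    have h1 := hderiv p hpO (η, b p η) ζ
    have h2 := hderiv p hpO (ζ, b p ζ) η
    have h3 := hinv _ hpO.1 _ _ (hrel p hpO η) (hrel p hpO ζ)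
    have hne : θ (τ p) e ≠ 0 := hpO.2
    refine mul_right_cancel₀ hne ?_
    linarith
  obtain ⟨U, h, hU, h0U, hh, hh0, hh1, hhd⟩ := exists_integral_function ha hinv'
  obtain ⟨N, hN, hNo, h0N⟩ := mem_nhds_iff.1 (hab.and (hO₁.mem_nhds h0))
  let U' := U ∩ (fun q : W × ℝ => (q.1, h q)) ⁻¹' N
  have hU' : IsOpen U' := (continuous_fst.continuousOn.prodMk hh.continuousOn).isOpen_inter_preimage
    hU hNo
  have h0U' : (0 : W × ℝ) ∈ U' := ⟨h0U, by
    simp only [Set.mem_preimage, hh0]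
    exact h0N⟩
  -- For fixed c the map y ↦ f(y, c) parametrizes a leaf as the graph of h(·, c).
  let f : W × ℝ → V := fun q => u + L (q.1, h q)
  have hf : ContDiffOn ℝ ∞ f U' := contDiffOn_const.add (L.contDiff.comp_contDiffOn
    (contDiffOn_fst.prodMk (hh.mono Set.inter_subset_left)))
  have hfd : ∀ q ∈ U', HasFDerivAt f ((L : W × ℝ →L[ℝ] V).comp
      ((ContinuousLinearMap.fst ℝ W ℝ).prod (fderiv ℝ h q))) q := by
    intro q hq
    have hd := ((hh.contDiffAt (hU.mem_nhds hq.1)).differentiableAt (by simp)).hasFDerivAt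
    exact (L.hasFDerivAt.comp q ((hasFDerivAt_fst (𝕜 := ℝ)).prodMk hd)).const_add u
  -- The derivative of (y, c) ↦ (y, h(y, c)) at 0 is unipotent because ∂h/∂c = 1 there.
  let e₀ : (W × ℝ) ≃L[ℝ] W × ℝ := ContinuousLinearEquiv.skewProd (ContinuousLinearEquiv.refl ℝ W)
    (ContinuousLinearEquiv.refl ℝ ℝ) ((fderiv ℝ h 0).comp (ContinuousLinearMap.inl ℝ W ℝ))
  have he₀ : ((e₀.trans L : (W × ℝ) ≃L[ℝ] V) : W × ℝ →L[ℝ] V) = (L : W × ℝ →L[ℝ] V).comp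
      ((ContinuousLinearMap.fst ℝ W ℝ).prod (fderiv ℝ h 0)) := by
    refine ContinuousLinearMap.ext fun w => congrArg L (Prod.ext rfl ?_)
    have : w = (w.1, 0) + w.2 • (0, 1) := by simp
    conv_rhs => rw [this]
    simp only [map_add, map_smul]
    simp [e₀, hh1, add_comm]
  obtain ⟨Φ, hΦ, h0Φ, hsrc, hsymm⟩ := exists_smooth_local_inverse hU' hf h0U' (e₀.trans L)
    (by rw [he₀]; exact hfd 0 h0U')
  have hmem : ∀ q ∈ U', (q.1, h q) ∈ O₁ ∧ a (q.1, h q) = b (q.1, h q) :=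
    fun q hq => ⟨(hN hq.2).2, (hN hq.2).1⟩
  refine ⟨Φ, ?_, ?_, ?_, hsymm, ?_⟩
  · have h := Φ.map_source h0Φ
    have h1 : Φ 0 = u := by
      rw [hΦ]
      simp only [f, hh0]
      change u + L 0 = u
      simp
    rwa [h1] at h
  · intro v hv
    have hs := hsrc (Φ.map_target hv)
    have := (hmem _ hs).1.1
    rw [← Φ.right_inv hv, hΦ]
    exact this
  · rw [hΦ]; exact hf.mono hsrc
  · intro p hp η
    have hpU := hsrc hp
    rw [hΦ, (hfd p hpU).fderiv]
    have h1 := hhd p hpU.1 η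
    rw [(hmem p hpU).2] at h1
    have := hrel _ (hmem p hpU).1 η
    rw [← h1] at this
    exact this

/-! ### The scalar product over an arbitrary ring -/

section Bil

variable {R : Type*} [CommRing R] {n : ℕ}

/-- The scalar product of signature `(n, 2)`, as a bilinear form with coefficients in `R`. -/
def bil : Vec R n →ₗ[R] Vec R n →ₗ[R] R :=
  LinearMap.mk₂ R (fun x y => ∑ ξ : Fin (n + 2), (if (ξ : ℕ) < n then 1 else -1) * (x ξ * y ξ))
    (fun x y z => by simp only [Pi.add_apply, add_mul, mul_add, Finset.sum_add_distrib])
    (fun c x y => by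
      simp only [Pi.smul_apply, smul_eq_mul, Finset.mul_sum]
      exact Finset.sum_congr rfl fun _ _ => by ring)
    (fun x y z => by simp only [Pi.add_apply, mul_add, Finset.sum_add_distrib])
    (fun c x y => by
      simp only [Pi.smul_apply, smul_eq_mul, Finset.mul_sum]
      exact Finset.sum_congr rfl fun _ _ => by ring)

theorem bil_apply (x y : Vec R n) :
    bil x y = ∑ ξ : Fin (n + 2), (if (ξ : ℕ) < n then 1 else -1) * (x ξ * y ξ) := rfl

theorem scal_eq_bil (x y : Vec ℝ n) : scal x y = bil x y := rfl

theorem bil_comm (x y : Vec R n) : bil x y = bil y x := by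
  simp only [bil_apply, mul_comm (x _)]

theorem bil_single (x : Vec R n) (ξ : Fin (n + 2)) :
    bil x (Pi.single ξ 1) = (if (ξ : ℕ) < n then 1 else -1) * x ξ := by
  rw [bil_apply, Finset.sum_eq_single ξ]
  · simp
  · intro η _ h
    simp [h]
  · simp

theorem eq_zero_of_bil_eq_zero {x : Vec R n} (h : ∀ y, bil x y = 0) : x = 0 := by
  funext ξ
  have := h (Pi.single ξ 1)
  rw [bil_single] at this
  split_ifs at this <;> simpa using this

end Bil

/-! ### Extension of scalars -/

section Emb

variable (K : Type*) [RCLike K] {n : ℕ}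

/-- The inclusion of the real vectors into the vectors with coordinates in `K`. -/
def emb : Vec ℝ n →L[ℝ] Vec K n :=
  ContinuousLinearMap.pi fun ξ => RCLike.ofRealCLM.comp (ContinuousLinearMap.proj ξ)

variable {K}

theorem emb_apply (x : Vec ℝ n) (ξ : Fin (n + 2)) : emb K x ξ = algebraMap ℝ K (x ξ) := rfl

theorem bil_emb (x y : Vec ℝ n) : bil (emb K x) (emb K y) = algebraMap ℝ K (bil x y) := by
  simp only [bil_apply, emb_apply, map_sum, map_mul]
  refine Finset.sum_congr rfl fun ξ _ => ?_
  split_ifs <;> simp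

theorem emb_injective : Function.Injective (emb K : Vec ℝ n → Vec K n) := fun _ _ h =>
  funext fun ξ => (algebraMap ℝ K).injective (congrFun h ξ)

theorem emb_smul (c : ℝ) (x : Vec ℝ n) : emb K (c • x) = (algebraMap ℝ K c) • emb K x := by
  funext ξ
  simp [emb_apply]

theorem extend_eq_span (L : Submodule ℝ (Vec ℝ n)) :
    extend K L = Submodule.span K (emb K '' (L : Set (Vec ℝ n))) := rfl

theorem emb_mem_extend {L : Submodule ℝ (Vec ℝ n)} {x : Vec ℝ n} (hx : x ∈ L) :
    emb K x ∈ extend K L :=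
  Submodule.subset_span ⟨x, hx, rfl⟩

theorem extend_span_pair (x y : Vec ℝ n) :
    extend K (Submodule.span ℝ {x, y}) = Submodule.span K {emb K x, emb K y} := by
  apply le_antisymm
  · rw [extend_eq_span, Submodule.span_le]
    rintro _ ⟨z, hz, rfl⟩
    obtain ⟨a, b, rfl⟩ := Submodule.mem_span_pair.1 hz
    rw [map_add, emb_smul, emb_smul]
    exact Submodule.mem_span_pair.2 ⟨_, _, rfl⟩
  · rw [Submodule.span_le]
    rintro _ (rfl | rfl)
    · exact emb_mem_extend (Submodule.subset_span (by simp))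
    · exact emb_mem_extend (Submodule.subset_span (by simp))

theorem bil_eq_zero_of_mem_extend {L : Submodule ℝ (Vec ℝ n)}
    (hL : ∀ x ∈ L, ∀ y ∈ L, scal x y = 0) {x y : Vec K n} (hx : x ∈ extend K L)
    (hy : y ∈ extend K L) : bil x y = 0 := by
  induction hx using Submodule.span_induction with
  | mem x hx =>
    induction hy using Submodule.span_induction with
    | mem y hy =>
      obtain ⟨x, hx, rfl⟩ := hx
      obtain ⟨y, hy, rfl⟩ := hy
      change bil (emb K x) (emb K y) = 0
      rw [bil_emb, ← scal_eq_bil, hL x hx y hy, map_zero]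
    | zero => simp
    | add y z _ _ h1 h2 => simp [h1, h2]
    | smul c y _ h => simp [h]
  | zero => simp
  | add y z _ _ h1 h2 => simp [h1, h2]
  | smul c y _ h => simp [h]

end Emb

/-! ### Calculus of scalar products -/

section Calculus

variable {K : Type*} [RCLike K] {n : ℕ} {F : Type*} [NormedAddCommGroup F] [NormedSpace ℝ F]

theorem contDiffAt_bil {k : WithTop ℕ∞} {f g : F → Vec K n} {u : F} (hf : ContDiffAt ℝ k f u)
    (hg : ContDiffAt ℝ k g u) : ContDiffAt ℝ k (fun v => bil (f v) (g v)) u := by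
  simp only [bil_apply]
  exact ContDiffAt.sum fun ξ _ => contDiffAt_const.mul
    ((contDiffAt_pi.1 hf ξ).mul (contDiffAt_pi.1 hg ξ))

theorem contDiffOn_scal {k : WithTop ℕ∞} {f g : F → Vec ℝ n} {O : Set F}
    (hf : ContDiffOn ℝ k f O) (hg : ContDiffOn ℝ k g O) :
    ContDiffOn ℝ k (fun v => bil (f v) (g v)) O := by
  simp only [bil_apply]
  exact ContDiffOn.sum fun ξ _ => contDiffOn_const.mul
    ((contDiffOn_pi.1 hf ξ).mul (contDiffOn_pi.1 hg ξ))

theorem fderiv_bil {f g : F → Vec ℝ n} {u : F} (hf : DifferentiableAt ℝ f u)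
    (hg : DifferentiableAt ℝ g u) (w : F) :
    fderiv ℝ (fun v => bil (f v) (g v)) u w =
      bil (fderiv ℝ f u w) (g u) + bil (f u) (fderiv ℝ g u w) := by
  have h := (bil (R := ℝ) (n := n)).toContinuousBilinearMap.hasFDerivAt_of_bilinear
    hf.hasFDerivAt hg.hasFDerivAt
  have h' : HasFDerivAt (fun v => bil (f v) (g v)) _ u := h
  rw [h'.fderiv, add_comm]
  rfl

theorem bil_fderiv_of_eventually_const {f g : F → Vec ℝ n} {u : F} {c : ℝ}
    (hf : DifferentiableAt ℝ f u) (hg : DifferentiableAt ℝ g u)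
    (h : ∀ᶠ v in 𝓝 u, bil (f v) (g v) = c) (w : F) :
    bil (fderiv ℝ f u w) (g u) + bil (f u) (fderiv ℝ g u w) = 0 := by
  rw [← fderiv_bil hf hg]
  have : (fun v => bil (f v) (g v)) =ᶠ[𝓝 u] fun _ => c := h
  rw [this.fderiv_eq]
  simp

/-- The tangent subspace of a ruled family spanned by a pair of smooth sections. -/
theorem ruledTangent_eq [Nontrivial F] {ℓ : F → Submodule ℝ (Vec ℝ n)} {u : F}
    {B C N M : F → Vec ℝ n} (hB : ContDiffAt ℝ ∞ B u) (hC : ContDiffAt ℝ ∞ C u)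
    (hN : ContDiffAt ℝ ∞ N u) (hM : ContDiffAt ℝ ∞ M u)
    (hℓ : ∀ᶠ v in 𝓝 u, ℓ v = Submodule.span ℝ {B v, C v})
    (hdual : ∀ᶠ v in 𝓝 u, bil (B v) (N v) = -1 ∧ bil (C v) (N v) = 0 ∧
      bil (B v) (M v) = 0 ∧ bil (C v) (M v) = -1) (p q : K) :
    ruledTangent K ℓ u (p • emb K (B u) + q • emb K (C u)) =
      Submodule.span K ({emb K (B u), emb K (C u)} ∪
        Set.range fun w => p • emb K (fderiv ℝ B u w) + q • emb K (fderiv ℝ C u w)) := by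
  have hBd : HasFDerivAt (fun v => emb K (B v)) ((emb K).comp (fderiv ℝ B u)) u :=
    (emb K).hasFDerivAt.comp u (hB.differentiableAt (by simp)).hasFDerivAt
  have hCd : HasFDerivAt (fun v => emb K (C v)) ((emb K).comp (fderiv ℝ C u)) u :=
    (emb K).hasFDerivAt.comp u (hC.differentiableAt (by simp)).hasFDerivAt
  have hBs : ContDiffAt ℝ ∞ (fun v => emb K (B v)) u := (emb K).contDiff.contDiffAt.comp u hB
  have hCs : ContDiffAt ℝ ∞ (fun v => emb K (C v)) u := (emb K).contDiff.contDiffAt.comp u hC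
  have hder : ∀ {α β : F → K}, DifferentiableAt ℝ α u → DifferentiableAt ℝ β u → ∀ w,
      fderiv ℝ (fun v => α v • emb K (B v) + β v • emb K (C v)) u w =
        (α u • emb K (fderiv ℝ B u w) + β u • emb K (fderiv ℝ C u w)) +
        (fderiv ℝ α u w • emb K (B u) + fderiv ℝ β u w • emb K (C u)) := by
    intro α β hα hβ w
    have := (hα.hasFDerivAt.smul hBd).add (hβ.hasFDerivAt.smul hCd)
    have h' : HasFDerivAt (fun v => α v • emb K (B v) + β v • emb K (C v)) _ u := this
    rw [h'.fderiv]
    simp only [_root_.add_apply, _root_.smul_apply, ContinuousLinearMap.comp_apply,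
      ContinuousLinearMap.smulRight_apply]
    abel
  -- The dual sections N, M read off the coefficients of any section of the lines, which are
  -- therefore smooth functions of the parameter.
  have hcoef : ∀ᶠ v in 𝓝 u, ∀ Y ∈ extend K (ℓ v),
      Y = (-bil Y (emb K (N v))) • emb K (B v) + (-bil Y (emb K (M v))) • emb K (C v) := by
    filter_upwards [hℓ, hdual] with v hv hd Y hY
    rw [hv, extend_span_pair] at hY
    obtain ⟨a, b, rfl⟩ := Submodule.mem_span_pair.1 hY
    simp [bil_emb, hd.1, hd.2.1, hd.2.2.1, hd.2.2.2]
  apply le_antisymm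
  · refine Submodule.span_le.2 ?_
    rintro _ ⟨Y, w, hY, hYmem, hYu, rfl⟩
    have hα : ContDiffAt ℝ ∞ (fun v => -bil (Y v) (emb K (N v))) u :=
      (contDiffAt_bil hY ((emb K).contDiff.contDiffAt.comp u hN)).neg
    have hβ : ContDiffAt ℝ ∞ (fun v => -bil (Y v) (emb K (M v))) u :=
      (contDiffAt_bil hY ((emb K).contDiff.contDiffAt.comp u hM)).neg
    have heq : Y =ᶠ[𝓝 u] fun v => (-bil (Y v) (emb K (N v))) • emb K (B v) +
        (-bil (Y v) (emb K (M v))) • emb K (C v) := by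
      filter_upwards [hcoef, hYmem] with v hv hm using hv _ hm
    rw [heq.fderiv_eq, hder (hα.differentiableAt (by simp)) (hβ.differentiableAt (by simp))]
    obtain ⟨h1, h2, h3, h4⟩ := hdual.self_of_nhds
    have hp : -bil (Y u) (emb K (N u)) = p := by
      rw [hYu]; simp [bil_emb, h1, h2]
    have hq : -bil (Y u) (emb K (M u)) = q := by
      rw [hYu]; simp [bil_emb, h3, h4]
    rw [hp, hq]
    refine Submodule.add_mem _ (Submodule.subset_span (Or.inr ⟨w, rfl⟩))
      (Submodule.add_mem _ (Submodule.smul_mem _ _ (Submodule.subset_span ?_))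
        (Submodule.smul_mem _ _ (Submodule.subset_span ?_))) <;> simp
  -- To reach the generators B and C themselves, some direction must move the coefficients: φ is a
  -- functional with φ w₀ = 1, and φ(v - u) is the increment.
  · obtain ⟨w₀, hw₀⟩ := exists_ne (0 : F)
    obtain ⟨φ, hφ⟩ := SeparatingDual.exists_eq_one (R := ℝ) hw₀
    -- velocities of sections with affine coefficients
    have key : ∀ (c d : K) (w : F),
        (p • emb K (fderiv ℝ B u w) + q • emb K (fderiv ℝ C u w)) +
          (((φ w : ℝ) • c) • emb K (B u) + ((φ w : ℝ) • d) • emb K (C u)) ∈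
        ruledTangent K ℓ u (p • emb K (B u) + q • emb K (C u)) := by
      intro c d w
      let α : K → K → F → K := fun e c v => e + (φ (v - u)) • c
      have hαs : ∀ e c, ContDiff ℝ ∞ (α e c) := fun e c => contDiff_const.add
        ((φ.contDiff.comp (contDiff_id.sub contDiff_const)).smul contDiff_const)
      have hαu : ∀ e c, α e c u = e := fun e c => by simp [α]
      have hαd : ∀ e c w, fderiv ℝ (α e c) u w = φ w • c := by
        intro e c w
        have h1 : HasFDerivAt (fun v : F => φ (v - u)) φ u := by
          have := φ.hasFDerivAt.comp u ((hasFDerivAt_id (𝕜 := ℝ) u).sub_const u)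
          exact this
        have h2 : HasFDerivAt (α e c) _ u := (h1.smul_const c).const_add e
        rw [h2.fderiv]
        simp
      refine Submodule.subset_span ⟨fun v => α p c v • emb K (B v) + α q d v • emb K (C v), w,
        ((hαs p c).contDiffAt.smul hBs).add ((hαs q d).contDiffAt.smul hCs), ?_, ?_, ?_⟩
      · filter_upwards [hℓ] with v hv
        rw [hv, extend_span_pair]
        exact Submodule.mem_span_pair.2 ⟨_, _, rfl⟩
      · simp only [hαu]
      · rw [hder ((hαs p c).differentiable (by simp) u) ((hαs q d).differentiable (by simp) u)]
        simp only [hαu, hαd]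
    have hvel : ∀ w, p • emb K (fderiv ℝ B u w) + q • emb K (fderiv ℝ C u w) ∈
        ruledTangent K ℓ u (p • emb K (B u) + q • emb K (C u)) := fun w => by
      simpa using key 0 0 w
    refine Submodule.span_le.2 ?_
    rintro _ ((rfl | rfl) | ⟨w, rfl⟩)
    -- Two sections with the same velocity except for the coefficient of B: the difference is B.
    · have := Submodule.sub_mem _ (key 1 0 w₀) (hvel w₀)
      simpa [hφ] using this
    · have := Submodule.sub_mem _ (key 0 1 w₀) (hvel w₀)
      simpa [hφ] using this
    · exact hvel w

end Calculus

/-! ### Coordinates with respect to an adapted frame -/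

section Index

variable {n : ℕ}

theorem sum_frame (hn : 2 ≤ n) {M : Type*} [AddCommMonoid M] (f : Fin (n + 2) → M) :
    ∑ ξ, f ξ = f 0 + f 1 + ∑ i : Fin (n - 2), f (mid i) + f (idxN n) + f (Fin.last (n + 1)) := by
  obtain ⟨m, rfl⟩ : ∃ m, n = m + 2 := ⟨n - 2, by omega⟩
  rw [Fin.sum_univ_castSucc, Fin.sum_univ_castSucc, Fin.sum_univ_succ, Fin.sum_univ_succ]
  simp only [← add_assoc]
  rfl

theorem frame_index_cases (hn : 2 ≤ n) (ξ : Fin (n + 2)) :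
    ξ = 0 ∨ ξ = 1 ∨ (∃ i : Fin (n - 2), ξ = mid i) ∨ ξ = idxN n ∨ ξ = Fin.last (n + 1) := by
  obtain ⟨k, hk⟩ := ξ
  rcases Nat.lt_or_ge k 2 with h | h
  · interval_cases k
    · exact Or.inl rfl
    · exact Or.inr (Or.inl (Fin.ext (by simp)))
  · rcases Nat.lt_or_ge k n with h' | h'
    · exact Or.inr (Or.inr (Or.inl ⟨⟨k - 2, by omega⟩, Fin.ext (by simp [mid]; omega)⟩))
    · rcases Nat.eq_or_lt_of_le h' with h'' | h''
      · exact Or.inr (Or.inr (Or.inr (Or.inl (Fin.ext (by simp [idxN, h''])))))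
      · exact Or.inr (Or.inr (Or.inr (Or.inr (Fin.ext (by simp [Fin.last]; omega)))))

/-- A frame-indexed family with given values at `0`, `1`, the middle indices, `n` and `n + 1`. -/
def ofParts {α : Type*} (a b : α) (c : Fin (n - 2) → α) (d e : α) (ξ : Fin (n + 2)) : α :=
  if (ξ : ℕ) = 0 then a else if (ξ : ℕ) = 1 then b else
    if h : 2 ≤ (ξ : ℕ) ∧ (ξ : ℕ) < n then c ⟨ξ - 2, by omega⟩ else if (ξ : ℕ) = n then d else e

section OfParts

variable {α : Type*} (a b : α) (c : Fin (n - 2) → α) (d e : α)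

@[simp] theorem ofParts_zero : ofParts a b c d e 0 = a := by simp [ofParts]

@[simp] theorem ofParts_one : ofParts a b c d e 1 = b := by simp [ofParts]

@[simp] theorem ofParts_mid (i : Fin (n - 2)) : ofParts a b c d e (mid i) = c i := by
  have : (i : ℕ) + 2 < n := by omega
  simp [ofParts, mid, this]

theorem ofParts_idxN (hn : 2 ≤ n) : ofParts a b c d e (idxN n) = d := by
  have h0 : n ≠ 0 := by omega
  have h1 : n ≠ 1 := by omega
  simp [ofParts, idxN, h0, h1]

@[simp] theorem ofParts_last (hn : 2 ≤ n) : ofParts a b c d e (Fin.last (n + 1)) = e := by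
  have h1 : n ≠ 0 := by omega
  simp [ofParts, h1]

end OfParts

end Index

/-! ### Scalar products and the connection forms of an adapted frame. -/

section Frame

variable {n : ℕ} {K : Type*} [RCLike K] {ℓ : Param n → Submodule ℝ (Vec ℝ n)} {O : Set (Param n)}
  {A : Fin (n + 2) → Param n → Vec ℝ n} {u : Param n}

/-- The vector with coordinates `c` in the frame `A` at `u`. -/
def comb (A : Fin (n + 2) → Param n → Vec ℝ n) (u : Param n) (c : Fin (n + 2) → K) : Vec K n :=
  ∑ ξ, c ξ • emb K (A ξ u)

theorem bil_comb_zero (hn : 2 ≤ n) (hA : IsAdaptedFrame ℓ O A) (hu : u ∈ O)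
    (c : Fin (n + 2) → K) :
    bil (comb A u c) (emb K (A 0 u)) = -c (Fin.last (n + 1)) := by
  have h0 := hA.s00 u hu
  have h1 := hA.s01 u hu
  have h2 := hA.s0i u hu
  have h3 := hA.s0n u hu
  have h4 := hA.s0l u hu
  simp only [scal_eq_bil] at h0 h1 h2 h3 h4
  simp [bil_comm _ (emb K (A 0 u)), comb, sum_frame hn, bil_emb, h0, h1, h2, h3, h4]

theorem bil_comb_one (hn : 2 ≤ n) (hA : IsAdaptedFrame ℓ O A) (hu : u ∈ O)
    (c : Fin (n + 2) → K) :
    bil (comb A u c) (emb K (A 1 u)) = -c (idxN n) := by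
  have h0 := hA.s01 u hu
  have h1 := hA.s11 u hu
  have h2 := hA.s1i u hu
  have h3 := hA.s1n u hu
  have h4 := hA.s1l u hu
  simp only [scal_eq_bil] at h0 h1 h2 h3 h4
  rw [bil_comm] at h0
  simp [bil_comm _ (emb K (A 1 u)), comb, sum_frame hn, bil_emb, h0, h1, h2, h3, h4]

theorem bil_comb_idxN (hn : 2 ≤ n) (hA : IsAdaptedFrame ℓ O A) (hu : u ∈ O)
    (c : Fin (n + 2) → K) :
    bil (comb A u c) (emb K (A (idxN n) u)) = -c 1 := by
  have h0 := hA.s0n u hu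
  have h1 := hA.s1n u hu
  have h2 := hA.sin u hu
  have h3 := hA.snn u hu
  have h4 := hA.snl u hu
  simp only [scal_eq_bil] at h0 h1 h2 h3 h4
  rw [bil_comm] at h4
  simp [comb, sum_frame hn, bil_emb, h0, h1, h2, h3, h4]

theorem bil_comb_last (hn : 2 ≤ n) (hA : IsAdaptedFrame ℓ O A) (hu : u ∈ O)
    (c : Fin (n + 2) → K) :
    bil (comb A u c) (emb K (A (Fin.last (n + 1)) u)) = -c 0 := by
  have h0 := hA.s0l u hu
  have h1 := hA.s1l u hu
  have h2 := hA.sil u hu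
  have h3 := hA.snl u hu
  have h4 := hA.sll u hu
  simp only [scal_eq_bil] at h0 h1 h2 h3 h4
  simp [comb, sum_frame hn, bil_emb, h0, h1, h2, h3, h4]

theorem bil_comb_mid (hn : 2 ≤ n) (hA : IsAdaptedFrame ℓ O A) (hu : u ∈ O)
    (c : Fin (n + 2) → K)
    (j : Fin (n - 2)) : bil (comb A u c) (emb K (A (mid j) u)) =
    ∑ i, c (mid i) * algebraMap ℝ K (gMat A u i j) := by
  have h0 := hA.s0i u hu
  have h1 := hA.s1i u hu
  have h3 := hA.sin u hu
  have h4 := hA.sil u hu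
  simp only [scal_eq_bil] at h0 h1 h3 h4
  have h3' := fun i => (bil_comm _ _).trans (h3 i)
  have h4' := fun i => (bil_comm _ _).trans (h4 i)
  simp [comb, sum_frame hn, bil_emb, h0, h1, h3', h4', gMat, scal_eq_bil]

theorem gMat_map_det_ne_zero (hA : IsAdaptedFrame ℓ O A) (hu : u ∈ O) :
    ((gMat A u).map (algebraMap ℝ K)).det ≠ 0 := by
  have h := (hA.sij u hu).det_pos.ne'
  have h1 : ((gMat A u).map (algebraMap ℝ K)).det = algebraMap ℝ K (gMat A u).det :=
    ((algebraMap ℝ K).map_det _).symm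
  rw [h1]
  simpa using h

/-- Pairing with A_{n+1}, A_n, A_1, A_0 isolates the coordinates 0, 1, n, n+1; pairing with the
middle vectors multiplies the others by the invertible Gram matrix. -/
theorem comb_injective (hn : 2 ≤ n) (hA : IsAdaptedFrame ℓ O A) (hu : u ∈ O)
    {c : Fin (n + 2) → K} (h : comb A u c = 0) : c = 0 := by
  have h0 := bil_comb_zero hn hA hu c
  have h1 := bil_comb_one hn hA hu c
  have h2 := bil_comb_mid hn hA hu c
  have h3 := bil_comb_idxN hn hA hu c
  have h4 := bil_comb_last hn hA hu c
  simp only [h, map_zero, LinearMap.zero_apply] at h0 h1 h2 h3 h4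
  have hm : (fun i => c (mid i)) = 0 := by
    refine Matrix.eq_zero_of_vecMul_eq_zero (gMat_map_det_ne_zero (K := K) hA hu) ?_
    funext j
    exact (h2 j).symm
  funext ξ
  rcases frame_index_cases hn ξ with rfl | rfl | ⟨i, rfl⟩ | rfl | rfl
  · simpa using h4
  · simpa using h3
  · exact congrFun hm i
  · simpa using h1
  · simpa using h0

theorem isUnit_frame (hn : 2 ≤ n) (hA : IsAdaptedFrame ℓ O A) (hu : u ∈ O) :
    IsUnit (Matrix.of fun ξ => A ξ u) := by
  rw [Matrix.isUnit_iff_isUnit_det, isUnit_iff_ne_zero]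
  intro h
  obtain ⟨c, hc, hc0⟩ := Matrix.exists_vecMul_eq_zero_iff.2 h
  refine hc (comb_injective (K := ℝ) hn hA hu ?_)
  funext η
  have := congrFun hc0 η
  simp only [Matrix.vecMul, dotProduct, Matrix.of_apply] at this
  simpa [comb, Finset.sum_apply, emb_apply] using this

theorem fderiv_frame (hn : 2 ≤ n) (hA : IsAdaptedFrame ℓ O A) (hu : u ∈ O)
    (w : Param n) (ξ : Fin (n + 2)) :
    fderiv ℝ (A ξ) u w = ∑ η, conn A u w ξ η • A η u := by
  have hdet := (Matrix.isUnit_iff_isUnit_det _).1 (isUnit_frame hn hA hu)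
  have : conn A u w * (Matrix.of fun ξ => A ξ u) = Matrix.of fun ξ => fderiv ℝ (A ξ) u w := by
    rw [conn, Matrix.mul_assoc, Matrix.nonsing_inv_mul _ hdet, Matrix.mul_one]
  have h := congrFun this ξ
  funext ζ
  have := congrFun h ζ
  simp only [Matrix.mul_apply, Matrix.of_apply] at this
  simp [← this]

theorem fderiv_frame_comb (hn : 2 ≤ n) (hA : IsAdaptedFrame ℓ O A) (hu : u ∈ O)
    (w : Param n) (ξ : Fin (n + 2)) :
    fderiv ℝ (A ξ) u w = comb (K := ℝ) A u (conn A u w ξ) :=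
  fderiv_frame hn hA hu w ξ

theorem differentiableAt_frame (hA : IsAdaptedFrame ℓ O A) (hu : u ∈ O)
    (ξ : Fin (n + 2)) : DifferentiableAt ℝ (A ξ) u :=
  ((hA.smooth ξ).contDiffAt (hA.isOpen.mem_nhds hu)).differentiableAt (by simp)

theorem contDiffAt_frame (hA : IsAdaptedFrame ℓ O A) (hu : u ∈ O)
    (ξ : Fin (n + 2)) : ContDiffAt ℝ ∞ (A ξ) u :=
  (hA.smooth ξ).contDiffAt (hA.isOpen.mem_nhds hu)

theorem bil_fderiv_zero (hn : 2 ≤ n) (hA : IsAdaptedFrame ℓ O A) (hu : u ∈ O)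
    (w : Param n) (ξ : Fin (n + 2)) :
    bil (fderiv ℝ (A ξ) u w) (A 0 u) = -conn A u w ξ (Fin.last (n + 1)) := by
  rw [fderiv_frame_comb hn hA hu]
  exact bil_comb_zero (K := ℝ) hn hA hu _

theorem bil_fderiv_one (hn : 2 ≤ n) (hA : IsAdaptedFrame ℓ O A) (hu : u ∈ O)
    (w : Param n) (ξ : Fin (n + 2)) :
    bil (fderiv ℝ (A ξ) u w) (A 1 u) = -conn A u w ξ (idxN n) := by
  rw [fderiv_frame_comb hn hA hu]
  exact bil_comb_one (K := ℝ) hn hA hu _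

theorem bil_fderiv_mid (hn : 2 ≤ n) (hA : IsAdaptedFrame ℓ O A) (hu : u ∈ O)
    (w : Param n) (ξ : Fin (n + 2)) (j : Fin (n - 2)) :
    bil (fderiv ℝ (A ξ) u w) (A (mid j) u) = ∑ i, conn A u w ξ (mid i) * gMat A u i j := by
  rw [fderiv_frame_comb hn hA hu]
  exact bil_comb_mid (K := ℝ) hn hA hu _ j

/-- The derivative of (A_0, A_0) = 0. The next two relations come in the same way from (A_1, A_1) =
0 and (A_0, A_1) = 0. -/
theorem conn_zero_last (hn : 2 ≤ n) (hA : IsAdaptedFrame ℓ O A) (hu : u ∈ O)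
    (w : Param n) : conn A u w 0 (Fin.last (n + 1)) = 0 := by
  have h := bil_fderiv_of_eventually_const (differentiableAt_frame hA hu 0)
    (differentiableAt_frame hA hu 0)
    (Filter.eventually_of_mem (hA.isOpen.mem_nhds hu) fun v hv => hA.s00 v hv) w
  rw [bil_comm (A 0 u), bil_fderiv_zero hn hA hu] at h
  linarith

theorem conn_one_idxN (hn : 2 ≤ n) (hA : IsAdaptedFrame ℓ O A) (hu : u ∈ O)
    (w : Param n) : conn A u w 1 (idxN n) = 0 := by
  have h := bil_fderiv_of_eventually_const (differentiableAt_frame hA hu 1)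
    (differentiableAt_frame hA hu 1)
    (Filter.eventually_of_mem (hA.isOpen.mem_nhds hu) fun v hv => hA.s11 v hv) w
  rw [bil_comm (A 1 u), bil_fderiv_one hn hA hu] at h
  linarith

theorem conn_one_last (hn : 2 ≤ n) (hA : IsAdaptedFrame ℓ O A) (hu : u ∈ O)
    (w : Param n) :
    conn A u w 1 (Fin.last (n + 1)) = -conn A u w 0 (idxN n) := by
  have h := bil_fderiv_of_eventually_const (differentiableAt_frame hA hu 0)
    (differentiableAt_frame hA hu 1)
    (Filter.eventually_of_mem (hA.isOpen.mem_nhds hu) fun v hv => hA.s01 v hv) w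
  rw [bil_comm (A 0 u), bil_fderiv_zero hn hA hu, bil_fderiv_one hn hA hu] at h
  linarith

theorem conn_add (w₁ w₂ : Param n) (ξ η : Fin (n + 2)) :
    conn A u (w₁ + w₂) ξ η = conn A u w₁ ξ η + conn A u w₂ ξ η := by
  simp [conn, Matrix.mul_apply, add_mul, Finset.sum_add_distrib]

theorem conn_smul (r : ℝ) (w : Param n) (ξ η : Fin (n + 2)) :
    conn A u (r • w) ξ η = r * conn A u w ξ η := by
  simp [conn, Matrix.mul_apply, Finset.mul_sum, mul_assoc]

/-- The form `ω_ξ^η` at `u`. -/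
def connForm (A : Fin (n + 2) → Param n → Vec ℝ n) (u : Param n) (ξ η : Fin (n + 2)) :
    Param n →ₗ[ℝ] ℝ where
  toFun w := conn A u w ξ η
  map_add' w₁ w₂ := conn_add w₁ w₂ ξ η
  map_smul' r w := conn_smul r w ξ η

theorem connForm_apply (ξ η : Fin (n + 2)) (w : Param n) : connForm A u ξ η w = conn A u w ξ η :=
  rfl

/-- The forms `ω_0^i` and `ω_0^n` at `u`. -/
def basisMap (A : Fin (n + 2) → Param n → Vec ℝ n) (u : Param n) :
    Param n →ₗ[ℝ] (Fin (n - 2) → ℝ) × ℝ :=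
  (LinearMap.pi fun i => connForm A u 0 (mid i)).prod (connForm A u 0 (idxN n))

theorem basisMap_fst (w : Param n) (i : Fin (n - 2)) :
    (basisMap A u w).1 i = conn A u w 0 (mid i) := rfl

theorem basisMap_snd (w : Param n) : (basisMap A u w).2 = conn A u w 0 (idxN n) := rfl

theorem bijective_basisMap (hn : 2 ≤ n) (hB : BasisForms A u) :
    Function.Bijective (basisMap A u) := by
  have hinj : Function.Injective (basisMap A u) := by
    rw [injective_iff_map_eq_zero]
    intro w hw
    exact hB w (fun i => congrFun (congrArg Prod.fst hw) i) (congrArg Prod.snd hw)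
  refine ⟨hinj, (LinearMap.injective_iff_surjective_of_finrank_eq_finrank ?_).1 hinj⟩
  simp
  omega

/-- The n - 1 basis forms are linear coordinates on the tangent space, so each ω_1^i is a unique
combination of them; its coefficients are its values on the dual basis. -/
theorem existsUnique_affinor (hn : 2 ≤ n) (hB : BasisForms A u) :
    ∃! p : Matrix (Fin (n - 2)) (Fin (n - 2)) ℝ × (Fin (n - 2) → ℝ), IsAffinor A u p.1 p.2 := by
  let e := LinearEquiv.ofBijective (basisMap A u) (bijective_basisMap hn hB)
  have he : ∀ x, basisMap A u (e.symm x) = x := e.apply_symm_apply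
  refine ⟨(Matrix.of fun i j => conn A u (e.symm (Pi.single j 1, 0)) 1 (mid i),
    fun i => conn A u (e.symm (0, 1)) 1 (mid i)), ?_, ?_⟩
  · intro w i
    have hw : w = ∑ j, conn A u w 0 (mid j) • e.symm (Pi.single j 1, 0) +
        conn A u w 0 (idxN n) • e.symm (0, 1) := by
      apply e.injective
      simp only [map_add, map_sum, map_smul, LinearEquiv.apply_symm_apply]
      refine Prod.ext ?_ ?_
      · funext k
        change conn A u w 0 (mid k) = _
        simp [Prod.fst_sum, Finset.sum_apply, Pi.single_apply]
      · change conn A u w 0 (idxN n) = _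
        simp [Prod.snd_sum]
    have h2 := congrArg (connForm A u 1 (mid i)) hw
    simp only [map_add, map_sum, map_smul, connForm_apply, smul_eq_mul] at h2
    rw [h2]
    simp only [Matrix.of_apply, mul_comm]
  · rintro ⟨Λ, μ⟩ h
    refine Prod.ext ?_ ?_
    · ext i j
      have := h (e.symm (Pi.single j 1, 0)) i
      simp only [← basisMap_fst, ← basisMap_snd, he] at this
      simp [this, Pi.single_apply]
    · funext i
      have := h (e.symm (0, 1)) i
      simp only [← basisMap_fst, ← basisMap_snd, he] at this
      simp [this]

end Frame

/-! ### Singular points in terms of an adapted frame -/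

section Singular

variable {n : ℕ} {K : Type*} [RCLike K] {ℓ : Param n → Submodule ℝ (Vec ℝ n)} {O : Set (Param n)}
  {A : Fin (n + 2) → Param n → Vec ℝ n} {u : Param n}

theorem ruledTangent_frame (hn : 2 ≤ n) (hA : IsAdaptedFrame ℓ O A) (hu : u ∈ O) (p q : K) :
    ruledTangent K ℓ u (p • emb K (A 0 u) + q • emb K (A 1 u)) =
      Submodule.span K ({emb K (A 0 u), emb K (A 1 u)} ∪
        Set.range fun w => p • emb K (fderiv ℝ (A 0) u w) + q • emb K (fderiv ℝ (A 1) u w)) := by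
  have : Nonempty (Fin (n - 1)) := ⟨⟨0, by omega⟩⟩
  refine ruledTangent_eq (contDiffAt_frame hA hu 0) (contDiffAt_frame hA hu 1)
    (contDiffAt_frame hA hu (Fin.last (n + 1))) (contDiffAt_frame hA hu (idxN n))
    (Filter.eventually_of_mem (hA.isOpen.mem_nhds hu) hA.span_eq)
    (Filter.eventually_of_mem (hA.isOpen.mem_nhds hu) fun v hv => ?_) p q
  exact ⟨hA.s0l v hv, hA.s1l v hv, hA.s0n v hv, hA.s1n v hv⟩

/-- The value of the form `ω_ξ^η` on a vector with coordinates in `K`. -/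
def connK (K : Type*) [RCLike K] (A : Fin (n + 2) → Param n → Vec ℝ n) (u : Param n)
    (ξ η : Fin (n + 2)) : (Fin (n - 1) → K) →ₗ[K] K :=
  ∑ k, (algebraMap ℝ K (conn A u (Pi.single k 1) ξ η)) • LinearMap.proj k

theorem connK_apply (ξ η : Fin (n + 2)) (s : Fin (n - 1) → K) :
    connK K A u ξ η s = ∑ k, algebraMap ℝ K (conn A u (Pi.single k 1) ξ η) * s k := by
  simp only [connK, LinearMap.sum_apply, LinearMap.smul_apply, LinearMap.proj_apply, smul_eq_mul]

theorem connK_ofReal (ξ η : Fin (n + 2)) (w : Param n) :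
    connK K A u ξ η (fun k => algebraMap ℝ K (w k)) = algebraMap ℝ K (conn A u w ξ η) := by
  have h : w = ∑ k, w k • (Pi.single k 1 : Param n) := by
    funext j
    simp [Finset.sum_apply, Pi.single_apply]
  have h2 := congrArg (connForm A u ξ η) h
  simp only [map_sum, map_smul, connForm_apply, smul_eq_mul] at h2
  rw [connK_apply, h2, map_sum]
  simp only [map_mul, mul_comm]

/-- The parametrization of the tangent subspace at the point `p A_0 + q A_1`. -/
def tangentMap (A : Fin (n + 2) → Param n → Vec ℝ n) (u : Param n) (p q : K) :
    (K × K) × (Fin (n - 1) → K) →ₗ[K] Vec K n :=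
  LinearMap.coprod
    (LinearMap.coprod (LinearMap.toSpanSingleton K _ (emb K (A 0 u)))
      (LinearMap.toSpanSingleton K _ (emb K (A 1 u))))
    (∑ k, (LinearMap.toSpanSingleton K _ (p • emb K (fderiv ℝ (A 0) u (Pi.single k 1)) +
      q • emb K (fderiv ℝ (A 1) u (Pi.single k 1)))).comp (LinearMap.proj k))

theorem tangentMap_apply (p q a b : K) (s : Fin (n - 1) → K) :
    tangentMap A u p q ((a, b), s) = a • emb K (A 0 u) + b • emb K (A 1 u) +
      ∑ k, s k • (p • emb K (fderiv ℝ (A 0) u (Pi.single k 1)) +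
        q • emb K (fderiv ℝ (A 1) u (Pi.single k 1))) := by
  simp [tangentMap]

theorem range_tangentMap (hn : 2 ≤ n) (hA : IsAdaptedFrame ℓ O A) (hu : u ∈ O) (p q : K) :
    LinearMap.range (tangentMap A u p q) =
      ruledTangent K ℓ u (p • emb K (A 0 u) + q • emb K (A 1 u)) := by
  rw [ruledTangent_frame hn hA hu]
  apply le_antisymm
  · rintro _ ⟨⟨⟨a, b⟩, s⟩, rfl⟩
    rw [tangentMap_apply]
    refine Submodule.add_mem _ (Submodule.add_mem _ ?_ ?_) (Submodule.sum_mem _ fun k _ => ?_)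
    · exact Submodule.smul_mem _ _ (Submodule.subset_span (by simp))
    · exact Submodule.smul_mem _ _ (Submodule.subset_span (by simp))
    · exact Submodule.smul_mem _ _ (Submodule.subset_span (Or.inr ⟨_, rfl⟩))
  · rw [Submodule.span_le]
    rintro _ ((rfl | rfl) | ⟨w, rfl⟩)
    · exact ⟨((1, 0), 0), by simp [tangentMap_apply]⟩
    · exact ⟨((0, 1), 0), by simp [tangentMap_apply]⟩
    · refine ⟨((0, 0), fun k => algebraMap ℝ K (w k)), ?_⟩
      have h : w = ∑ k, w k • (Pi.single k 1 : Param n) := by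
        funext j
        simp [Finset.sum_apply, Pi.single_apply]
      have h2 : ∀ ξ, emb K (fderiv ℝ (A ξ) u w) =
          ∑ k, algebraMap ℝ K (w k) • emb K (fderiv ℝ (A ξ) u (Pi.single k 1)) := by
        intro ξ
        conv_lhs => rw [h]
        simp only [map_sum, map_smul, ← emb_smul]
      beta_reduce
      rw [tangentMap_apply, h2, h2]
      simp only [zero_smul, zero_add, smul_add, Finset.sum_add_distrib, Finset.smul_sum]
      congr 1 <;> exact Finset.sum_congr rfl fun k _ => smul_comm _ _ _

theorem emb_fderiv_frame (hn : 2 ≤ n) (hA : IsAdaptedFrame ℓ O A) (hu : u ∈ O) (w : Param n)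
    (ξ : Fin (n + 2)) :
    emb K (fderiv ℝ (A ξ) u w) = comb A u fun η => algebraMap ℝ K (conn A u w ξ η) := by
  rw [fderiv_frame hn hA hu]
  simp only [map_sum, ← emb_smul, comb]

theorem comb_add (c d : Fin (n + 2) → K) : comb A u (c + d) = comb A u c + comb A u d := by
  simp [comb, add_smul, Finset.sum_add_distrib]

theorem comb_smul (r : K) (c : Fin (n + 2) → K) : comb A u (r • c) = r • comb A u c := by
  simp [comb, mul_smul, Finset.smul_sum]

theorem comb_single (ξ : Fin (n + 2)) : comb A u (Pi.single ξ (1 : K)) = emb K (A ξ u) := by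
  rw [comb, Finset.sum_eq_single ξ]
  · simp
  · intro η _ h
    simp [h]
  · simp

/-- Expansion of vectors in an adapted frame, as a linear map. -/
def combMap (A : Fin (n + 2) → Param n → Vec ℝ n) (u : Param n) :
    (Fin (n + 2) → K) →ₗ[K] Vec K n where
  toFun := comb A u
  map_add' := comb_add
  map_smul' := comb_smul

theorem tangentMap_eq_comb (hn : 2 ≤ n) (hA : IsAdaptedFrame ℓ O A) (hu : u ∈ O)
    (p q a b : K) (s : Fin (n - 1) → K) :
    tangentMap A u p q ((a, b), s) = comb A u (a • Pi.single 0 1 + b • Pi.single 1 1 +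
      fun η => p * connK K A u 0 η s + q * connK K A u 1 η s) := by
  rw [comb_add, comb_add, comb_smul, comb_smul, comb_single, comb_single, tangentMap_apply]
  congr 1
  simp only [emb_fderiv_frame hn hA hu]
  have h1 : ∀ k, s k • (p • comb A u (fun η => algebraMap ℝ K (conn A u (Pi.single k 1) 0 η)) +
      q • comb A u (fun η => algebraMap ℝ K (conn A u (Pi.single k 1) 1 η))) =
      combMap (K := K) A u (s k • (p • (fun η => algebraMap ℝ K (conn A u (Pi.single k 1) 0 η)) +
      q • (fun η => algebraMap ℝ K (conn A u (Pi.single k 1) 1 η)))) := by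
    intro k
    rw [map_smul, map_add, map_smul, map_smul]
    rfl
  simp only [h1]
  rw [← map_sum]
  change comb A u _ = comb A u _
  congr 1
  funext η
  simp only [Finset.sum_apply, Pi.smul_apply, Pi.add_apply, smul_eq_mul, connK_apply,
    Finset.mul_sum, ← Finset.sum_add_distrib]
  exact Finset.sum_congr rfl fun k _ => by ring

theorem connK_zero_last (hn : 2 ≤ n) (hA : IsAdaptedFrame ℓ O A) (hu : u ∈ O)
    (s : Fin (n - 1) → K) : connK K A u 0 (Fin.last (n + 1)) s = 0 := by
  simp [connK_apply, conn_zero_last hn hA hu]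

theorem connK_one_idxN (hn : 2 ≤ n) (hA : IsAdaptedFrame ℓ O A) (hu : u ∈ O)
    (s : Fin (n - 1) → K) : connK K A u 1 (idxN n) s = 0 := by
  simp [connK_apply, conn_one_idxN hn hA hu]

theorem connK_one_last (hn : 2 ≤ n) (hA : IsAdaptedFrame ℓ O A) (hu : u ∈ O)
    (s : Fin (n - 1) → K) :
    connK K A u 1 (Fin.last (n + 1)) s = -connK K A u 0 (idxN n) s := by
  simp [connK_apply, conn_one_last hn hA hu]

/-- The tangent subspace is the image of a space of dimension 2 + (n - 1), so it has less than full
dimension exactly when the parametrization has a kernel. In frame coordinates the A_0 and A_1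
components can always be cancelled; what remains are the stated equations on s. -/
theorem finrank_ruledTangent_lt_iff (hn : 2 ≤ n) (hA : IsAdaptedFrame ℓ O A) (hu : u ∈ O)
    {p q : K} (hpq : p ≠ 0 ∨ q ≠ 0) :
    Module.finrank K (ruledTangent K ℓ u (p • emb K (A 0 u) + q • emb K (A 1 u))) < n + 1 ↔
      ∃ s : Fin (n - 1) → K, s ≠ 0 ∧ connK K A u 0 (idxN n) s = 0 ∧
        ∀ i, p * connK K A u 0 (mid i) s + q * connK K A u 1 (mid i) s = 0 := by
  rw [← range_tangentMap hn hA hu]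
  have hdim : Module.finrank K ((K × K) × (Fin (n - 1) → K)) = n + 1 := by
    simp
    omega
  have hker := LinearMap.finrank_range_add_finrank_ker (tangentMap A u p q)
  rw [hdim] at hker
  have hiff : Module.finrank K (LinearMap.range (tangentMap A u p q)) < n + 1 ↔
      LinearMap.ker (tangentMap A u p q) ≠ ⊥ := by
    rw [← Submodule.one_le_finrank_iff]
    omega
  rw [hiff, Submodule.ne_bot_iff]
  have hne : ∀ i : Fin (n - 2), (mid i : Fin (n + 2)) ≠ 0 ∧ (mid i : Fin (n + 2)) ≠ 1 := fun i => by
    constructor <;> simp [mid, Fin.ext_iff]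
  have hne' : idxN n ≠ 0 ∧ idxN n ≠ 1 := by
    constructor <;> (simp [idxN, Fin.ext_iff]; omega)
  have hne'' : Fin.last (n + 1) ≠ 0 ∧ Fin.last (n + 1) ≠ 1 := by
    constructor <;> simp [Fin.ext_iff]
    omega
  constructor
  · rintro ⟨⟨⟨a, b⟩, s⟩, hx, hx0⟩
    rw [LinearMap.mem_ker, tangentMap_eq_comb hn hA hu] at hx
    have hc := comb_injective hn hA hu hx
    -- The A_n component is pω_0^n(s) and the A_{n+1} component is -qω_0^n(s); one of p, q is
    -- nonzero.
    have hN : connK K A u 0 (idxN n) s = 0 := by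
      have h1 := congrFun hc (idxN n)
      have h2 := congrFun hc (Fin.last (n + 1))
      simp [hne'.1, hne'.2, connK_one_idxN hn hA hu] at h1
      simp [hne''.1, hne''.2, connK_one_last hn hA hu, connK_zero_last hn hA hu] at h2
      rcases hpq with h | h
      · exact h1.resolve_left h
      · exact h2.resolve_left h
    refine ⟨s, ?_, hN, fun i => ?_⟩
    · rintro rfl
      have h0 := congrFun hc 0
      have h1 := congrFun hc 1
      simp at h0 h1
      exact hx0 (by simp [h0, h1])
    · have := congrFun hc (mid i)
      simpa [(hne i).1, (hne i).2] using this
  · rintro ⟨s, hs, hN, hi⟩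
    -- The coefficients of A_0 and A_1 are chosen to cancel those of the velocity.
    refine ⟨((-(p * connK K A u 0 0 s + q * connK K A u 1 0 s),
      -(p * connK K A u 0 1 s + q * connK K A u 1 1 s)), s), ?_, fun h => hs (congrArg Prod.snd h)⟩
    rw [LinearMap.mem_ker, tangentMap_eq_comb hn hA hu]
    have : ∀ c : Fin (n + 2) → K, c = 0 → comb A u c = 0 := by
      rintro c rfl
      simp [comb]
    refine this _ (funext fun ξ => ?_)
    rcases frame_index_cases hn ξ with rfl | rfl | ⟨i, rfl⟩ | rfl | rfl
    · simp
    · simp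
    · simpa [(hne i).1, (hne i).2] using hi i
    · simp [hne'.1, hne'.2, connK_one_idxN hn hA hu, hN]
    · simp [hne''.1, hne''.2, connK_one_last hn hA hu, connK_zero_last hn hA hu, hN]

/-- The singularity criterion at q = 0 is precisely linear dependence of ω_0^i and ω_0^n, so
nonsingularity of A_0 makes them basis forms. -/
theorem basisForms_of_finrank (hn : 2 ≤ n) (hA : IsAdaptedFrame ℓ O A) (hu : u ∈ O)
    {p : K} (hp : p ≠ 0)
    (h : ¬ Module.finrank K (ruledTangent K ℓ u (p • emb K (A 0 u))) < n + 1) :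
    BasisForms A u := by
  intro w hi hN
  by_contra hw
  have h2 := finrank_ruledTangent_lt_iff hn hA hu (q := (0 : K)) (Or.inl hp)
  rw [zero_smul, add_zero] at h2
  refine h (h2.2 ⟨fun k => algebraMap ℝ K (w k), ?_, ?_, fun i => ?_⟩)
  · intro h0
    exact hw (funext fun k => (algebraMap ℝ K).injective (by simpa using congrFun h0 k))
  · rw [connK_ofReal, hN, map_zero]
  · rw [connK_ofReal, hi, map_zero]; simp

theorem connK_eq_re_im (ξ η : Fin (n + 2)) (s : Fin (n - 1) → ℂ) :
    connK ℂ A u ξ η s = conn A u (fun k => (s k).re) ξ η +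
      conn A u (fun k => (s k).im) ξ η * Complex.I := by
  have h : s = (fun k => algebraMap ℝ ℂ (s k).re) +
      Complex.I • (fun k => algebraMap ℝ ℂ (s k).im) := by
    funext k
    simp [mul_comm Complex.I]
  conv_lhs => rw [h]
  rw [map_add, map_smul, connK_ofReal, connK_ofReal, smul_eq_mul, mul_comm]
  rfl

/-- The basis forms on complex vectors. -/
def basisMapC (A : Fin (n + 2) → Param n → Vec ℝ n) (u : Param n) :
    (Fin (n - 1) → ℂ) →ₗ[ℂ] (Fin (n - 2) → ℂ) × ℂ :=
  (LinearMap.pi fun i => connK ℂ A u 0 (mid i)).prod (connK ℂ A u 0 (idxN n))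

/-- The forms have real coefficients, so a complex vector in their common kernel has real and
imaginary parts there too. -/
theorem bijective_basisMapC (hn : 2 ≤ n) (hB : BasisForms A u) :
    Function.Bijective (basisMapC A u) := by
  have hinj : Function.Injective (basisMapC A u) := by
    rw [injective_iff_map_eq_zero]
    intro s hs
    have h1 : ∀ i, connK ℂ A u 0 (mid i) s = 0 := fun i => congrFun (congrArg Prod.fst hs) i
    have h2 : connK ℂ A u 0 (idxN n) s = 0 := congrArg Prod.snd hs
    simp only [connK_eq_re_im, Complex.ext_iff] at h1 h2
    simp at h1 h2
    have e1 := hB _ (fun i => (h1 i).1) h2.1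
    have e2 := hB _ (fun i => (h1 i).2) h2.2
    funext k
    exact Complex.ext (congrFun e1 k) (congrFun e2 k)
  refine ⟨hinj, (LinearMap.injective_iff_surjective_of_finrank_eq_finrank ?_).1 hinj⟩
  simp
  omega

theorem connK_affinor {Λ : Matrix (Fin (n - 2)) (Fin (n - 2)) ℝ} {μ : Fin (n - 2) → ℝ}
    (h : IsAffinor A u Λ μ) (s : Fin (n - 1) → K) (i : Fin (n - 2)) :
    connK K A u 1 (mid i) s = ∑ j, algebraMap ℝ K (Λ i j) * connK K A u 0 (mid j) s +
      algebraMap ℝ K (μ i) * connK K A u 0 (idxN n) s := by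
  simp only [connK_apply, h _ i, map_add, map_sum, map_mul, add_mul, Finset.sum_add_distrib,
    Finset.mul_sum, Finset.sum_mul]
  rw [Finset.sum_comm]
  simp only [mul_assoc]

/-- On the kernel of ω_0^n the values ω_0^i(s) form an arbitrary complex vector, and pω_0^i + qω_1^i
is the matrix p + qλ applied to it. A nonzero solution exists exactly when this matrix is
degenerate. -/
theorem finrank_ruledTangent_lt_iff_det (hn : 2 ≤ n) (hA : IsAdaptedFrame ℓ O A) (hu : u ∈ O)
    (hB : BasisForms A u) {Λ : Matrix (Fin (n - 2)) (Fin (n - 2)) ℝ} {μ : Fin (n - 2) → ℝ}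
    (hΛ : IsAffinor A u Λ μ) {p q : ℂ} (hpq : p ≠ 0 ∨ q ≠ 0) :
    Module.finrank ℂ (ruledTangent ℂ ℓ u (p • emb ℂ (A 0 u) + q • emb ℂ (A 1 u))) < n + 1 ↔
      (p • (1 : Matrix (Fin (n - 2)) (Fin (n - 2)) ℂ) + q • Λ.map (algebraMap ℝ ℂ)).det = 0 := by
  rw [finrank_ruledTangent_lt_iff hn hA hu hpq, ← Matrix.exists_mulVec_eq_zero_iff]
  have hmul : ∀ (s : Fin (n - 1) → ℂ), connK ℂ A u 0 (idxN n) s = 0 → ∀ i,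
      ((p • (1 : Matrix (Fin (n - 2)) (Fin (n - 2)) ℂ) + q • Λ.map (algebraMap ℝ ℂ)) *ᵥ
        fun j => connK ℂ A u 0 (mid j) s) i =
      p * connK ℂ A u 0 (mid i) s + q * connK ℂ A u 1 (mid i) s := by
    intro s hs i
    rw [connK_affinor hΛ, hs, Matrix.add_mulVec, Matrix.smul_mulVec, Matrix.smul_mulVec,
      Matrix.one_mulVec]
    simp [Matrix.mulVec, dotProduct]
  constructor
  · rintro ⟨s, hs, hN, hi⟩
    refine ⟨fun j => connK ℂ A u 0 (mid j) s, fun h0 => hs ?_, funext fun i => ?_⟩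
    · apply (bijective_basisMapC hn hB).1
      rw [map_zero]
      exact Prod.ext h0 hN
    · rw [hmul s hN, hi]; rfl
  · rintro ⟨v, hv, hv0⟩
    obtain ⟨s, hs⟩ := (bijective_basisMapC hn hB).2 (v, 0)
    have h1 : (fun j => connK ℂ A u 0 (mid j) s) = v := congrArg Prod.fst hs
    have h2 : connK ℂ A u 0 (idxN n) s = 0 := congrArg Prod.snd hs
    refine ⟨s, ?_, h2, fun i => ?_⟩
    · rintro rfl
      exact hv (by rw [← h1]; funext j; simp)
    · rw [← hmul s h2, h1, hv0]; rfl

end Singular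

/-! ### Existence of adapted frames -/

section Existence

variable {n : ℕ}

theorem bil_eq_frame_sum {R : Type*} [CommRing R] (hn : 2 ≤ n) (x y : Vec R n) :
    bil x y = x 0 * y 0 + x 1 * y 1 + ∑ i : Fin (n - 2), x (mid i) * y (mid i) -
      x (idxN n) * y (idxN n) - x (Fin.last (n + 1)) * y (Fin.last (n + 1)) := by
  rw [bil_apply, sum_frame hn]
  have h0 : ((0 : Fin (n + 2)) : ℕ) < n := by simp; omega
  have h1 : ((1 : Fin (n + 2)) : ℕ) < n := by simp; omega
  have h2 : ∀ i : Fin (n - 2), ((mid i : Fin (n + 2)) : ℕ) < n := fun i => by simp [mid]; omega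
  have h3 : ¬ ((idxN n : Fin (n + 2)) : ℕ) < n := by simp [idxN]
  have h4 : ¬ ((Fin.last (n + 1) : Fin (n + 2)) : ℕ) < n := by simp
  simp only [h0, h1, h2, h3, h4, if_true, if_false]
  simp only [one_mul]
  ring

theorem eq_zero_of_bil_self_nonpos (hn : 2 ≤ n) {y : Vec ℝ n} (h : bil y y ≤ 0)
    (h3 : y (idxN n) = 0) (h4 : y (Fin.last (n + 1)) = 0) : y = 0 := by
  rw [bil_eq_frame_sum hn, h3, h4] at h
  have hs : 0 ≤ ∑ i : Fin (n - 2), y (mid i) * y (mid i) :=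
    Finset.sum_nonneg fun i _ => mul_self_nonneg _
  have e0 : y 0 = 0 := by nlinarith [mul_self_nonneg (y 0), mul_self_nonneg (y 1)]
  have e1 : y 1 = 0 := by nlinarith [mul_self_nonneg (y 0), mul_self_nonneg (y 1)]
  have e2 : ∑ i : Fin (n - 2), y (mid i) * y (mid i) = 0 := by
    nlinarith [mul_self_nonneg (y 0), mul_self_nonneg (y 1)]
  rw [Finset.sum_eq_zero_iff_of_nonneg fun i _ => mul_self_nonneg _] at e2
  funext ξ
  rcases frame_index_cases hn ξ with rfl | rfl | ⟨i, rfl⟩ | rfl | rfl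
  · exact e0
  · exact e1
  · exact mul_self_eq_zero.1 (e2 i (Finset.mem_univ i))
  · exact h3
  · exact h4

/-- The reflection changing the sign of the two negative coordinates. -/
def refl : Vec ℝ n →ₗ[ℝ] Vec ℝ n where
  toFun x ξ := (if (ξ : ℕ) < n then 1 else -1) * x ξ
  map_add' x y := by funext ξ; simp [mul_add]
  map_smul' c x := by funext ξ; simp only [Pi.smul_apply, smul_eq_mul, RingHom.id_apply]; ring

theorem refl_apply (x : Vec ℝ n) (ξ : Fin (n + 2)) :
    refl x ξ = (if (ξ : ℕ) < n then 1 else -1) * x ξ := rfl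

theorem bil_refl_refl (x y : Vec ℝ n) : bil (refl x) (refl y) = bil x y := by
  simp only [bil_apply, refl_apply]
  refine Finset.sum_congr rfl fun ξ _ => ?_
  split_ifs <;> ring

theorem bil_refl (x y : Vec ℝ n) : bil x (refl y) = x ⬝ᵥ y := by
  simp only [bil_apply, refl_apply, dotProduct]
  refine Finset.sum_congr rfl fun ξ _ => ?_
  split_ifs <;> ring

theorem dotProduct_sub_bil (hn : 2 ≤ n) (x y : Vec ℝ n) : x ⬝ᵥ y - bil x y =
    2 * (x (idxN n) * y (idxN n) + x (Fin.last (n + 1)) * y (Fin.last (n + 1))) := by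
  rw [bil_eq_frame_sum hn, dotProduct, sum_frame hn]
  ring

/-- Orthogonality to a, b and their reflections makes the negative part (α, β) of z
Euclidean-orthogonal to those of a and b. If it were nonzero, those two parts would be proportional,
and a combination of a and b would be isotropic with no negative part, hence zero, against
independence. So z has only positive coordinates. -/
theorem bil_self_pos_of_orthogonal (hn : 2 ≤ n) {a b z : Vec ℝ n} (haa : bil a a = 0)
    (hab : bil a b = 0) (hbb : bil b b = 0)
    (hli : ∀ s t : ℝ, s • a + t • b = 0 → s = 0 ∧ t = 0)
    (hza : bil z a = 0) (hzb : bil z b = 0) (hza' : bil z (refl a) = 0)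
    (hzb' : bil z (refl b) = 0) (hz : z ≠ 0) : 0 < bil z z := by
  have ea := dotProduct_sub_bil hn z a
  have eb := dotProduct_sub_bil hn z b
  rw [← bil_refl, hza, hza'] at ea
  rw [← bil_refl, hzb, hzb'] at eb
  set α := z (idxN n)
  set β := z (Fin.last (n + 1))
  by_cases hαβ : α = 0 ∧ β = 0
  · by_contra hneg
    exact hz (eq_zero_of_bil_self_nonpos hn (not_lt.1 hneg) hαβ.1 hαβ.2)
  exfalso
  have hpos : α ^ 2 + β ^ 2 ≠ 0 := by
    intro h
    refine hαβ ⟨?_, ?_⟩ <;> nlinarith [sq_nonneg α, sq_nonneg β]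
  -- ma and mb are the components of the negative parts of a and b along (-β, α), the only direction
  -- left to them; mb a - ma b has no negative part.
  set ma := -β * a (idxN n) + α * a (Fin.last (n + 1)) with hma
  set mb := -β * b (idxN n) + α * b (Fin.last (n + 1)) with hmb
  have hy : mb • a + (-ma) • b = 0 := by
    apply eq_zero_of_bil_self_nonpos hn
    · have hba : bil b a = 0 := by rw [bil_comm, hab]
      simp [haa, hab, hbb, hba]
    · simp only [Pi.add_apply, Pi.smul_apply, smul_eq_mul]
      rw [hma, hmb]
      linear_combination (-b (Fin.last (n + 1)) / 2) * ea + (a (Fin.last (n + 1)) / 2) * eb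
    · simp only [Pi.add_apply, Pi.smul_apply, smul_eq_mul]
      rw [hma, hmb]
      linear_combination (-a (idxN n) / 2) * eb + (b (idxN n) / 2) * ea
  have hm0 : ma = 0 := neg_eq_zero.1 (hli _ _ hy).2
  have han : a (idxN n) = 0 := by
    refine (mul_eq_zero.1 ?_).resolve_left hpos
    linear_combination (-α / 2) * ea - β * hm0
  have hal : a (Fin.last (n + 1)) = 0 := by
    refine (mul_eq_zero.1 ?_).resolve_left hpos
    linear_combination (-β / 2) * ea + α * hm0
  have ha0 := eq_zero_of_bil_self_nonpos hn haa.le han hal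
  have := (hli 1 0 (by simp [ha0])).1
  exact one_ne_zero this

/-- Four linear conditions in dimension n + 2 leave a kernel of dimension at least n - 2. -/
theorem exists_linearIndependent_orthogonal (f : Fin 4 → Vec ℝ n) :
    ∃ E : Fin (n - 2) → Vec ℝ n, LinearIndependent ℝ E ∧ ∀ i k, bil (E i) (f k) = 0 := by
  let L : Vec ℝ n →ₗ[ℝ] (Fin 4 → ℝ) := LinearMap.pi fun k => (bil (R := ℝ)).flip (f k)
  have hker : n - 2 ≤ Module.finrank ℝ (LinearMap.ker L) := by
    have h1 := LinearMap.finrank_range_add_finrank_ker L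
    have h2 := Submodule.finrank_le (LinearMap.range L)
    simp at h1 h2
    omega
  obtain ⟨E, hE⟩ := exists_linearIndependent_of_le_finrank hker
  refine ⟨fun i => (E i : Vec ℝ n), hE.map' (LinearMap.ker L).subtype (by simp), fun i k => ?_⟩
  exact congrFun (LinearMap.mem_ker.1 (E i).2) k

/-- Completion of a pair of isotropic sections to an adapted frame. -/
theorem exists_adaptedFrame_of_sections (hn : 2 ≤ n) {ℓ : Param n → Submodule ℝ (Vec ℝ n)}
    {O : Set (Param n)} (hO : IsOpen O) {a b : Param n → Vec ℝ n} (ha : ContDiffOn ℝ ∞ a O)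
    (hb : ContDiffOn ℝ ∞ b O) (hspan : ∀ v ∈ O, ℓ v = Submodule.span ℝ {a v, b v})
    (haa : ∀ v ∈ O, bil (a v) (a v) = 0) (hab : ∀ v ∈ O, bil (a v) (b v) = 0)
    (hbb : ∀ v ∈ O, bil (b v) (b v) = 0)
    (hli : ∀ v ∈ O, ∀ s t : ℝ, s • a v + t • b v = 0 → s = 0 ∧ t = 0)
    {u : Param n} (hu : u ∈ O) :
    ∃ O' ⊆ O, u ∈ O' ∧ ∃ A, IsAdaptedFrame ℓ O' A ∧ A 0 = a := by
  let J : Vec ℝ n →L[ℝ] Vec ℝ n := refl.toContinuousLinearMap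
  have hJ : ∀ x, J x = refl x := fun x => rfl
  have hJa : ContDiffOn ℝ ∞ (fun v => refl (a v)) O := J.contDiff.comp_contDiffOn ha
  have hJb : ContDiffOn ℝ ∞ (fun v => refl (b v)) O := J.contDiff.comp_contDiffOn hb
  let p : Param n → ℝ := fun v => bil (a v) (refl (a v))
  let q : Param n → ℝ := fun v => bil (a v) (refl (b v))
  let r : Param n → ℝ := fun v => bil (b v) (refl (b v))
  have hp : ContDiffOn ℝ ∞ p O := contDiffOn_scal ha hJa
  have hq : ContDiffOn ℝ ∞ q O := contDiffOn_scal ha hJb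
  have hr : ContDiffOn ℝ ∞ r O := contDiffOn_scal hb hJb
  have hqs : ∀ v, bil (b v) (refl (a v)) = q v := fun v => by
    simp only [q, bil_refl, dotProduct_comm]
  have hba : ∀ v ∈ O, bil (b v) (a v) = 0 := fun v hv => by rw [bil_comm, hab v hv]
  -- The Euclidean Gram determinant of a and b, nonzero by independence.
  let D : Param n → ℝ := fun v => p v * r v - q v * q v
  have hD : ∀ v ∈ O, D v ≠ 0 := by
    intro v hv h0
    have hz : r v • a v + (-q v) • b v = 0 := by
      have : (r v • a v + (-q v) • b v) ⬝ᵥ (r v • a v + (-q v) • b v) = 0 := by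
        rw [← bil_refl]
        simp only [map_add, map_smul, LinearMap.add_apply, LinearMap.smul_apply, hqs, smul_eq_mul]
        change r v * (r v * p v + -q v * q v) + -q v * (r v * q v + -q v * r v) = 0
        linear_combination r v * h0
      exact dotProduct_self_eq_zero.1 this
    have hr0 := (hli v hv _ _ hz).1
    simp only [r, bil_refl] at hr0
    have hb0 := dotProduct_self_eq_zero.1 hr0
    exact one_ne_zero (hli v hv 0 1 (by simp [hb0])).2
  have hDs : ContDiffOn ℝ ∞ D O := (hp.mul hr).sub (hq.mul hq)
  -- The reflections of a and b span an isotropic plane paired with the plane of a and b by the Gram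
  -- matrix. N and M are the basis of it dual to a, b up to sign.
  let N : Param n → Vec ℝ n := fun v => (-(D v)⁻¹) • (r v • refl (a v) - q v • refl (b v))
  let M : Param n → Vec ℝ n := fun v => (-(D v)⁻¹) • (p v • refl (b v) - q v • refl (a v))
  have hN : ContDiffOn ℝ ∞ N O := (hDs.inv hD).neg.smul ((hr.smul hJa).sub (hq.smul hJb))
  have hM : ContDiffOn ℝ ∞ M O := (hDs.inv hD).neg.smul ((hp.smul hJb).sub (hq.smul hJa))
  have haN : ∀ v ∈ O, bil (a v) (N v) = -1 := fun v hv => by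
    simp only [N, map_smul, map_sub, smul_eq_mul]
    change -(D v)⁻¹ * (r v * p v - q v * q v) = -1
    rw [show r v * p v - q v * q v = D v by simp only [D]; ring]
    have := hD v hv
    field_simp
  have hbN : ∀ v, bil (b v) (N v) = 0 := fun v => by
    simp only [N, map_smul, map_sub, smul_eq_mul, hqs]
    change -(D v)⁻¹ * (r v * q v - q v * r v) = 0
    ring
  have hbM : ∀ v ∈ O, bil (b v) (M v) = -1 := fun v hv => by
    simp only [M, map_smul, map_sub, smul_eq_mul, hqs]
    change -(D v)⁻¹ * D v = -1
    have := hD v hv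
    field_simp
  have haM : ∀ v, bil (a v) (M v) = 0 := fun v => by
    simp only [M, map_smul, map_sub, smul_eq_mul]
    change -(D v)⁻¹ * (p v * q v - q v * p v) = 0
    ring
  have hNN : ∀ v ∈ O, bil (N v) (N v) = 0 := fun v hv => by
    simp [N, bil_refl_refl, haa v hv, hab v hv, hbb v hv, hba v hv]
  have hMN : ∀ v ∈ O, bil (M v) (N v) = 0 := fun v hv => by
    simp [N, M, bil_refl_refl, haa v hv, hab v hv, hbb v hv, hba v hv]
  have hMM : ∀ v ∈ O, bil (M v) (M v) = 0 := fun v hv => by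
    simp [M, bil_refl_refl, haa v hv, hab v hv, hbb v hv, hba v hv]
  obtain ⟨E, hE, hEo⟩ := exists_linearIndependent_orthogonal ![a u, b u, N u, M u]
  -- The constant vectors E_i, projected onto the orthogonal complement of a, b, N, M at v; the plus
  -- signs compensate (a, N) = (b, M) = -1.
  let G : Fin (n - 2) → Param n → Vec ℝ n := fun i v => E i + bil (E i) (N v) • a v +
    bil (E i) (a v) • N v + bil (E i) (M v) • b v + bil (E i) (b v) • M v
  have hG : ∀ i, ContDiffOn ℝ ∞ (G i) O := fun i =>
    (((contDiffOn_const.add ((contDiffOn_scal contDiffOn_const hN).smul ha)).add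
      ((contDiffOn_scal contDiffOn_const ha).smul hN)).add
      ((contDiffOn_scal contDiffOn_const hM).smul hb)).add
      ((contDiffOn_scal contDiffOn_const hb).smul hM)
  have hNa : ∀ v ∈ O, bil (N v) (a v) = -1 := fun v hv => by rw [bil_comm, haN v hv]
  have hNb : ∀ v, bil (N v) (b v) = 0 := fun v => by rw [bil_comm, hbN v]
  have hMa : ∀ v, bil (M v) (a v) = 0 := fun v => by rw [bil_comm, haM v]
  have hMb : ∀ v ∈ O, bil (M v) (b v) = -1 := fun v hv => by rw [bil_comm, hbM v hv]
  have hNM : ∀ v ∈ O, bil (N v) (M v) = 0 := fun v hv => by rw [bil_comm, hMN v hv]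
  have hGa : ∀ i, ∀ v ∈ O, bil (G i v) (a v) = 0 := fun i v hv => by
    simp [G, haa v hv, hba v hv, hNa v hv, hMa v]
  have hGb : ∀ i, ∀ v ∈ O, bil (G i v) (b v) = 0 := fun i v hv => by
    simp [G, hab v hv, hbb v hv, hNb v, hMb v hv]
  have hGN : ∀ i, ∀ v ∈ O, bil (G i v) (N v) = 0 := fun i v hv => by
    simp [G, haN v hv, hbN v, hNN v hv, hMN v hv]
  have hGM : ∀ i, ∀ v ∈ O, bil (G i v) (M v) = 0 := fun i v hv => by
    simp [G, haM v, hbM v hv, hNM v hv, hMM v hv]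
  have hGu : ∀ i, G i u = E i := fun i => by
    have h0 := hEo i 0
    have h1 := hEo i 1
    have h2 := hEo i 2
    have h3 := hEo i 3
    simp at h0 h1 h2 h3
    simp [G, h0, h1, h2, h3]
  let A : Fin (n + 2) → Param n → Vec ℝ n := ofParts a b G M N
  have A0 : A 0 = a := ofParts_zero ..
  have A1 : A 1 = b := ofParts_one ..
  have Am : ∀ i, A (mid i) = G i := fun i => ofParts_mid ..
  have An : A (idxN n) = M := ofParts_idxN _ _ _ _ _ hn
  have Al : A (Fin.last (n + 1)) = N := ofParts_last _ _ _ _ _ hn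
  have hA : ∀ ξ, ContDiffOn ℝ ∞ (A ξ) O := fun ξ => by
    rcases frame_index_cases hn ξ with rfl | rfl | ⟨i, rfl⟩ | rfl | rfl
    · rwa [A0]
    · rwa [A1]
    · rw [Am]; exact hG i
    · rwa [An]
    · rwa [Al]
  -- The projected vectors are independent at u; the open set where the determinant is nonzero is
  -- the domain of the frame.
  let d : Param n → ℝ := fun v => (Matrix.of fun ξ => A ξ v).det
  have hd : ContinuousOn d O := by
    rw [continuousOn_iff_continuous_domRestrict]
    refine Continuous.matrix_det (continuous_pi fun ξ => ?_)
    exact continuousOn_iff_continuous_domRestrict.1 (hA ξ).continuousOn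
  have hdu : d u ≠ 0 := by
    intro h0
    obtain ⟨c, hc, hc0⟩ := Matrix.exists_vecMul_eq_zero_iff.2 h0
    have hsum : c 0 • a u + c 1 • b u + ∑ i, c (mid i) • E i + c (idxN n) • M u +
        c (Fin.last (n + 1)) • N u = 0 := by
      have : ∑ ξ, c ξ • A ξ u = 0 := by
        funext η
        have := congrFun hc0 η
        simpa [Matrix.vecMul, dotProduct, Finset.sum_apply] using this
      rw [sum_frame hn, A0, A1, An, Al] at this
      simpa [Am, hGu] using this
    have hEa : ∀ i, bil (E i) (a u) = 0 := fun i => hEo i 0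
    have hEb : ∀ i, bil (E i) (b u) = 0 := fun i => hEo i 1
    have hEN : ∀ i, bil (E i) (N u) = 0 := fun i => hEo i 2
    have hEM : ∀ i, bil (E i) (M u) = 0 := fun i => hEo i 3
    have e1 := congrArg (fun x => bil x (a u)) hsum
    have e2 := congrArg (fun x => bil x (b u)) hsum
    have e3 := congrArg (fun x => bil x (N u)) hsum
    have e4 := congrArg (fun x => bil x (M u)) hsum
    simp [haa u hu, hba u hu, hEa, hMa, hNa u hu] at e1
    simp [hab u hu, hbb u hu, hEb, hMb u hu, hNb] at e2
    simp [haN u hu, hbN, hEN, hMN u hu, hNN u hu] at e3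
    simp [haM, hbM u hu, hEM, hMM u hu, hNM u hu] at e4
    simp only [e1, e2, e3, e4, zero_smul, zero_add, add_zero] at hsum
    have hm := Fintype.linearIndependent_iff.1 hE _ hsum
    refine hc (funext fun ξ => ?_)
    rcases frame_index_cases hn ξ with rfl | rfl | ⟨i, rfl⟩ | rfl | rfl
    · exact e3
    · exact e4
    · exact hm i
    · exact e2
    · exact e1
  refine ⟨O ∩ d ⁻¹' {0}ᶜ, Set.inter_subset_left, ⟨hu, hdu⟩, A, ?_, A0⟩
  have hcomm : ∀ v ∈ O, ∀ i, bil (a v) (G i v) = 0 := fun v hv i => by rw [bil_comm, hGa i v hv]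
  have hcomm' : ∀ v ∈ O, ∀ i, bil (b v) (G i v) = 0 := fun v hv i => by rw [bil_comm, hGb i v hv]
  constructor
  · exact hd.isOpen_inter_preimage hO isOpen_compl_singleton
  · exact fun ξ => (hA ξ).mono Set.inter_subset_left
  · rw [A0, A1]; exact fun v hv => hspan v hv.1
  · rw [A0]; exact fun v hv => haa v hv.1
  · rw [A0, A1]; exact fun v hv => hab v hv.1
  · intro v hv i; rw [A0, Am]; exact hcomm v hv.1 i
  · rw [A0, An]; exact fun v hv => haM v
  · rw [A0, Al]; exact fun v hv => haN v hv.1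
  · rw [A1]; exact fun v hv => hbb v hv.1
  · intro v hv i; rw [A1, Am]; exact hcomm' v hv.1 i
  · rw [A1, An]; exact fun v hv => hbM v hv.1
  · rw [A1, Al]; exact fun v hv => hbN v
  · intro v hv
    refine Matrix.PosDef.of_dotProduct_mulVec_pos ?_ ?_
    · ext i j
      simp [gMat, scal_eq_bil, bil_comm]
    · intro x hx
      have hz : star x ⬝ᵥ (gMat A v *ᵥ x) = bil (∑ i, x i • G i v) (∑ i, x i • G i v) := by
        simp only [map_sum, LinearMap.sum_apply, map_smul, LinearMap.smul_apply, smul_eq_mul,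
          dotProduct, Matrix.mulVec, gMat, Matrix.of_apply, Am, scal_eq_bil, Finset.mul_sum,
          star_trivial]
        rw [Finset.sum_comm]
        refine Finset.sum_congr rfl fun i _ => Finset.sum_congr rfl fun j _ => ?_
        ring
      rw [hz]
      -- N, M and the two reflections span the same plane, by D ≠ 0, so the positivity lemma applies
      -- to combinations of the G_i.
      have hrefl : ∀ w : Vec ℝ n, bil w (N v) = 0 → bil w (M v) = 0 →
          bil w (refl (a v)) = 0 ∧ bil w (refl (b v)) = 0 := by
        intro w h1 h2
        have hDv := hD v hv.1
        simp only [N, M, map_smul, map_sub, smul_eq_mul, mul_eq_zero, neg_eq_zero, inv_eq_zero,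
          hDv, false_or] at h1 h2
        constructor
        · refine (mul_eq_zero.1 ?_).resolve_left hDv
          simp only [D]
          linear_combination p v * h1 + q v * h2
        · refine (mul_eq_zero.1 ?_).resolve_left hDv
          simp only [D]
          linear_combination r v * h2 + q v * h1
      obtain ⟨hra, hrb⟩ := hrefl (∑ i, x i • G i v) (by simp [hGN _ v hv.1]) (by simp [hGM _ v hv.1])
      refine bil_self_pos_of_orthogonal hn (haa v hv.1) (hab v hv.1) (hbb v hv.1) (hli v hv.1)
        (by simp [hGa _ v hv.1]) (by simp [hGb _ v hv.1]) hra hrb ?_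
      intro h0
      refine hv.2 (Matrix.exists_vecMul_eq_zero_iff.1
        ⟨ofParts (n := n) 0 0 x 0 0, fun h => hx ?_, ?_⟩)
      · funext i
        have := congrFun h (mid i)
        simpa using this
      · have hs : ∑ ξ, ofParts (n := n) 0 0 x 0 0 ξ • A ξ v = 0 := by
          rw [sum_frame hn, ofParts_idxN _ _ _ _ _ hn, ofParts_last _ _ _ _ _ hn]
          simpa [Am] using h0
        funext η
        have := congrFun hs η
        simpa [Matrix.vecMul, dotProduct, Finset.sum_apply] using this
  · intro v hv i; rw [Am, An]; exact hGM i v hv.1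
  · intro v hv i; rw [Am, Al]; exact hGN i v hv.1
  · rw [An]; exact fun v hv => hMM v hv.1
  · rw [An, Al]; exact fun v hv => hMN v hv.1
  · rw [Al]; exact fun v hv => hNN v hv.1

/-- A_0 may be placed at any prescribed nonzero vector of the line; it will be a nonsingular point.
-/
theorem exists_adaptedFrame (hn : 2 ≤ n) {Ω : Set (Param n)} {ℓ : Param n → Submodule ℝ (Vec ℝ n)}
    (hΩ : IsCongruence Ω ℓ) {u : Param n} (hu : u ∈ Ω) {X : Vec ℝ n} (hX : X ∈ ℓ u)
    (hX0 : X ≠ 0) :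
    ∃ O ⊆ Ω, u ∈ O ∧ ∃ A, IsAdaptedFrame ℓ O A ∧ A 0 u = X := by
  obtain ⟨O, hOΩ, hO, huO, B, C, hB, hC, hℓ⟩ := hΩ.smooth u hu
  rw [hℓ u huO] at hX
  obtain ⟨b, c, rfl⟩ := Submodule.mem_span_pair.1 hX
  have hbc : b ^ 2 + c ^ 2 ≠ 0 := by
    intro h
    have hb : b = 0 := by nlinarith [sq_nonneg b, sq_nonneg c]
    have hc : c = 0 := by nlinarith [sq_nonneg b, sq_nonneg c]
    exact hX0 (by simp [hb, hc])
  have hmem : ∀ v ∈ O, B v ∈ ℓ v ∧ C v ∈ ℓ v := fun v hv => by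
    rw [hℓ v hv]
    exact ⟨Submodule.subset_span (by simp), Submodule.subset_span (by simp)⟩
  have hiso : ∀ v ∈ O, ∀ x ∈ ℓ v, ∀ y ∈ ℓ v, bil x y = 0 :=
    fun v hv => hΩ.isotropic v (hOΩ hv)
  have hcomb : ∀ v ∈ O, ∀ s t : ℝ, s • B v + t • C v ∈ ℓ v := fun v hv s t =>
    Submodule.add_mem _ (Submodule.smul_mem _ _ (hmem v hv).1)
      (Submodule.smul_mem _ _ (hmem v hv).2)
  -- The second section is obtained from (b, c) by a quarter turn, so the change of sections has
  -- determinant b² + c² ≠ 0.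
  have hspan : ∀ v ∈ O, ℓ v = Submodule.span ℝ {b • B v + c • C v, (-c) • B v + b • C v} := by
    intro v hv
    apply le_antisymm
    · rw [hℓ v hv, Submodule.span_le]
      rintro _ (rfl | rfl)
      · refine Submodule.mem_span_pair.2 ⟨b / (b ^ 2 + c ^ 2), -c / (b ^ 2 + c ^ 2), ?_⟩
        funext ξ
        simp only [Pi.add_apply, Pi.smul_apply, smul_eq_mul]
        field_simp
        ring
      · refine Submodule.mem_span_pair.2 ⟨c / (b ^ 2 + c ^ 2), b / (b ^ 2 + c ^ 2), ?_⟩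
        funext ξ
        simp only [Pi.add_apply, Pi.smul_apply, smul_eq_mul]
        field_simp
        ring
    · rw [Submodule.span_le]
      rintro _ (rfl | rfl)
      · exact hcomb v hv _ _
      · exact hcomb v hv _ _
  have hli : ∀ v ∈ O, ∀ s t : ℝ,
      s • (b • B v + c • C v) + t • ((-c) • B v + b • C v) = 0 → s = 0 ∧ t = 0 := by
    intro v hv
    have hfr := hΩ.finrank_eq v (hOΩ hv)
    rw [hspan v hv] at hfr
    have : LinearIndependent ℝ ![b • B v + c • C v, (-c) • B v + b • C v] := by
      rw [linearIndependent_iff_card_eq_finrank_span]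
      rw [Set.finrank, Matrix.range_cons, Matrix.range_cons, Matrix.range_empty, Set.union_empty]
      exact (Fintype.card_fin 2).trans hfr.symm
    exact LinearIndependent.pair_iff.1 this
  obtain ⟨O', hO', huO', A, hA, hA0⟩ := exists_adaptedFrame_of_sections hn (ℓ := ℓ) hO
    (a := fun v => b • B v + c • C v) (b := fun v => (-c) • B v + b • C v)
    ((hB.const_smul b).add (hC.const_smul c)) ((hB.const_smul (-c)).add (hC.const_smul b)) hspan
    (fun v hv => hiso v hv _ (hcomb v hv _ _) _ (hcomb v hv _ _))
    (fun v hv => hiso v hv _ (hcomb v hv _ _) _ (hcomb v hv _ _))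
    (fun v hv => hiso v hv _ (hcomb v hv _ _) _ (hcomb v hv _ _)) hli huO
  exact ⟨O', hO'.trans hOΩ, huO', A, hA, by rw [hA0]⟩

end Existence

/-! ### The divisor of singular points -/

section Polynomial

variable {n : ℕ} (Λ : Matrix (Fin (n - 2)) (Fin (n - 2)) ℝ)

theorem singularPoly_eq_charpoly : singularPoly Λ = (-(Λ.map (algebraMap ℝ ℂ))).charpoly := by
  rw [singularPoly, Matrix.charpoly, Matrix.charmatrix]
  congr 1
  ext1 i j
  simp [Matrix.one_apply, Matrix.diagonal_apply, add_comm]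

theorem card_roots_singularPoly : (singularPoly Λ).roots.card = n - 2 := by
  rw [← (IsAlgClosed.splits _).natDegree_eq_card_roots, singularPoly_eq_charpoly,
    Matrix.charpoly_natDegree_eq_dim, Fintype.card_fin]

theorem singularPoly_ne_zero : singularPoly Λ ≠ 0 := by
  rw [singularPoly_eq_charpoly]
  exact (Matrix.charpoly_monic _).ne_zero

theorem eval_singularPoly (x : ℂ) : (singularPoly Λ).eval x =
    (x • (1 : Matrix (Fin (n - 2)) (Fin (n - 2)) ℂ) + Λ.map (algebraMap ℝ ℂ)).det := by
  rw [singularPoly_eq_charpoly, Matrix.eval_charpoly, sub_neg_eq_add, Matrix.scalar_apply,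
    ← Matrix.smul_one_eq_diagonal]

theorem eval_singularPoly_eq_prod (x : ℂ) : (singularPoly Λ).eval x =
    ((singularPoly Λ).roots.map fun r => x - r).prod := by
  have hm : (singularPoly Λ).Monic := by
    rw [singularPoly_eq_charpoly]
    exact Matrix.charpoly_monic _
  have := (IsAlgClosed.splits (singularPoly Λ)).eq_prod_roots_of_monic hm
  conv_lhs => rw [this]
  rw [Polynomial.eval_multiset_prod, Multiset.map_map]
  simp

/-- The factorization of the monic polynomial, homogenized. At q = 0 both sides are p^{n-2}, because
the number of roots equals the degree. -/
theorem det_eq_prod_roots (p q : ℂ) :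
    (p • (1 : Matrix (Fin (n - 2)) (Fin (n - 2)) ℂ) + q • Λ.map (algebraMap ℝ ℂ)).det =
      ((singularPoly Λ).roots.map fun r => p - q * r).prod := by
  by_cases hq : q = 0
  · subst hq
    simp [card_roots_singularPoly]
  · have h1 : p • (1 : Matrix (Fin (n - 2)) (Fin (n - 2)) ℂ) + q • Λ.map (algebraMap ℝ ℂ) =
        q • ((p / q) • (1 : Matrix (Fin (n - 2)) (Fin (n - 2)) ℂ) + Λ.map (algebraMap ℝ ℂ)) := by
      rw [smul_add, smul_smul, mul_div_cancel₀ _ hq]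
    rw [h1, Matrix.det_smul, ← eval_singularPoly, eval_singularPoly_eq_prod, Fintype.card_fin]
    have h2 : (fun r => p - q * r) = fun r => q * (p / q - r) := by
      funext r
      field_simp
    rw [h2, Multiset.prod_map_mul, Multiset.map_const', Multiset.prod_replicate,
      card_roots_singularPoly]

/-- The roots of `det (λ + x)` under a projective change of parameter. -/
theorem roots_singularPoly_of_change {Λ Λ' C : Matrix (Fin (n - 2)) (Fin (n - 2)) ℝ} {a b c d : ℝ}
    (hdet : (C * (a • 1 + b • Λ)).det ≠ 0)
    (h : Λ' * (C * (a • 1 + b • Λ)) = C * (c • 1 + d • Λ)) :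
    (∀ r ∈ (singularPoly Λ).roots, (a : ℂ) - b * r ≠ 0) ∧
    (singularPoly Λ').roots = (singularPoly Λ).roots.map fun r : ℂ => -(c - d * r) / (a - b * r) := by
  let φ : Matrix (Fin (n - 2)) (Fin (n - 2)) ℝ →+* Matrix (Fin (n - 2)) (Fin (n - 2)) ℂ :=
    (algebraMap ℝ ℂ).mapMatrix
  have hφ : ∀ M, φ M = M.map (algebraMap ℝ ℂ) := fun M => rfl
  have hφs : ∀ (s : ℝ) M, φ (s • M) = (s : ℂ) • φ M := fun s M => by
    ext i j
    simp [hφ]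
  have hφl : ∀ s t : ℝ, φ (s • 1 + t • Λ) = (s : ℂ) • 1 + (t : ℂ) • φ Λ := fun s t => by
    rw [map_add, hφs, hφs, map_one]
  have hdetφ : ∀ M, (φ M).det = algebraMap ℝ ℂ M.det := fun M => ((algebraMap ℝ ℂ).map_det M).symm
  have hCdet : (φ C).det ≠ 0 := by
    rw [hdetφ]
    rw [Matrix.det_mul] at hdet
    simpa using left_ne_zero_of_mul hdet
  -- This product is det(a + bΛ), a factor of the nonzero determinant in the hypothesis; no root is
  -- sent to infinity.
  have hδ : ((singularPoly Λ).roots.map fun r => (a : ℂ) - b * r).prod ≠ 0 := by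
    rw [← det_eq_prod_roots, ← hφ, ← hφl, hdetφ]
    rw [Matrix.det_mul] at hdet
    simpa using right_ne_zero_of_mul hdet
  have hne : ∀ r ∈ (singularPoly Λ).roots, (a : ℂ) - b * r ≠ 0 := by
    intro r hr h0
    exact hδ (Multiset.prod_eq_zero (Multiset.mem_map.2 ⟨r, hr, h0⟩))
  refine ⟨hne, ?_⟩
  -- Multiplying x + Λ' by C(a + bΛ) gives C times a pencil in Λ alone; determinants then compare
  -- the two polynomials, C cancelling.
  have hmat : ∀ x : ℂ, (x • 1 + φ Λ') * (φ C * ((a : ℂ) • 1 + (b : ℂ) • φ Λ)) =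
      φ C * ((c + x * a) • 1 + (d + x * b) • φ Λ) := by
    intro x
    have h' := congrArg φ h
    rw [map_mul, map_mul, map_mul, hφl, hφl] at h'
    rw [add_mul, h', smul_mul_assoc, one_mul, ← Matrix.mul_smul, ← Matrix.mul_add]
    congr 1
    module
  have heval : ∀ x : ℂ, (singularPoly Λ').eval x *
      ((singularPoly Λ).roots.map fun r => (a : ℂ) - b * r).prod =
      ((singularPoly Λ).roots.map fun r => (c + x * a) - (d + x * b) * r).prod := by
    intro x
    rw [eval_singularPoly, ← det_eq_prod_roots, ← det_eq_prod_roots, ← hφ, ← hφ]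
    have := congrArg Matrix.det (hmat x)
    rw [Matrix.det_mul, Matrix.det_mul, Matrix.det_mul] at this
    refine mul_left_cancel₀ hCdet ?_
    rw [← this]
    ring
  -- The factor (c + xa) - (d + xb)r equals (a - br)x + (c - dr), whose zero is -(c - dr)/(a - br).
  have hpoly : singularPoly Λ' = (((singularPoly Λ).roots.map fun r : ℂ =>
      -(c - d * r) / (a - b * r)).map fun ρ => Polynomial.X - Polynomial.C ρ).prod := by
    refine Polynomial.funext fun x => mul_right_cancel₀ hδ ?_
    rw [heval, Polynomial.eval_multiset_prod, Multiset.map_map, Multiset.map_map,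
      ← Multiset.prod_map_mul]
    congr 1
    refine Multiset.map_congr rfl fun r hr => ?_
    have := hne r hr
    simp
    field_simp
    ring
  rw [hpoly, Polynomial.roots_multiset_prod_X_sub_C]

end Polynomial

/-! ### Singular points of a line as roots of det(λ + x). -/

section Points

variable {n : ℕ} {ℓ : Param n → Submodule ℝ (Vec ℝ n)} {O : Set (Param n)}
  {A : Fin (n + 2) → Param n → Vec ℝ n} {u : Param n}

theorem pointOn_eq (x : ℂ) : pointOn A u x = x • emb ℂ (A 0 u) + (1 : ℂ) • emb ℂ (A 1 u) := by
  funext ξ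
  simp [pointOn, emb_apply, add_comm]

theorem smul_add_smul_eq_zero (hn : 2 ≤ n) (hA : IsAdaptedFrame ℓ O A) (hu : u ∈ O)
    {K : Type*} [RCLike K] {p q : K}
    (h : p • emb K (A 0 u) + q • emb K (A 1 u) = 0) : p = 0 ∧ q = 0 := by
  have h2 : comb A u (p • Pi.single 0 1 + q • Pi.single 1 1 : Fin (n + 2) → K) = 0 := by
    rw [comb_add, comb_smul, comb_smul, comb_single, comb_single, h]
  have h3 := comb_injective hn hA hu h2
  have e0 := congrFun h3 0
  have e1 := congrFun h3 1
  simp at e0 e1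
  exact ⟨e0, e1⟩

theorem pointOn_ne_zero (hn : 2 ≤ n) (hA : IsAdaptedFrame ℓ O A) (hu : u ∈ O) (x : ℂ) :
    pointOn A u x ≠ 0 := by
  rw [pointOn_eq]
  exact fun h => one_ne_zero (smul_add_smul_eq_zero hn hA hu h).2

theorem pointOn_mem (hA : IsAdaptedFrame ℓ O A) (hu : u ∈ O) (x : ℂ) :
    pointOn A u x ∈ extend ℂ (ℓ u) := by
  rw [pointOn_eq, hA.span_eq u hu, extend_span_pair]
  exact Submodule.mem_span_pair.2 ⟨_, _, rfl⟩

theorem rep_eq (hA : IsAdaptedFrame ℓ O A) (hu : u ∈ O) {P : ℙ ℂ (Vec ℂ n)}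
    (hP : P.submodule ≤ extend ℂ (ℓ u)) :
    ∃ p q : ℂ, P.rep = p • emb ℂ (A 0 u) + q • emb ℂ (A 1 u) ∧ (p ≠ 0 ∨ q ≠ 0) := by
  have h : P.rep ∈ extend ℂ (ℓ u) := hP (by
    rw [Projectivization.submodule_eq]
    exact Submodule.mem_span_singleton_self _)
  rw [hA.span_eq u hu, extend_span_pair] at h
  obtain ⟨p, q, hpq⟩ := Submodule.mem_span_pair.1 h
  refine ⟨p, q, hpq.symm, ?_⟩
  by_contra hcon
  push Not at hcon
  apply P.rep_nonzero
  rw [← hpq, hcon.1, hcon.2]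
  simp

/-- A zero of ∏(p - qr) with (p, q) ≠ 0 has q ≠ 0 and p = qr, so pA_0 + qA_1 is proportional to A_1
+ rA_0; in particular A_0 is never singular in a frame with basis forms. -/
theorem isSingularPoint_iff (hn : 2 ≤ n) (hA : IsAdaptedFrame ℓ O A) (hu : u ∈ O)
    (hB : BasisForms A u) {Λ : Matrix (Fin (n - 2)) (Fin (n - 2)) ℝ} {μ : Fin (n - 2) → ℝ}
    (hΛ : IsAffinor A u Λ μ) (P : ℙ ℂ (Vec ℂ n)) :
    IsSingularPoint ℓ u P ↔
      ∃ x ∈ (singularPoly Λ).roots, P.submodule = Submodule.span ℂ {pointOn A u x} := by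
  constructor
  · rintro ⟨hP, hlt⟩
    obtain ⟨p, q, hrep, hpq⟩ := rep_eq hA hu hP
    rw [hrep, finrank_ruledTangent_lt_iff_det hn hA hu hB hΛ hpq, det_eq_prod_roots,
      Multiset.prod_eq_zero_iff, Multiset.mem_map] at hlt
    obtain ⟨r, hr, hpr⟩ := hlt
    have hp : p = q * r := sub_eq_zero.1 hpr
    have hq : q ≠ 0 := by
      rintro rfl
      simp [hp] at hpq
    refine ⟨r, hr, ?_⟩
    have : P.rep = q • pointOn A u r := by
      rw [hrep, pointOn_eq, hp]
      module
    rw [Projectivization.submodule_eq, this]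
    exact Submodule.span_singleton_smul_eq hq.isUnit _
  · rintro ⟨x, hx, hP⟩
    have hle : P.submodule ≤ extend ℂ (ℓ u) := by
      rw [hP, Submodule.span_singleton_le_iff_mem]
      exact pointOn_mem hA hu x
    refine ⟨hle, ?_⟩
    have hmem : P.rep ∈ Submodule.span ℂ {pointOn A u x} := by
      rw [← hP, Projectivization.submodule_eq]
      exact Submodule.mem_span_singleton_self _
    obtain ⟨c, hc⟩ := Submodule.mem_span_singleton.1 hmem
    have hc0 : c ≠ 0 := by
      rintro rfl
      exact P.rep_nonzero (by rw [← hc, zero_smul])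
    have hrep : P.rep = (c * x) • emb ℂ (A 0 u) + c • emb ℂ (A 1 u) := by
      rw [← hc, pointOn_eq]
      module
    rw [hrep, finrank_ruledTangent_lt_iff_det hn hA hu hB hΛ (Or.inr hc0), det_eq_prod_roots]
    exact Multiset.prod_eq_zero (Multiset.mem_map.2 ⟨x, hx, sub_self _⟩)

/-- The divisor of the singular points, computed in an adapted frame. -/
theorem exists_rootDivisor (hn : 2 ≤ n) (hA : IsAdaptedFrame ℓ O A) (hu : u ∈ O)
    (hB : BasisForms A u) {Λ : Matrix (Fin (n - 2)) (Fin (n - 2)) ℝ} {μ : Fin (n - 2) → ℝ}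
    (hΛ : IsAffinor A u Λ μ) :
    ∃ D : Multiset (ℙ ℂ (Vec ℂ n)), D.card = n - 2 ∧ (∀ P, P ∈ D ↔ IsSingularPoint ℓ u P) ∧
      IsRootDivisor A u Λ D := by
  refine ⟨(singularPoly Λ).roots.map fun x =>
    Projectivization.mk ℂ (pointOn A u x) (pointOn_ne_zero hn hA hu x), ?_, fun P => ?_, ?_⟩
  · rw [Multiset.card_map, card_roots_singularPoly]
  · rw [isSingularPoint_iff hn hA hu hB hΛ, Multiset.mem_map]
    refine exists_congr fun x => and_congr_right fun _ => ?_
    rw [← Projectivization.submodule_mk (K := ℂ) (pointOn A u x) (pointOn_ne_zero hn hA hu x),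
      Projectivization.submodule_injective.eq_iff, eq_comm]
  · rw [IsRootDivisor, Multiset.map_map]
    rfl

end Points

/-! ### Change of the adapted frame -/

section Change

variable {n : ℕ} {ℓ : Param n → Submodule ℝ (Vec ℝ n)} {O O' : Set (Param n)}
  {A A' : Fin (n + 2) → Param n → Vec ℝ n} {u : Param n}

/-- The first two vectors of two adapted frames over the same line are related by a regular linear
substitution, and so are their differentials up to vectors of the line. -/
theorem exists_frame_change (hn : 2 ≤ n) (hA : IsAdaptedFrame ℓ O A) (hu : u ∈ O)
    (hA' : IsAdaptedFrame ℓ O' A') (hu' : u ∈ O') :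
    ∃ a b c d : ℝ, a * d - b * c ≠ 0 ∧
      A' 0 u = a • A 0 u + b • A 1 u ∧ A' 1 u = c • A 0 u + d • A 1 u ∧
      (∀ w, fderiv ℝ (A' 0) u w - (a • fderiv ℝ (A 0) u w + b • fderiv ℝ (A 1) u w) ∈ ℓ u) ∧
      (∀ w, fderiv ℝ (A' 1) u w - (c • fderiv ℝ (A 0) u w + d • fderiv ℝ (A 1) u w) ∈ ℓ u) := by
  -- A_{n+1} and A_n are dual to A_0 and A_1, so scalar products with them give the coefficients,
  -- smooth in v.
  have hcoef : ∀ v ∈ O, ∀ X ∈ ℓ v,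
      X = (-bil X (A (Fin.last (n + 1)) v)) • A 0 v + (-bil X (A (idxN n) v)) • A 1 v := by
    intro v hv X hX
    rw [hA.span_eq v hv] at hX
    obtain ⟨s, t, rfl⟩ := Submodule.mem_span_pair.1 hX
    have h1 := hA.s0l v hv
    have h2 := hA.s1l v hv
    have h3 := hA.s0n v hv
    have h4 := hA.s1n v hv
    simp only [scal_eq_bil] at h1 h2 h3 h4
    simp [h1, h2, h3, h4]
  have hmem : ∀ v ∈ O', A' 0 v ∈ ℓ v ∧ A' 1 v ∈ ℓ v := fun v hv => by
    rw [hA'.span_eq v hv]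
    exact ⟨Submodule.subset_span (by simp), Submodule.subset_span (by simp)⟩
  have hAmem : A 0 u ∈ ℓ u ∧ A 1 u ∈ ℓ u := by
    rw [hA.span_eq u hu]
    exact ⟨Submodule.subset_span (by simp), Submodule.subset_span (by simp)⟩
  have hnhds : O ∩ O' ∈ 𝓝 u :=
    Filter.inter_mem (hA.isOpen.mem_nhds hu) (hA'.isOpen.mem_nhds hu')
  -- the differential of a section of the family of lines
  have hder : ∀ Y : Param n → Vec ℝ n, DifferentiableAt ℝ Y u → (∀ v ∈ O ∩ O', Y v ∈ ℓ v) → ∀ w,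
      fderiv ℝ Y u w - ((-bil (Y u) (A (Fin.last (n + 1)) u)) • fderiv ℝ (A 0) u w +
        (-bil (Y u) (A (idxN n) u)) • fderiv ℝ (A 1) u w) ∈ ℓ u := by
    intro Y hY hYm w
    have hb : ∀ ξ, DifferentiableAt ℝ (fun v => -bil (Y v) (A ξ v)) u := fun ξ =>
      ((bil (R := ℝ) (n := n)).toContinuousBilinearMap.hasFDerivAt_of_bilinear hY.hasFDerivAt
        (differentiableAt_frame hA hu ξ).hasFDerivAt).differentiableAt.neg
    have heq : Y =ᶠ[𝓝 u] fun v => (-bil (Y v) (A (Fin.last (n + 1)) v)) • A 0 v +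
        (-bil (Y v) (A (idxN n) v)) • A 1 v := by
      filter_upwards [hnhds] with v hv using hcoef v hv.1 _ (hYm v hv)
    have hd : HasFDerivAt (fun v => (-bil (Y v) (A (Fin.last (n + 1)) v)) • A 0 v +
        (-bil (Y v) (A (idxN n) v)) • A 1 v) _ u :=
      ((hb (Fin.last (n + 1))).hasFDerivAt.smul (differentiableAt_frame hA hu 0).hasFDerivAt).add
        ((hb (idxN n)).hasFDerivAt.smul (differentiableAt_frame hA hu 1).hasFDerivAt)
    rw [heq.fderiv_eq, hd.fderiv]
    simp only [_root_.add_apply, _root_.smul_apply, ContinuousLinearMap.smulRight_apply]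
    rw [show ∀ x y z t : Vec ℝ n, x + y + (z + t) - (x + z) = y + t from fun x y z t => by abel]
    exact Submodule.add_mem _ (Submodule.smul_mem _ _ hAmem.1) (Submodule.smul_mem _ _ hAmem.2)
  have e0 := hcoef u hu _ (hmem u hu').1
  have e1 := hcoef u hu _ (hmem u hu').2
  refine ⟨_, _, _, _, ?_, e0, e1,
    hder _ (differentiableAt_frame hA' hu' 0) fun v hv => (hmem v hv.2).1,
    hder _ (differentiableAt_frame hA' hu' 1) fun v hv => (hmem v hv.2).2⟩
  set a := -bil (A' 0 u) (A (Fin.last (n + 1)) u)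
  set b := -bil (A' 0 u) (A (idxN n) u)
  set c := -bil (A' 1 u) (A (Fin.last (n + 1)) u)
  set d := -bil (A' 1 u) (A (idxN n) u)
  -- With zero determinant, A'_0 and A'_1 would be linearly dependent.
  intro h0
  have hlin : ∀ p q : ℝ, p • A' 0 u + q • A' 1 u = 0 → p = 0 ∧ q = 0 := fun p q h =>
    smul_add_smul_eq_zero (K := ℝ) hn hA' hu' h
  have h1 : d • A' 0 u + (-b) • A' 1 u = 0 := by
    rw [e0, e1, show d • (a • A 0 u + b • A 1 u) + (-b) • (c • A 0 u + d • A 1 u) =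
      (a * d - b * c) • A 0 u by module, h0, zero_smul]
  have h2 : c • A' 0 u + (-a) • A' 1 u = 0 := by
    rw [e0, e1, show c • (a • A 0 u + b • A 1 u) + (-a) • (c • A 0 u + d • A 1 u) =
      -((a * d - b * c) • A 1 u) by module, h0, zero_smul, neg_zero]
  have hd0 := (hlin _ _ h1).1
  have hc0 := (hlin _ _ h2).1
  rw [hd0, hc0] at e1
  exact one_ne_zero (hlin 0 1 (by rw [e1]; simp)).2

theorem bil_eq_zero_of_mem_line (hA : IsAdaptedFrame ℓ O A) (hu : u ∈ O) {x y : Vec ℝ n}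
    (hx : x ∈ ℓ u) (hy : y ∈ ℓ u) : bil x y = 0 := by
  rw [hA.span_eq u hu] at hx hy
  obtain ⟨a, b, rfl⟩ := Submodule.mem_span_pair.1 hx
  obtain ⟨c, d, rfl⟩ := Submodule.mem_span_pair.1 hy
  have h0 := hA.s00 u hu
  have h1 := hA.s01 u hu
  have h2 := hA.s11 u hu
  simp only [scal_eq_bil] at h0 h1 h2
  have h3 : bil (A 1 u) (A 0 u) = 0 := by rw [bil_comm, h1]
  simp [h0, h1, h2, h3]

theorem bil_mid_eq_zero_of_mem_line (hA : IsAdaptedFrame ℓ O A) (hu : u ∈ O) {x : Vec ℝ n}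
    (hx : x ∈ ℓ u) (i : Fin (n - 2)) : bil x (A (mid i) u) = 0 := by
  rw [hA.span_eq u hu] at hx
  obtain ⟨a, b, rfl⟩ := Submodule.mem_span_pair.1 hx
  have h0 := hA.s0i u hu i
  have h1 := hA.s1i u hu i
  simp only [scal_eq_bil] at h0 h1
  simp [h0, h1]

theorem frame_zero_mem (hA : IsAdaptedFrame ℓ O A) (hu : u ∈ O) : A 0 u ∈ ℓ u := by
  rw [hA.span_eq u hu]
  exact Submodule.subset_span (by simp)

theorem frame_one_mem (hA : IsAdaptedFrame ℓ O A) (hu : u ∈ O) : A 1 u ∈ ℓ u := by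
  rw [hA.span_eq u hu]
  exact Submodule.subset_span (by simp)

/-- Up to a nonzero factor, the form `ω_0^n` does not depend on the frame. -/
theorem conn_idxN_change (hn : 2 ≤ n) (hA : IsAdaptedFrame ℓ O A) (hu : u ∈ O)
    (hA' : IsAdaptedFrame ℓ O' A') (hu' : u ∈ O') {a b c d : ℝ}
    (e1 : A' 1 u = c • A 0 u + d • A 1 u)
    (hd0 : ∀ w, fderiv ℝ (A' 0) u w - (a • fderiv ℝ (A 0) u w + b • fderiv ℝ (A 1) u w) ∈ ℓ u)
    (w : Param n) :
    conn A' u w 0 (idxN n) = (a * d - b * c) * conn A u w 0 (idxN n) := by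
  have h := bil_fderiv_one hn hA' hu' w 0
  have h1 := bil_eq_zero_of_mem_line hA hu (hd0 w) (frame_one_mem hA' hu')
  rw [map_sub, LinearMap.sub_apply, h, sub_eq_zero, e1] at h1
  simp only [map_add, map_smul, LinearMap.add_apply, LinearMap.smul_apply, smul_eq_mul,
    bil_fderiv_zero hn hA hu, bil_fderiv_one hn hA hu, conn_zero_last hn hA hu,
    conn_one_idxN hn hA hu, conn_one_last hn hA hu] at h1
  linarith

theorem exists_conn_idxN_eq_mul (hn : 2 ≤ n) (hA : IsAdaptedFrame ℓ O A) (hu : u ∈ O)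
    (hA' : IsAdaptedFrame ℓ O' A') (hu' : u ∈ O') :
    ∃ r : ℝ, r ≠ 0 ∧ ∀ w, conn A' u w 0 (idxN n) = r * conn A u w 0 (idxN n) := by
  obtain ⟨a, b, c, d, hdet, -, e1, hd0, -⟩ := exists_frame_change hn hA hu hA' hu'
  exact ⟨_, hdet, conn_idxN_change hn hA hu hA' hu' e1 hd0⟩

/-- The differentials of `A_0`, `A_1` along `ω_0^n = 0`, paired with vectors orthogonal to the
line. -/
theorem bil_fderiv_of_orthogonal (hn : 2 ≤ n) (hA : IsAdaptedFrame ℓ O A) (hu : u ∈ O)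
    {w : Param n} (hw : conn A u w 0 (idxN n) = 0) {z : Vec ℝ n} (h0 : bil (A 0 u) z = 0)
    (h1 : bil (A 1 u) z = 0) :
    bil (fderiv ℝ (A 0) u w) z = ∑ i, conn A u w 0 (mid i) * bil (A (mid i) u) z ∧
    bil (fderiv ℝ (A 1) u w) z = ∑ i, conn A u w 1 (mid i) * bil (A (mid i) u) z := by
  constructor
  · rw [fderiv_frame hn hA hu, sum_frame hn]
    simp [h0, h1, hw, conn_zero_last hn hA hu]
  · rw [fderiv_frame hn hA hu, sum_frame hn]
    simp [h0, h1, hw, conn_one_last hn hA hu, conn_one_idxN hn hA hu]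

/-- The transformation of the affinor under a change of the frame. -/
theorem affinor_change (hn : 2 ≤ n) (hA : IsAdaptedFrame ℓ O A) (hu : u ∈ O)
    (hB : BasisForms A u) (hA' : IsAdaptedFrame ℓ O' A') (hu' : u ∈ O') (hB' : BasisForms A' u)
    {Λ Λ' : Matrix (Fin (n - 2)) (Fin (n - 2)) ℝ} {μ μ' : Fin (n - 2) → ℝ}
    (hΛ : IsAffinor A u Λ μ) (hΛ' : IsAffinor A' u Λ' μ') {a b c d : ℝ}
    (e1 : A' 1 u = c • A 0 u + d • A 1 u)
    (hd0 : ∀ w, fderiv ℝ (A' 0) u w - (a • fderiv ℝ (A 0) u w + b • fderiv ℝ (A 1) u w) ∈ ℓ u)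
    (hd1 : ∀ w, fderiv ℝ (A' 1) u w - (c • fderiv ℝ (A 0) u w + d • fderiv ℝ (A 1) u w) ∈ ℓ u) :
    ∃ C : Matrix (Fin (n - 2)) (Fin (n - 2)) ℝ, (C * (a • 1 + b • Λ)).det ≠ 0 ∧
      Λ' * (C * (a • 1 + b • Λ)) = C * (c • 1 + d • Λ) := by
  -- G solves for the middle components in the second frame, and H converts middle components of the
  -- first frame into scalar products with the second.
  let G := (gMat A' u)ᵀ
  let H : Matrix (Fin (n - 2)) (Fin (n - 2)) ℝ :=
    Matrix.of fun j i => bil (A (mid i) u) (A' (mid j) u)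
  have hG : IsUnit G.det := by
    rw [Matrix.det_transpose]
    exact (hA'.sij u hu').det_pos.ne'.isUnit
  have haff : ∀ w, conn A u w 0 (idxN n) = 0 →
      (fun i => conn A u w 1 (mid i)) = Λ *ᵥ fun i => conn A u w 0 (mid i) := by
    intro w hw
    funext i
    rw [hΛ w i, hw]
    simp [Matrix.mulVec, dotProduct]
  -- both differentials, paired with the middle vectors of the second frame
  have hrow : ∀ (s t : ℝ) (ξ : Fin (n + 2)),
      (∀ w, fderiv ℝ (A' ξ) u w - (s • fderiv ℝ (A 0) u w + t • fderiv ℝ (A 1) u w) ∈ ℓ u) →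
      ∀ w, conn A u w 0 (idxN n) = 0 → (fun i => conn A' u w ξ (mid i)) =
        (G⁻¹ * H * (s • 1 + t • Λ)) *ᵥ fun i => conn A u w 0 (mid i) := by
    intro s t ξ hξ w hw
    have key : G *ᵥ (fun i => conn A' u w ξ (mid i)) =
        (H * (s • 1 + t • Λ)) *ᵥ fun i => conn A u w 0 (mid i) := by
      funext j
      have h := bil_mid_eq_zero_of_mem_line hA' hu' (hξ w) j
      have hz := bil_fderiv_of_orthogonal hn hA hu hw
        (bil_mid_eq_zero_of_mem_line hA' hu' (frame_zero_mem hA hu) j)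
        (bil_mid_eq_zero_of_mem_line hA' hu' (frame_one_mem hA hu) j)
      rw [map_sub, LinearMap.sub_apply, sub_eq_zero, bil_fderiv_mid hn hA' hu'] at h
      simp only [map_add, map_smul, LinearMap.add_apply, LinearMap.smul_apply, hz.1, hz.2] at h
      rw [← Matrix.mulVec_mulVec, Matrix.add_mulVec, Matrix.smul_mulVec, Matrix.smul_mulVec,
        Matrix.one_mulVec, ← haff w hw]
      have hl : (G *ᵥ fun i => conn A' u w ξ (mid i)) j =
          ∑ i, conn A' u w ξ (mid i) * gMat A' u i j := by
        simp [G, Matrix.mulVec, dotProduct, mul_comm]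
      rw [hl, h]
      simp only [H, Matrix.mulVec, dotProduct, Matrix.of_apply, Pi.add_apply, Pi.smul_apply,
        smul_eq_mul, mul_add, Finset.sum_add_distrib, Finset.mul_sum]
      congr 1 <;> exact Finset.sum_congr rfl fun i _ => by ring
    rw [Matrix.mul_assoc, ← Matrix.mulVec_mulVec, ← key, Matrix.mulVec_mulVec,
      Matrix.nonsing_inv_mul _ hG, Matrix.one_mulVec]
  have h0 := hrow a b 0 hd0
  have h1 := hrow c d 1 hd1
  -- Basis forms let the middle forms take arbitrary values on the kernel of ω_0^n, so relations
  -- between vectors become relations between matrices.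
  have hsurj : ∀ σ : Fin (n - 2) → ℝ, ∃ w, conn A u w 0 (idxN n) = 0 ∧
      (fun i => conn A u w 0 (mid i)) = σ := by
    intro σ
    obtain ⟨w, hw⟩ := (bijective_basisMap hn hB).2 (σ, 0)
    exact ⟨w, congrArg Prod.snd hw, congrArg Prod.fst hw⟩
  have hθ := conn_idxN_change hn hA hu hA' hu' e1 hd0
  refine ⟨G⁻¹ * H, ?_, ?_⟩
  · intro hdet
    -- A kernel vector of C(a + bΛ) would come from a w annihilated by all basis forms of the second
    -- frame.
    obtain ⟨σ, hσ, hσ0⟩ := Matrix.exists_mulVec_eq_zero_iff.2 hdet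
    obtain ⟨w, hw, rfl⟩ := hsurj σ
    rw [← h0 w hw] at hσ0
    have hw0 := hB' w (fun i => congrFun hσ0 i) (by rw [hθ, hw, mul_zero])
    subst hw0
    refine hσ (funext fun i => ?_)
    simp [conn, Matrix.mul_apply]
  · refine Matrix.ext_of_mulVec_single fun j => ?_
    obtain ⟨w, hw, hσ⟩ := hsurj (Pi.single j 1)
    rw [← hσ, ← Matrix.mulVec_mulVec, ← h0 w hw, ← h1 w hw]
    funext i
    rw [hΛ' w i, hθ, hw]
    simp [Matrix.mulVec, dotProduct]

/-- The substitution on the roots is exactly the change of coordinate on the line: A'_1 + r'A'_0 is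
(ad - bc)/(a - br) times A_1 + rA_0. Equality of multisets carries the multiplicities. -/
theorem isRootDivisor_change (hn : 2 ≤ n) (hA : IsAdaptedFrame ℓ O A) (hu : u ∈ O)
    (hB : BasisForms A u) (hA' : IsAdaptedFrame ℓ O' A') (hu' : u ∈ O') (hB' : BasisForms A' u)
    {Λ Λ' : Matrix (Fin (n - 2)) (Fin (n - 2)) ℝ} {μ μ' : Fin (n - 2) → ℝ}
    (hΛ : IsAffinor A u Λ μ) (hΛ' : IsAffinor A' u Λ' μ') {D : Multiset (ℙ ℂ (Vec ℂ n))}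
    (hD : IsRootDivisor A u Λ D) : IsRootDivisor A' u Λ' D := by
  obtain ⟨a, b, c, d, hdet, e0, e1, hd0, hd1⟩ := exists_frame_change hn hA hu hA' hu'
  obtain ⟨C, hC, hCΛ⟩ := affinor_change hn hA hu hB hA' hu' hB' hΛ hΛ' e1 hd0 hd1
  obtain ⟨hne, hroots⟩ := roots_singularPoly_of_change hC hCΛ
  rw [IsRootDivisor, hD, hroots, Multiset.map_map]
  refine Multiset.map_congr rfl fun r hr => ?_
  have hr' := hne r hr
  have hdetC : (a * d - b * c : ℂ) ≠ 0 := by exact_mod_cast hdet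
  have hpt : pointOn A' u (-(c - d * r) / (a - b * r)) =
      ((a * d - b * c : ℂ) / (a - b * r)) • pointOn A u r := by
    funext ξ
    simp only [pointOn, e0, e1, Pi.add_apply, Pi.smul_apply, smul_eq_mul]
    push_cast
    obtain ⟨δ, hδ⟩ : ∃ δ : ℂ, δ = a - b * r := ⟨_, rfl⟩
    rw [← hδ] at hr' ⊢
    field_simp
    rw [hδ]
    ring
  simp only [Function.comp_apply]
  rw [hpt]
  exact (Submodule.span_singleton_smul_eq (div_ne_zero hdetC hr').isUnit _).symm

end Change

/-! ### The Darboux mapping and conformal charts -/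

section Darboux

variable {K : Type*} [Field K] {n : ℕ}

/-- The Minkowski coordinates `X^1, …, X^n` of a vector. -/
def inner {R : Type*} (X : Vec R n) (r : Fin n) : R := X r.castSucc.succ

@[simp] theorem darboux_zero (x : Fin n → K) : darboux x 0 = (1 - mink x x) / 2 := rfl

@[simp] theorem darboux_last (x : Fin n → K) :
    darboux x (Fin.last (n + 1)) = (1 + mink x x) / 2 := by
  rw [← Fin.succ_last, darboux, Fin.cons_succ, Fin.snoc_last]

@[simp] theorem darboux_succ (x : Fin n → K) (r : Fin n) : darboux x r.castSucc.succ = x r := by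
  rw [darboux, Fin.cons_succ, Fin.snoc_castSucc]

theorem vec_ext {R : Type*} {X Y : Vec R n} (h0 : X 0 = Y 0) (hr : ∀ r, inner X r = inner Y r)
    (hl : X (Fin.last (n + 1)) = Y (Fin.last (n + 1))) : X = Y := by
  funext ξ
  refine Fin.cases h0 (fun η => ?_) ξ
  refine Fin.lastCases ?_ (fun r => hr r) η
  rw [Fin.succ_last]
  exact hl

theorem bil_eq_mink (hn : 1 ≤ n) (X Y : Vec K n) :
    bil X Y = X 0 * Y 0 + mink (inner X) (inner Y) -
      X (Fin.last (n + 1)) * Y (Fin.last (n + 1)) := by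
  rw [bil_apply, Fin.sum_univ_succ, Fin.sum_univ_castSucc, mink, Fin.succ_last]
  have h0 : ((0 : Fin (n + 2)) : ℕ) < n := by simp; omega
  have h4 : ¬ ((Fin.last (n + 1) : Fin (n + 2)) : ℕ) < n := by simp
  simp only [h0, h4, if_true, if_false, inner, Fin.val_succ, Fin.val_castSucc]
  ring

theorem mink_add_left (x y z : Fin n → K) : mink (x + y) z = mink x z + mink y z := by
  simp only [mink, Pi.add_apply, add_mul, mul_add, Finset.sum_add_distrib]

theorem mink_smul_left (c : K) (x z : Fin n → K) : mink (c • x) z = c * mink x z := by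
  simp only [mink, Pi.smul_apply, smul_eq_mul, Finset.mul_sum]
  exact Finset.sum_congr rfl fun _ _ => by ring

theorem mink_comm (x y : Fin n → K) : mink x y = mink y x := by
  simp only [mink, mul_comm (x _)]

theorem darboux_zero_add_last [CharZero K] (x : Fin n → K) :
    darboux x 0 + darboux x (Fin.last (n + 1)) = 1 := by
  rw [darboux_zero, darboux_last]
  ring

/-- Isotropy reads (Z^0 - Z^{n+1})(Z^0 + Z^{n+1}) + g = 0 in the coordinates; with the sum
normalized to 1 the difference is determined by g. -/
theorem eq_darboux [CharZero K] (hn : 1 ≤ n) {Z : Vec K n} (hZ : bil Z Z = 0)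
    (h1 : Z 0 + Z (Fin.last (n + 1)) = 1) : Z = darboux (inner Z) := by
  rw [bil_eq_mink hn] at hZ
  have hl : Z (Fin.last (n + 1)) = 1 - Z 0 := by rw [← h1]; ring
  rw [hl] at hZ
  have hm : mink (inner Z) (inner Z) = 1 - 2 * Z 0 := by linear_combination hZ
  refine vec_ext ?_ (fun r => (darboux_succ _ r).symm) ?_
  · rw [darboux_zero, hm]; ring
  · rw [darboux_last, hm, hl]; ring

/-- The differential of the Darboux mapping at `x`. -/
def dDarboux (x : Fin n → K) : (Fin n → K) →ₗ[K] Vec K n where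
  toFun z := Fin.cons (-mink x z) (Fin.snoc (α := fun _ => K) z (mink x z))
  map_add' y z := by
    refine vec_ext ?_ (fun r => ?_) ?_
    · simp [mink_comm x, mink_add_left, add_comm]
    · simp [inner]
    · simp only [← Fin.succ_last, Pi.add_apply, Fin.cons_succ, Fin.snoc_last, mink_comm x,
        mink_add_left]
  map_smul' c z := by
    refine vec_ext ?_ (fun r => ?_) ?_
    · simp [mink_comm x, mink_smul_left]
    · simp [inner]
    · simp only [← Fin.succ_last, Pi.smul_apply, Fin.cons_succ, Fin.snoc_last, mink_comm x,
        mink_smul_left, smul_eq_mul, RingHom.id_apply]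

theorem dDarboux_zero (x z : Fin n → K) : dDarboux x z 0 = -mink x z := rfl

theorem dDarboux_last (x z : Fin n → K) : dDarboux x z (Fin.last (n + 1)) = mink x z := by
  rw [← Fin.succ_last]
  simp only [dDarboux, LinearMap.coe_mk, AddHom.coe_mk, Fin.cons_succ, Fin.snoc_last]

theorem inner_dDarboux (x z : Fin n → K) : inner (dDarboux x z) = z := by
  funext r
  simp only [inner, dDarboux, LinearMap.coe_mk, AddHom.coe_mk, Fin.cons_succ, Fin.snoc_castSucc]

/-- The extreme components ∓g(x, z) have equal squares and cancel: the chart is isometric, so causal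
character may be computed in the quadric. -/
theorem bil_dDarboux (hn : 1 ≤ n) (x z : Fin n → K) :
    bil (dDarboux x z) (dDarboux x z) = mink z z := by
  rw [bil_eq_mink hn, dDarboux_zero, dDarboux_last, inner_dDarboux]
  ring

end Darboux

/-! ### Conformal transformations and the inverse of a chart. -/

section Conformal

variable {K : Type*} [RCLike K] {n : ℕ} {T : Matrix (Fin (n + 2)) (Fin (n + 2)) ℝ}

theorem isUnit_det_of_isConformal (hT : IsConformal T) : IsUnit T.det := by
  rw [isUnit_iff_ne_zero]
  intro h
  obtain ⟨x, hx, hx0⟩ := Matrix.exists_mulVec_eq_zero_iff.2 h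
  refine hx (eq_zero_of_bil_eq_zero fun y => ?_)
  have := hT x y
  rw [hx0] at this
  rw [← scal_eq_bil, ← this, scal_eq_bil]
  simp

/-- Invariance is given for real vectors; the standard basis is real, so bilinearity extends it to
K. -/
theorem bil_mulVec (hT : IsConformal T) (x y : Vec K n) :
    bil (T.map (algebraMap ℝ K) *ᵥ x) (T.map (algebraMap ℝ K) *ᵥ y) = bil x y := by
  let L := Matrix.mulVecLin (T.map (algebraMap ℝ K))
  have h : (bil (R := K)).compl₁₂ L L = bil := by
    refine LinearMap.ext_basis (Pi.basisFun K _) (Pi.basisFun K _) fun i j => ?_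
    have hemb : ∀ i, (Pi.basisFun K (Fin (n + 2))) i = emb K (Pi.single i 1) := fun i => by
      funext ξ
      rw [Pi.basisFun_apply, emb_apply]
      by_cases h : ξ = i
      · subst h; simp
      · simp [h]
    have hL : ∀ x : Vec ℝ n, L (emb K x) = emb K (T *ᵥ x) := fun x => by
      funext ξ
      simp only [L, Matrix.mulVecLin_apply, Matrix.mulVec, dotProduct, emb_apply, map_sum, map_mul,
        Matrix.map_apply]
    rw [LinearMap.compl₁₂_apply, hemb, hemb, hL, hL, bil_emb, bil_emb, ← scal_eq_bil, hT]
    rfl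
  exact congrArg (fun B : Vec K n →ₗ[K] Vec K n →ₗ[K] K => B x y) h

/-- The differential of a conformal chart. -/
def dChart (T : Matrix (Fin (n + 2)) (Fin (n + 2)) ℝ) (x : Fin n → K) :
    (Fin n → K) →ₗ[K] Vec K n :=
  (Matrix.mulVecLin (T.map (algebraMap ℝ K))).comp (dDarboux x)

theorem dChart_apply (x z : Fin n → K) :
    dChart T x z = T.map (algebraMap ℝ K) *ᵥ dDarboux x z := rfl

theorem bil_dChart (hn : 1 ≤ n) (hT : IsConformal T) (x z : Fin n → K) :
    bil (dChart T x z) (dChart T x z) = mink z z := by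
  rw [dChart_apply, bil_mulVec hT, bil_dDarboux hn]

/-- The coordinates read after the inverse of a conformal transformation. -/
def pullBack (T : Matrix (Fin (n + 2)) (Fin (n + 2)) ℝ) : Vec K n →ₗ[K] Vec K n :=
  Matrix.mulVecLin (T⁻¹.map (algebraMap ℝ K))

theorem pullBack_mulVec (hT : IsConformal T) (X : Vec K n) :
    pullBack T (T.map (algebraMap ℝ K) *ᵥ X) = X := by
  rw [pullBack, Matrix.mulVecLin_apply, Matrix.mulVec_mulVec, ← Matrix.map_mul,
    Matrix.nonsing_inv_mul _ (isUnit_det_of_isConformal hT),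
    Matrix.map_one _ (map_zero _) (map_one _), Matrix.one_mulVec]

theorem mulVec_pullBack (hT : IsConformal T) (X : Vec K n) :
    T.map (algebraMap ℝ K) *ᵥ pullBack T X = X := by
  rw [pullBack, Matrix.mulVecLin_apply, Matrix.mulVec_mulVec, ← Matrix.map_mul,
    Matrix.mul_nonsing_inv _ (isUnit_det_of_isConformal hT),
    Matrix.map_one _ (map_zero _) (map_one _), Matrix.one_mulVec]

/-- The linear functional normalized to `1` on the image of the chart. -/
def level (T : Matrix (Fin (n + 2)) (Fin (n + 2)) ℝ) : Vec K n →ₗ[K] K :=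
  LinearMap.comp (LinearMap.proj (R := K) (φ := fun _ : Fin (n + 2) => K) 0 +
    LinearMap.proj (Fin.last (n + 1))) (pullBack T)

theorem level_apply (X : Vec K n) :
    level T X = pullBack T X 0 + pullBack T X (Fin.last (n + 1)) := rfl

theorem level_chart (hT : IsConformal T) (x : Fin n → K) : level T (chart T x) = 1 := by
  rw [level_apply, chart, pullBack_mulVec hT, darboux_zero_add_last]

theorem level_dChart (hT : IsConformal T) (x z : Fin n → K) : level T (dChart T x z) = 0 := by
  rw [level_apply, dChart_apply, pullBack_mulVec hT, dDarboux_zero, dDarboux_last]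
  ring

theorem inner_pullBack_chart (hT : IsConformal T) (x : Fin n → K) :
    inner (pullBack T (chart T x)) = x := by
  rw [chart, pullBack_mulVec hT]
  funext r
  exact darboux_succ x r

theorem dChart_injective (hT : IsConformal T) (x : Fin n → K) :
    Function.Injective (dChart T x) := by
  intro y z h
  have := congrArg (fun X => inner (pullBack T X)) h
  simpa only [dChart_apply, pullBack_mulVec hT, inner_dDarboux] using this

/-- After division by its level an isotropic vector satisfies the normalization that characterizes
Darboux images; every point off the hyperplane of level zero is thus in the chart. -/
theorem chart_inner_pullBack (hn : 1 ≤ n) (hT : IsConformal T) {X : Vec K n} (hX : bil X X = 0)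
    (hl : level T X ≠ 0) : chart T ((level T X)⁻¹ • inner (pullBack T X)) =
      (level T X)⁻¹ • X := by
  set c := (level T X)⁻¹ with hc
  have hZ : bil (pullBack T (c • X)) (pullBack T (c • X)) = 0 := by
    rw [← bil_mulVec hT, mulVec_pullBack hT]
    simp [hX]
  have h1 : pullBack T (c • X) 0 + pullBack T (c • X) (Fin.last (n + 1)) = 1 := by
    rw [← level_apply, map_smul, smul_eq_mul, hc, inv_mul_cancel₀ hl]
  have h2 := eq_darboux hn hZ h1
  have h3 : c • inner (pullBack T X) = inner (pullBack T (c • X)) := by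
    funext r
    simp [inner]
  rw [h3, chart, ← h2, mulVec_pullBack hT]

end Conformal

/-! ### Tangent subspaces in the quadric and in a chart. -/

section ChartTangent

variable {K : Type*} [RCLike K] {n : ℕ} {T : Matrix (Fin (n + 2)) (Fin (n + 2)) ℝ}
  {F : Type*} [NormedAddCommGroup F] [NormedSpace ℝ F]

theorem contDiffAt_mink {k : WithTop ℕ∞} {f g : F → Fin n → K} {u : F} (hf : ContDiffAt ℝ k f u)
    (hg : ContDiffAt ℝ k g u) : ContDiffAt ℝ k (fun v => mink (f v) (g v)) u := by
  simp only [mink]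
  exact ContDiffAt.sum fun ξ _ => contDiffAt_const.mul
    ((contDiffAt_pi.1 hf ξ).mul (contDiffAt_pi.1 hg ξ))

theorem contDiffAt_mulVec {k : WithTop ℕ∞} {f : F → Vec K n} {u : F}
    (M : Matrix (Fin (n + 2)) (Fin (n + 2)) K) (hf : ContDiffAt ℝ k f u) :
    ContDiffAt ℝ k (fun v => M *ᵥ f v) u := by
  refine contDiffAt_pi.2 fun ξ => ?_
  simp only [Matrix.mulVec, dotProduct]
  exact ContDiffAt.sum fun η _ => contDiffAt_const.mul (contDiffAt_pi.1 hf η)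

theorem contDiffAt_darboux {k : WithTop ℕ∞} {y : F → Fin n → K} {u : F}
    (hy : ContDiffAt ℝ k y u) : ContDiffAt ℝ k (fun v => darboux (y v)) u := by
  refine contDiffAt_pi.2 fun ξ => ?_
  refine Fin.cases ?_ (fun η => ?_) ξ
  · simp only [darboux_zero]
    exact (contDiffAt_const.sub (contDiffAt_mink hy hy)).div_const _
  · refine Fin.lastCases ?_ (fun r => ?_) η
    · simp only [Fin.succ_last, darboux_last]
      exact (contDiffAt_const.add (contDiffAt_mink hy hy)).div_const _
    · simp only [darboux_succ]
      exact contDiffAt_pi.1 hy r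

theorem hasFDerivAt_mink {y : F → Fin n → K} {u : F} (hy : DifferentiableAt ℝ y u) :
    ∃ L : F →L[ℝ] K, HasFDerivAt (fun v => mink (y v) (y v)) L u ∧
      ∀ w, L w = 2 * mink (y u) (fderiv ℝ y u w) := by
  have hr : ∀ r, HasFDerivAt (fun v => y v r) ((ContinuousLinearMap.proj r).comp (fderiv ℝ y u)) u :=
    fun r => (hasFDerivAt_pi'.1 hy.hasFDerivAt) r
  have h : HasFDerivAt (fun v => mink (y v) (y v)) _ u :=
    HasFDerivAt.fun_sum (u := Finset.univ) fun r _ =>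
      ((hr r).mul (hr r)).const_mul (if (r : ℕ) + 1 < n then (1 : K) else -1)
  refine ⟨_, h, fun w => ?_⟩
  rw [_root_.sum_apply, mink, Finset.mul_sum]
  refine Finset.sum_congr rfl fun r _ => ?_
  simp only [_root_.smul_apply, _root_.add_apply, ContinuousLinearMap.comp_apply,
    ContinuousLinearMap.proj_apply, smul_eq_mul]
  ring

theorem fderiv_darboux {y : F → Fin n → K} {u : F} (hy : ContDiffAt ℝ ∞ y u) (w : F) :
    fderiv ℝ (fun v => darboux (y v)) u w = dDarboux (y u) (fderiv ℝ y u w) := by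
  have hyd := hy.differentiableAt (by simp)
  have hd := (contDiffAt_darboux hy).differentiableAt (by simp)
  have hcomp : ∀ ξ, fderiv ℝ (fun v => darboux (y v)) u w ξ =
      fderiv ℝ (fun v => darboux (y v) ξ) u w := fun ξ => by
    have := ((hasFDerivAt_pi'.1 hd.hasFDerivAt) ξ).fderiv
    rw [this]
    rfl
  obtain ⟨L, hL, hLw⟩ := hasFDerivAt_mink hyd
  refine vec_ext ?_ (fun r => ?_) ?_
  · rw [hcomp, dDarboux_zero]
    simp only [darboux_zero, div_eq_mul_inv]
    have h1 : HasFDerivAt (fun v => (1 - mink (y v) (y v)) * 2⁻¹) _ u :=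
      (hL.const_sub 1).mul_const (2⁻¹ : K)
    rw [h1.fderiv]
    simp [hLw]
  · rw [inner_dDarboux, inner, hcomp]
    simp only [darboux_succ]
    have := ((hasFDerivAt_pi'.1 hyd.hasFDerivAt) r).fderiv
    rw [this]
    rfl
  · rw [hcomp, dDarboux_last]
    simp only [darboux_last, div_eq_mul_inv]
    have h1 : HasFDerivAt (fun v => (1 + mink (y v) (y v)) * 2⁻¹) _ u :=
      (hL.const_add 1).mul_const (2⁻¹ : K)
    rw [h1.fderiv]
    simp [hLw]

theorem contDiffAt_chart {k : WithTop ℕ∞} {y : F → Fin n → K} {u : F}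
    (hy : ContDiffAt ℝ k y u) : ContDiffAt ℝ k (fun v => chart T (y v)) u :=
  contDiffAt_mulVec _ (contDiffAt_darboux hy)

theorem fderiv_chart {y : F → Fin n → K} {u : F} (hy : ContDiffAt ℝ ∞ y u) (w : F) :
    fderiv ℝ (fun v => chart T (y v)) u w = dChart T (y u) (fderiv ℝ y u w) := by
  let L : Vec K n →L[ℝ] Vec K n :=
    ((Matrix.mulVecLin (T.map (algebraMap ℝ K))).restrictScalars ℝ).toContinuousLinearMap
  have hd := (contDiffAt_darboux hy).differentiableAt (by simp)
  have h : HasFDerivAt (fun v => chart T (y v)) _ u := L.hasFDerivAt.comp u hd.hasFDerivAt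
  rw [h.fderiv, dChart_apply, ← fderiv_darboux hy]
  rfl

theorem ruledTangent_smul_le {ℓ : F → Submodule ℝ (Vec ℝ n)} {u : F} {c : K} (hc : c ≠ 0)
    (X : Vec K n) : ruledTangent K ℓ u X ≤ ruledTangent K ℓ u (c • X) := by
  refine Submodule.span_le.2 ?_
  rintro _ ⟨Y, w, hY, hmem, hYu, rfl⟩
  have h : c • fderiv ℝ Y u w ∈ ruledTangent K ℓ u (c • X) := by
    refine Submodule.subset_span ⟨fun v => c • Y v, w, hY.const_smul c, ?_, by simp only [hYu], ?_⟩
    · filter_upwards [hmem] with v hv using Submodule.smul_mem _ _ hv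
    · have := (hY.differentiableAt (by simp)).hasFDerivAt.const_smul c
      have h' : HasFDerivAt (fun v => c • Y v) _ u := this
      rw [h'.fderiv]
      rfl
  have h2 := Submodule.smul_mem _ c⁻¹ h
  rwa [smul_smul, inv_mul_cancel₀ hc, one_smul] at h2

theorem ruledTangent_smul {ℓ : F → Submodule ℝ (Vec ℝ n)} {u : F} {c : K} (hc : c ≠ 0)
    (X : Vec K n) : ruledTangent K ℓ u (c • X) = ruledTangent K ℓ u X := by
  refine le_antisymm ?_ (ruledTangent_smul_le hc X)
  have := ruledTangent_smul_le (ℓ := ℓ) (u := u) (inv_ne_zero hc) (c • X)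
  rwa [smul_smul, inv_mul_cancel₀ hc, one_smul] at this

/-- The tangent subspace in the projective space, in terms of that in a conformal chart. -/
theorem ruledTangent_chart (hn : 1 ≤ n) (hT : IsConformal T) {ℓ : F → Submodule ℝ (Vec ℝ n)}
    {u : F} (hiso : ∀ᶠ v in 𝓝 u, ∀ x ∈ ℓ v, ∀ y ∈ ℓ v, scal x y = 0) {x : Fin n → K}
    (hX : chart T x ∈ ruledTangent K ℓ u (chart T x)) :
    ruledTangent K ℓ u (chart T x) = Submodule.span K {chart T x} ⊔
      (chartTangent K ℓ T u x).map (dChart T x) := by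
  apply le_antisymm
  · refine Submodule.span_le.2 ?_
    rintro _ ⟨Y, w, hY, hmem, hYu, rfl⟩
    have hZ : ContDiffAt ℝ ∞ (fun v => pullBack T (Y v)) u := contDiffAt_mulVec _ hY
    have he : ContDiffAt ℝ ∞ (fun v => level T (Y v)) u :=
      (contDiffAt_pi.1 hZ 0).add (contDiffAt_pi.1 hZ _)
    have heu : level T (Y u) = 1 := by rw [hYu, level_chart hT]
    have hne : ∀ᶠ v in 𝓝 u, level T (Y v) ≠ 0 :=
      he.continuousAt.eventually_ne (by rw [heu]; exact one_ne_zero)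
    -- The chart coordinates of the moving point Y; near u the level is nonzero since it is 1 at u.
    let y : F → Fin n → K := fun v => (level T (Y v))⁻¹ • inner (pullBack T (Y v))
    have hy : ContDiffAt ℝ ∞ y u :=
      (he.inv (by rw [heu]; exact one_ne_zero)).smul
        (contDiffAt_pi.2 fun r => contDiffAt_pi.1 hZ _)
    have hchart : ∀ᶠ v in 𝓝 u, chart T (y v) = (level T (Y v))⁻¹ • Y v := by
      filter_upwards [hne, hmem, hiso] with v h1 h2 h3
      exact chart_inner_pullBack hn hT (bil_eq_zero_of_mem_extend h3 h2 h2) h1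
    have hyu : y u = x := by
      simp only [y, hYu, inner_pullBack_chart hT, level_chart hT, inv_one, one_smul]
    have heq : Y =ᶠ[𝓝 u] fun v => level T (Y v) • chart T (y v) := by
      filter_upwards [hchart, hne] with v h1 h2
      rw [h1, smul_smul, mul_inv_cancel₀ h2, one_smul]
    have hder : HasFDerivAt (fun v => level T (Y v) • chart T (y v)) _ u :=
      (he.differentiableAt (by simp)).hasFDerivAt.smul
        ((contDiffAt_chart (T := T) hy).differentiableAt (by simp)).hasFDerivAt
    rw [heq.fderiv_eq, hder.fderiv]
    simp only [_root_.add_apply, ContinuousLinearMap.smulRight_apply, heu,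
      one_smul, fderiv_chart hy, hyu]
    refine Submodule.add_mem _ (Submodule.mem_sup_right (Submodule.mem_map_of_mem ?_))
      (Submodule.mem_sup_left (Submodule.mem_span_singleton.2 ⟨_, rfl⟩))
    refine Submodule.subset_span ⟨y, w, hy, ?_, hyu, rfl⟩
    filter_upwards [hchart, hmem] with v h1 h2
    rw [h1]
    exact Submodule.smul_mem _ _ h2
  · refine sup_le ?_ ?_
    · rwa [Submodule.span_singleton_le_iff_mem]
    · rw [Submodule.map_le_iff_le_comap]
      refine Submodule.span_le.2 ?_
      rintro _ ⟨y, w, hy, hmem, hyu, rfl⟩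
      refine Submodule.subset_span ⟨fun v => chart T (y v), w, contDiffAt_chart hy, hmem,
        by simp only [hyu], ?_⟩
      rw [fderiv_chart hy, hyu]

/-- The level is 1 at the point and 0 on the image of the injective differential, so the sum of
`ruledTangent_chart` is direct: the projective and affine dimensions agree. -/
theorem finrank_ruledTangent_chart (hn : 1 ≤ n) (hT : IsConformal T)
    {ℓ : F → Submodule ℝ (Vec ℝ n)} {u : F}
    (hiso : ∀ᶠ v in 𝓝 u, ∀ x ∈ ℓ v, ∀ y ∈ ℓ v, scal x y = 0) {x : Fin n → K}
    (hX : chart T x ∈ ruledTangent K ℓ u (chart T x)) :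
    Module.finrank K (ruledTangent K ℓ u (chart T x)) =
      Module.finrank K (chartTangent K ℓ T u x) + 1 := by
  have hne : chart T x ≠ 0 := fun h => by
    have := level_chart hT x
    rw [h, map_zero] at this
    exact zero_ne_one this
  have hinf : Submodule.span K {chart T x} ⊓ (chartTangent K ℓ T u x).map (dChart T x) = ⊥ := by
    rw [eq_bot_iff]
    rintro X ⟨h1, h2⟩
    obtain ⟨c, rfl⟩ := Submodule.mem_span_singleton.1 h1
    obtain ⟨z, -, hz⟩ := h2
    have := congrArg (level T) hz
    rw [level_dChart hT, map_smul, level_chart hT, smul_eq_mul, mul_one] at this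
    rw [← this]
    simp
  have h := Submodule.finrank_sup_add_finrank_inf_eq (Submodule.span K {chart T x})
    ((chartTangent K ℓ T u x).map (dChart T x))
  rw [hinf, finrank_bot, ← ruledTangent_chart hn hT hiso hX, finrank_span_singleton hne,
    ← LinearEquiv.finrank_eq (Submodule.equivMapOfInjective (dChart T x) (dChart_injective hT x)
      (chartTangent K ℓ T u x))] at h
  omega

end ChartTangent

/-! ### Singular points in conformal charts -/

section Covering

variable {n : ℕ}

/-- The matrix of the linear map `x ↦ (s ξ * x (σ ξ))_ξ`. -/
def signedPerm (σ : Equiv.Perm (Fin (n + 2))) (s : Fin (n + 2) → ℝ) :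
    Matrix (Fin (n + 2)) (Fin (n + 2)) ℝ :=
  Matrix.of fun ξ η => if σ ξ = η then s ξ else 0

theorem signedPerm_map_mulVec {K : Type*} [RCLike K] (σ : Equiv.Perm (Fin (n + 2)))
    (s : Fin (n + 2) → ℝ) (x : Vec K n) (ξ : Fin (n + 2)) :
    ((signedPerm σ s).map (algebraMap ℝ K) *ᵥ x) ξ = algebraMap ℝ K (s ξ) * x (σ ξ) := by
  simp only [Matrix.mulVec, dotProduct, signedPerm, Matrix.map_apply, Matrix.of_apply]
  rw [Finset.sum_eq_single (σ ξ)]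
  · simp
  · intro η _ hη
    simp [Ne.symm hη]
  · simp

theorem isConformal_signedPerm {σ : Equiv.Perm (Fin (n + 2))} {s : Fin (n + 2) → ℝ}
    (hσ : ∀ ξ, ((σ ξ : ℕ) < n ↔ (ξ : ℕ) < n)) (hs : ∀ ξ, s ξ * s ξ = 1) :
    IsConformal (signedPerm σ s) := by
  intro x y
  have h : ∀ (z : Vec ℝ n) ξ, (signedPerm σ s *ᵥ z) ξ = s ξ * z (σ ξ) := fun z ξ => by
    have := signedPerm_map_mulVec (K := ℝ) σ s z ξ
    simpa using this
  rw [scal, scal, ← Equiv.sum_comp σ (fun ξ => (if (ξ : ℕ) < n then (1 : ℝ) else -1) * (x ξ * y ξ))]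
  refine Finset.sum_congr rfl fun ξ _ => ?_
  rw [h, h]
  simp only [hσ ξ]
  linear_combination (if (ξ : ℕ) < n then (1 : ℝ) else -1) * x (σ ξ) * y (σ ξ) * hs ξ

theorem swap_lt_iff {a b : Fin (n + 2)} (h : (a : ℕ) < n ↔ (b : ℕ) < n) (ξ : Fin (n + 2)) :
    ((Equiv.swap a b ξ : ℕ) < n ↔ (ξ : ℕ) < n) := by
  rw [Equiv.swap_apply_def]
  split_ifs with h1 h2
  · rw [h1, h]
  · rw [h2, h]
  · rfl

/-- If X^i ± X^k vanished for all positive indices i and negative indices k, then X = 0. A signed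
permutation respecting the signature carries a nonvanishing combination to the level. -/
theorem exists_isConformal_level_ne_zero (hn : 1 ≤ n) {K : Type*} [RCLike K] {X : Vec K n}
    (hX : X ≠ 0) : ∃ T, IsConformal T ∧ level T X ≠ 0 := by
  obtain ⟨i, k, ε, hi, hk, hε, hne⟩ : ∃ (i k : Fin (n + 2)) (ε : ℝ), (i : ℕ) < n ∧ n ≤ (k : ℕ) ∧
      ε * ε = 1 ∧ X i + algebraMap ℝ K ε * X k ≠ 0 := by
    by_contra! hcon
    have key : ∀ i k : Fin (n + 2), (i : ℕ) < n → n ≤ (k : ℕ) → X i = 0 ∧ X k = 0 := by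
      intro i k hi hk
      have h1 := hcon i k 1 hi hk (by norm_num)
      have h2 := hcon i k (-1) hi hk (by norm_num)
      simp only [map_one, map_neg] at h1 h2
      constructor
      · linear_combination (h1 + h2) / 2
      · linear_combination (h1 - h2) / 2
    refine hX (funext fun ξ => ?_)
    by_cases h : (ξ : ℕ) < n
    · exact (key ξ (Fin.last _) h (by simp)).1
    · exact (key 0 ξ (Nat.lt_of_lt_of_le Nat.zero_lt_one hn) (by omega)).2
  have hl : ¬ ((Fin.last (n + 1) : Fin (n + 2)) : ℕ) < n := by simp
  have h0 : ((0 : Fin (n + 2)) : ℕ) < n := Nat.lt_of_lt_of_le Nat.zero_lt_one hn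
  -- σ sends i to 0 and k to the last index; the sign ε is put at k.
  let σ : Equiv.Perm (Fin (n + 2)) := Equiv.swap 0 i * Equiv.swap (Fin.last (n + 1)) k
  let s : Fin (n + 2) → ℝ := fun ξ => if ξ = k then ε else 1
  have hσ : ∀ ξ, ((σ ξ : ℕ) < n ↔ (ξ : ℕ) < n) := fun ξ => by
    rw [Equiv.Perm.mul_apply, swap_lt_iff (iff_of_true h0 hi), swap_lt_iff (iff_of_false hl (by omega))]
  have hs : ∀ ξ, s ξ * s ξ = 1 := fun ξ => by
    simp only [s]
    split_ifs
    · exact hε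
    · norm_num
  have hik : i ≠ k := fun h => by rw [h] at hi; omega
  have hil : i ≠ Fin.last (n + 1) := fun h => by rw [h] at hi; exact hl hi
  have hl0 : Fin.last (n + 1) ≠ 0 := fun h => by rw [h] at hl; exact hl h0
  have hσi : σ i = 0 := by
    rw [Equiv.Perm.mul_apply, Equiv.swap_apply_of_ne_of_ne hil hik, Equiv.swap_apply_right]
  have hσk : σ k = Fin.last (n + 1) := by
    rw [Equiv.Perm.mul_apply, Equiv.swap_apply_right, Equiv.swap_apply_of_ne_of_ne hl0 hil.symm]
  have hT := isConformal_signedPerm hσ hs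
  refine ⟨_, hT, ?_⟩
  let Z : Vec K n := fun η => algebraMap ℝ K (s (σ.symm η)) * X (σ.symm η)
  have hZ : (signedPerm σ s).map (algebraMap ℝ K) *ᵥ Z = X := by
    funext ξ
    rw [signedPerm_map_mulVec]
    simp only [Z, Equiv.symm_apply_apply]
    rw [← mul_assoc, ← map_mul, hs, map_one, one_mul]
  have hlev : level (signedPerm σ s) X = X i + algebraMap ℝ K ε * X k := by
    rw [level_apply, ← hZ, pullBack_mulVec hT, hZ]
    simp only [Z, ← hσi, ← hσk, Equiv.symm_apply_apply, s, if_neg hik, if_pos, map_one, one_mul]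
  rwa [hlev]

end Covering

/-! ### Singular points of a congruence: existence of frames, charts, the divisor. -/

section Congruence

variable {n : ℕ} {Ω : Set (Param n)} {ℓ : Param n → Submodule ℝ (Vec ℝ n)} {u : Param n}

/-- Real and imaginary parts of a vector of the complexification of L lie in L. -/
theorem mem_of_emb_mem_extend {L : Submodule ℝ (Vec ℝ n)} {x : Vec ℝ n}
    (h : emb ℂ x ∈ extend ℂ L) : x ∈ L := by
  have key : ∀ z ∈ extend ℂ L, (fun ξ => (z ξ).re) ∈ L ∧ (fun ξ => (z ξ).im) ∈ L := by
    intro z hz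
    induction hz using Submodule.span_induction with
    | mem z hz =>
      obtain ⟨y, hy, rfl⟩ := hz
      have h0 : (0 : Vec ℝ n) ∈ L := L.zero_mem
      have him : (fun ξ => (algebraMap ℝ ℂ (y ξ)).im) = 0 := funext fun ξ => Complex.ofReal_im _
      exact ⟨hy, him ▸ h0⟩
    | zero => exact ⟨L.zero_mem, L.zero_mem⟩
    | add x y _ _ hx hy => exact ⟨L.add_mem hx.1 hy.1, L.add_mem hx.2 hy.2⟩
    | smul c x _ hx =>
      refine ⟨?_, ?_⟩
      · convert L.sub_mem (L.smul_mem c.re hx.1) (L.smul_mem c.im hx.2) using 1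
        funext ξ
        simp
      · convert L.add_mem (L.smul_mem c.re hx.2) (L.smul_mem c.im hx.1) using 1
        funext ξ
        simp
  exact (key _ h).1

theorem exists_rep_smul {V : Type*} [AddCommGroup V] [Module ℂ V] {P : ℙ ℂ V} {X : V}
    (hX0 : X ≠ 0) (hX : X ∈ P.submodule) : ∃ c : ℂ, c ≠ 0 ∧ P.rep = c • X := by
  rw [Projectivization.submodule_eq, Submodule.mem_span_singleton] at hX
  obtain ⟨c, rfl⟩ := hX
  have hc : c ≠ 0 := fun h => hX0 (by rw [h, zero_smul])
  exact ⟨c⁻¹, inv_ne_zero hc, by rw [smul_smul, inv_mul_cancel₀ hc, one_smul]⟩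

/-- The real nonsingular point provided by the definition of a congruence is taken as A_0. -/
theorem exists_adaptedFrame_basisForms (hn : 2 ≤ n) (hΩ : IsCongruence Ω ℓ) (hu : u ∈ Ω) :
    ∃ O ⊆ Ω, u ∈ O ∧ ∃ A, IsAdaptedFrame ℓ O A ∧ BasisForms A u := by
  obtain ⟨P, ⟨x, hx0, hx⟩, hPle, hP⟩ := hΩ.regular u hu
  have hx' : emb ℂ x ∈ P.submodule := hx
  obtain ⟨O, hO, huO, A, hA, hA0⟩ :=
    exists_adaptedFrame hn hΩ hu (mem_of_emb_mem_extend (hPle hx')) hx0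
  have hne : emb ℂ x ≠ 0 := fun h => hx0 (emb_injective (h.trans (map_zero _).symm))
  obtain ⟨c, hc, hrep⟩ := exists_rep_smul hne hx'
  refine ⟨O, hO, huO, A, hA, basisForms_of_finrank (K := ℂ) hn hA huO hc ?_⟩
  rw [hA0, ← hrep]
  exact fun h => hP ⟨hPle, h⟩

theorem mem_ruledTangent_self {K : Type*} [RCLike K] (hn : 2 ≤ n) {O : Set (Param n)}
    {A : Fin (n + 2) → Param n → Vec ℝ n} (hA : IsAdaptedFrame ℓ O A) (hu : u ∈ O) {X : Vec K n}
    (hX : X ∈ extend K (ℓ u)) : X ∈ ruledTangent K ℓ u X := by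
  rw [hA.span_eq u hu, extend_span_pair, Submodule.mem_span_pair] at hX
  obtain ⟨p, q, rfl⟩ := hX
  rw [ruledTangent_frame hn hA hu]
  exact Submodule.add_mem _ (Submodule.smul_mem _ _ (Submodule.subset_span (Or.inl (Or.inl rfl))))
    (Submodule.smul_mem _ _ (Submodule.subset_span (Or.inl (Or.inr rfl))))

theorem IsCongruence.eventually_isotropic (hΩ : IsCongruence Ω ℓ) (hu : u ∈ Ω) :
    ∀ᶠ v in 𝓝 u, ∀ x ∈ ℓ v, ∀ y ∈ ℓ v, scal x y = 0 := by
  filter_upwards [hΩ.isOpen.mem_nhds hu] with v hv using hΩ.isotropic v hv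

theorem isSingularPoint_iff_isSingularInChart (hn : 2 ≤ n) (hΩ : IsCongruence Ω ℓ) (hu : u ∈ Ω)
    {T : Matrix (Fin (n + 2)) (Fin (n + 2)) ℝ} (hT : IsConformal T) {x : Fin n → ℂ}
    {P : ℙ ℂ (Vec ℂ n)} (hP : P.submodule = Submodule.span ℂ {chart T x}) :
    IsSingularPoint ℓ u P ↔ IsSingularInChart ℓ T u x := by
  have hmem : chart T x ∈ P.submodule := by rw [hP]; exact Submodule.mem_span_singleton_self _
  have hne : chart T x ≠ 0 := fun h => by
    have := level_chart hT x
    rw [h, map_zero] at this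
    exact zero_ne_one this
  obtain ⟨c, hc, hrep⟩ := exists_rep_smul hne hmem
  obtain ⟨O, -, huO, A, hA, -⟩ := exists_adaptedFrame_basisForms hn hΩ hu
  rw [IsSingularPoint, IsSingularInChart, hP, Submodule.span_singleton_le_iff_mem, hrep,
    ruledTangent_smul hc]
  refine and_congr_right fun h => ?_
  rw [finrank_ruledTangent_chart (by omega) hT (hΩ.eventually_isotropic hu)
    (mem_ruledTangent_self hn hA huO h)]
  omega

theorem exists_chart (hn : 1 ≤ n) (hΩ : IsCongruence Ω ℓ) (hu : u ∈ Ω) {P : ℙ ℂ (Vec ℂ n)}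
    (hP : P.submodule ≤ extend ℂ (ℓ u)) :
    ∃ T, IsConformal T ∧ ∃ x : Fin n → ℂ, P.submodule = Submodule.span ℂ {chart T x} := by
  obtain ⟨T, hT, hl⟩ := exists_isConformal_level_ne_zero hn P.rep_nonzero
  have hrep : P.rep ∈ extend ℂ (ℓ u) := hP (by
    rw [Projectivization.submodule_eq]
    exact Submodule.mem_span_singleton_self _)
  refine ⟨T, hT, (level T P.rep)⁻¹ • inner (pullBack T P.rep), ?_⟩
  rw [chart_inner_pullBack hn hT (bil_eq_zero_of_mem_extend (hΩ.isotropic u hu) hrep hrep) hl,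
    Submodule.span_singleton_smul_eq (IsUnit.mk0 _ (inv_ne_zero hl)),
    Projectivization.submodule_eq]

/-- The divisor is computed in one frame and transported to all others. -/
theorem exists_singular_divisor (hn : 2 ≤ n) (hΩ : IsCongruence Ω ℓ) (hu : u ∈ Ω) :
    ∃ D : Multiset (ℙ ℂ (Vec ℂ n)), D.card = n - 2 ∧ (∀ P, P ∈ D ↔ IsSingularPoint ℓ u P) ∧
      ∀ O A, IsAdaptedFrame ℓ O A → u ∈ O → BasisForms A u →
        (∃! p : Matrix (Fin (n - 2)) (Fin (n - 2)) ℝ × (Fin (n - 2) → ℝ),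
          IsAffinor A u p.1 p.2) ∧
        ∀ Λ μ, IsAffinor A u Λ μ → IsRootDivisor A u Λ D := by
  obtain ⟨O, -, huO, A, hA, hB⟩ := exists_adaptedFrame_basisForms hn hΩ hu
  obtain ⟨p, hp, -⟩ := existsUnique_affinor hn hB
  obtain ⟨D, hcard, hD, hdiv⟩ := exists_rootDivisor hn hA huO hB hp
  exact ⟨D, hcard, hD, fun O' A' hA' hu' hB' => ⟨existsUnique_affinor hn hB',
    fun Λ' μ' hΛ' => isRootDivisor_change hn hA huO hB hA' hu' hB' hp hΛ' hdiv⟩⟩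

end Congruence

/-! ### The affinor of a completely integrable congruence -/

section Integrable

variable {n : ℕ} {ℓ : Param n → Submodule ℝ (Vec ℝ n)} {O O' : Set (Param n)}
  {A A' : Fin (n + 2) → Param n → Vec ℝ n} {u : Param n}

/-- The form `ω_0^n` as a covector field. -/
def omegaN (A : Fin (n + 2) → Param n → Vec ℝ n) (v : Param n) : Param n →L[ℝ] ℝ :=
  -(((bil (R := ℝ) (n := n)).toContinuousBilinearMap (A 1 v)).comp (fderiv ℝ (A 0) v))

theorem omegaN_apply (hn : 2 ≤ n) (hA : IsAdaptedFrame ℓ O A) (hu : u ∈ O) (w : Param n) :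
    omegaN A u w = conn A u w 0 (idxN n) := by
  have h := bil_fderiv_one hn hA hu w 0
  have h' : omegaN A u w = -bil (A 1 u) (fderiv ℝ (A 0) u w) := rfl
  rw [h', bil_comm, h, neg_neg]

theorem contDiffOn_omegaN (hA : IsAdaptedFrame ℓ O A) : ContDiffOn ℝ ∞ (omegaN A) O := by
  have h0 : ContDiffOn ℝ ∞ (fderiv ℝ (A 0)) O :=
    (hA.smooth 0).fderiv_of_isOpen hA.isOpen (by simp)
  exact (((bil (R := ℝ) (n := n)).toContinuousBilinearMap.contDiff.comp_contDiffOn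
    (hA.smooth 1)).clm_comp h0).neg

theorem fderiv_omegaN_apply (hn : 2 ≤ n) (hA : IsAdaptedFrame ℓ O A) (hu : u ∈ O)
    (w₁ w₂ : Param n) : fderiv ℝ (omegaN A) u w₁ w₂ =
      fderiv ℝ (fun v => conn A v w₂ 0 (idxN n)) u w₁ := by
  have hd : DifferentiableAt ℝ (omegaN A) u :=
    ((contDiffOn_omegaN hA).contDiffAt (hA.isOpen.mem_nhds hu)).differentiableAt (by simp)
  have heq : (fun v => conn A v w₂ 0 (idxN n)) =ᶠ[𝓝 u] fun v => omegaN A v w₂ := by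
    filter_upwards [hA.isOpen.mem_nhds hu] with v hv using (omegaN_apply hn hA hv w₂).symm
  have h : HasFDerivAt (fun v => omegaN A v w₂) _ u :=
    hd.hasFDerivAt.clm_apply (hasFDerivAt_const w₂ u)
  rw [heq.fderiv_eq, h.fderiv]
  simp

theorem dForm_eq_fderiv_omegaN (hn : 2 ≤ n) (hA : IsAdaptedFrame ℓ O A) (hu : u ∈ O)
    (w₁ w₂ : Param n) : dForm (fun v w => conn A v w 0 (idxN n)) u w₁ w₂ =
      fderiv ℝ (omegaN A) u w₁ w₂ - fderiv ℝ (omegaN A) u w₂ w₁ := by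
  rw [fderiv_omegaN_apply hn hA hu, fderiv_omegaN_apply hn hA hu, dForm]

/-- From ω_0^n = -(dA_0, A_1): the second derivatives of A_0 cancel by symmetry, leaving the
products of first derivatives. -/
theorem dForm_conn (hn : 2 ≤ n) (hA : IsAdaptedFrame ℓ O A) (hu : u ∈ O) (w₁ w₂ : Param n) :
    dForm (fun v w => conn A v w 0 (idxN n)) u w₁ w₂ =
      bil (fderiv ℝ (A 0) u w₁) (fderiv ℝ (A 1) u w₂) -
        bil (fderiv ℝ (A 0) u w₂) (fderiv ℝ (A 1) u w₁) := by
  have hs := contDiffAt_frame hA hu 0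
  have hd : DifferentiableAt ℝ (fderiv ℝ (A 0)) u :=
    (hs.fderiv_right (m := ∞) (by simp)).differentiableAt (by simp)
  have key : ∀ h w, fderiv ℝ (fun v => conn A v w 0 (idxN n)) u h =
      -(bil (fderiv ℝ (fderiv ℝ (A 0)) u h w) (A 1 u) +
        bil (fderiv ℝ (A 0) u w) (fderiv ℝ (A 1) u h)) := by
    intro h w
    have heq : (fun v => conn A v w 0 (idxN n)) =ᶠ[𝓝 u]
        fun v => -bil (fderiv ℝ (A 0) v w) (A 1 v) := by
      filter_upwards [hA.isOpen.mem_nhds hu] with v hv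
      rw [bil_fderiv_one hn hA hv, neg_neg]
    have h1 : HasFDerivAt (fun v => fderiv ℝ (A 0) v w) _ u :=
      hd.hasFDerivAt.clm_apply (hasFDerivAt_const w u)
    rw [heq.fderiv_eq, fderiv_fun_neg, _root_.neg_apply,
      fderiv_bil h1.differentiableAt (differentiableAt_frame hA hu 1), h1.fderiv]
    simp
  have hsymm := hs.isSymmSndFDerivAt
    (by simpa using (WithTop.coe_le_coe.2 le_top : ((2 : ℕ∞) : WithTop ℕ∞) ≤ ∞)) w₁ w₂
  rw [dForm, key, key, hsymm]
  ring

/-- On the kernel of ω_0^n the differentials have no A_n, A_{n+1} components, so only the middle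
ones contribute. With ω_1 = λω_0 this is the bilinear form of gλ, and dω_0^n is its
antisymmetrization. -/
theorem bil_fderiv_fderiv (hn : 2 ≤ n) (hA : IsAdaptedFrame ℓ O A) (hu : u ∈ O)
    {w₁ w₂ : Param n} (h₁ : conn A u w₁ 0 (idxN n) = 0) (h₂ : conn A u w₂ 0 (idxN n) = 0) :
    bil (fderiv ℝ (A 0) u w₁) (fderiv ℝ (A 1) u w₂) =
      (fun i => conn A u w₁ 0 (mid i)) ⬝ᵥ gMat A u *ᵥ fun i => conn A u w₂ 1 (mid i) := by
  have e0 : bil (A 0 u) (fderiv ℝ (A 1) u w₂) = 0 := by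
    rw [bil_comm, bil_fderiv_zero hn hA hu, conn_one_last hn hA hu, h₂]
    simp
  have e1 : bil (A 1 u) (fderiv ℝ (A 1) u w₂) = 0 := by
    rw [bil_comm, bil_fderiv_one hn hA hu, conn_one_idxN hn hA hu]
    simp
  rw [(bil_fderiv_of_orthogonal hn hA hu h₁ e0 e1).1, dotProduct]
  refine Finset.sum_congr rfl fun i _ => ?_
  rw [bil_comm, bil_fderiv_mid hn hA hu]
  congr 1
  simp only [Matrix.mulVec, dotProduct]
  refine Finset.sum_congr rfl fun j _ => ?_
  rw [mul_comm]
  simp only [gMat, Matrix.of_apply, scal_eq_bil, bil_comm (A (mid j) u)]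

theorem isSymm_of_dotProduct {ι : Type*} [Fintype ι] [DecidableEq ι] {M : Matrix ι ι ℝ}
    (h : ∀ x y, x ⬝ᵥ M *ᵥ y = y ⬝ᵥ M *ᵥ x) : M.IsSymm := by
  ext i j
  have := h (Pi.single j 1) (Pi.single i 1)
  simpa using this

theorem isSymmetricAffinor_of_bil (hn : 2 ≤ n) (hA : IsAdaptedFrame ℓ O A) (hu : u ∈ O)
    (hB : BasisForms A u) {Λ : Matrix (Fin (n - 2)) (Fin (n - 2)) ℝ} {μ : Fin (n - 2) → ℝ}
    (hΛ : IsAffinor A u Λ μ)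
    (h : ∀ w₁ w₂, conn A u w₁ 0 (idxN n) = 0 → conn A u w₂ 0 (idxN n) = 0 →
      bil (fderiv ℝ (A 0) u w₁) (fderiv ℝ (A 1) u w₂) =
        bil (fderiv ℝ (A 0) u w₂) (fderiv ℝ (A 1) u w₁)) :
    IsSymmetricAffinor A u Λ := by
  have hex : ∀ x : Fin (n - 2) → ℝ, ∃ w, (fun i => conn A u w 0 (mid i)) = x ∧
      conn A u w 0 (idxN n) = 0 ∧ (fun i => conn A u w 1 (mid i)) = Λ *ᵥ x := by
    intro x
    obtain ⟨w, hw⟩ := (bijective_basisMap hn hB).2 (x, 0)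
    have h1 : ∀ i, conn A u w 0 (mid i) = x i := fun i => by rw [← basisMap_fst, hw]
    have h2 : conn A u w 0 (idxN n) = 0 := by rw [← basisMap_snd, hw]
    refine ⟨w, funext h1, h2, funext fun i => ?_⟩
    rw [hΛ, h2]
    simp [Matrix.mulVec, dotProduct, h1]
  refine isSymm_of_dotProduct fun x y => ?_
  obtain ⟨w₁, a1, b1, c1⟩ := hex x
  obtain ⟨w₂, a2, b2, c2⟩ := hex y
  have := h w₁ w₂ b1 b2
  rwa [bil_fderiv_fderiv hn hA hu b1 b2, bil_fderiv_fderiv hn hA hu b2 b1, a1, a2, c1, c2,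
    Matrix.mulVec_mulVec, Matrix.mulVec_mulVec] at this

theorem bil_fderiv_line (hn : 2 ≤ n) (hA : IsAdaptedFrame ℓ O A) (hu : u ∈ O) {w : Param n}
    (hw : conn A u w 0 (idxN n) = 0) {z : Vec ℝ n} (hz : z ∈ ℓ u) :
    bil (fderiv ℝ (A 0) u w) z = 0 ∧ bil (fderiv ℝ (A 1) u w) z = 0 := by
  have h := bil_fderiv_of_orthogonal hn hA hu hw
    (bil_eq_zero_of_mem_line hA hu (frame_zero_mem hA hu) hz)
    (bil_eq_zero_of_mem_line hA hu (frame_one_mem hA hu) hz)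
  have h0 : ∀ i, bil (A (mid i) u) z = 0 := fun i => by
    rw [bil_comm]; exact bil_mid_eq_zero_of_mem_line hA hu hz i
  rw [h.1, h.2]
  simp [h0]

/-- On the kernel of `ω_0^n`, the form `dω_0^n` is multiplied by a factor under a change of the
adapted frame. -/
theorem bil_fderiv_symm_of_change (hn : 2 ≤ n) (hA : IsAdaptedFrame ℓ O A) (hu : u ∈ O)
    (hA' : IsAdaptedFrame ℓ O' A') (hu' : u ∈ O') {w₁ w₂ : Param n}
    (h₁ : conn A u w₁ 0 (idxN n) = 0) (h₂ : conn A u w₂ 0 (idxN n) = 0)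
    (h : bil (fderiv ℝ (A 0) u w₁) (fderiv ℝ (A 1) u w₂) =
      bil (fderiv ℝ (A 0) u w₂) (fderiv ℝ (A 1) u w₁)) :
    bil (fderiv ℝ (A' 0) u w₁) (fderiv ℝ (A' 1) u w₂) =
      bil (fderiv ℝ (A' 0) u w₂) (fderiv ℝ (A' 1) u w₁) := by
  obtain ⟨a, b, c, d, -, -, -, hd0, hd1⟩ := exists_frame_change hn hA hu hA' hu'
  -- The correction terms p, q lie on the line, which is orthogonal to itself and to the
  -- differentials along the kernel. In the remaining expansion the products of like differentials
  -- are symmetric, and the mixed ones are symmetric by hypothesis.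
  have key : ∀ w w', conn A u w 0 (idxN n) = 0 → conn A u w' 0 (idxN n) = 0 →
      bil (fderiv ℝ (A' 0) u w) (fderiv ℝ (A' 1) u w') =
        bil (a • fderiv ℝ (A 0) u w + b • fderiv ℝ (A 1) u w)
          (c • fderiv ℝ (A 0) u w' + d • fderiv ℝ (A 1) u w') := by
    intro w w' hw hw'
    set p := fderiv ℝ (A' 0) u w - (a • fderiv ℝ (A 0) u w + b • fderiv ℝ (A 1) u w) with hp
    set q := fderiv ℝ (A' 1) u w' - (c • fderiv ℝ (A 0) u w' + d • fderiv ℝ (A 1) u w') with hq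
    have ep : fderiv ℝ (A' 0) u w = (a • fderiv ℝ (A 0) u w + b • fderiv ℝ (A 1) u w) + p := by
      rw [hp]; abel
    have eq : fderiv ℝ (A' 1) u w' =
        (c • fderiv ℝ (A 0) u w' + d • fderiv ℝ (A 1) u w') + q := by
      rw [hq]; abel
    have hpm : p ∈ ℓ u := hd0 w
    have hqm : q ∈ ℓ u := hd1 w'
    have h1 := bil_fderiv_line hn hA hu hw hqm
    have h2 := bil_fderiv_line hn hA hu hw' hpm
    have h3 := bil_eq_zero_of_mem_line hA hu hpm hqm
    rw [bil_comm _ p, bil_comm _ p] at h2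
    rw [ep, eq]
    simp only [map_add, map_smul, LinearMap.add_apply, LinearMap.smul_apply, smul_eq_mul, h1.1,
      h1.2, h2.1, h2.2, h3]
    ring
  rw [key _ _ h₁ h₂, key _ _ h₂ h₁]
  simp only [map_add, map_smul, LinearMap.add_apply, LinearMap.smul_apply, smul_eq_mul]
  rw [bil_comm (fderiv ℝ (A 0) u w₂) (fderiv ℝ (A 0) u w₁),
    bil_comm (fderiv ℝ (A 1) u w₂) (fderiv ℝ (A 1) u w₁),
    bil_comm (fderiv ℝ (A 1) u w₁), bil_comm (fderiv ℝ (A 1) u w₂), h]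

theorem dForm_eq_zero_of_frobeniusAt {θ : Param n → Param n → ℝ} (hθ : FrobeniusAt θ u)
    {w₁ w₂ w₃ : Param n} (h₁ : θ u w₁ = 0) (h₂ : θ u w₂ = 0) (h₃ : θ u w₃ ≠ 0) :
    dForm θ u w₁ w₂ = 0 := by
  have := hθ w₁ w₂ w₃
  rw [h₁, h₂, mul_zero, mul_zero, add_zero, add_zero] at this
  exact (mul_eq_zero.1 this).resolve_right h₃

/-- The frame in which integrability is given need not have basis forms; its ω_0^n is still nonzero,
being proportional to that of a frame which does. -/
theorem exists_conn_idxN_ne_zero (hn : 2 ≤ n) (hA : IsAdaptedFrame ℓ O A) (hu : u ∈ O)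
    (hA' : IsAdaptedFrame ℓ O' A') (hu' : u ∈ O') (hB' : BasisForms A' u) :
    ∃ w, conn A u w 0 (idxN n) ≠ 0 := by
  obtain ⟨w, hw⟩ := (bijective_basisMap hn hB').2 (0, 1)
  have h2 : conn A' u w 0 (idxN n) = 1 := by rw [← basisMap_snd, hw]
  obtain ⟨r, hr, h⟩ := exists_conn_idxN_eq_mul hn hA hu hA' hu'
  refine ⟨w, fun h0 => ?_⟩
  rw [h, h0, mul_zero] at h2
  exact zero_ne_one h2

/-- Integrability makes dω_0^n vanish on the kernel of ω_0^n. This property passes to any other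
frame, where it says that gλ is symmetric. -/
theorem isSymmetricAffinor_of_frobeniusAt (hn : 2 ≤ n) (hA : IsAdaptedFrame ℓ O A) (hu : u ∈ O)
    (hF : FrobeniusAt (fun v w => conn A v w 0 (idxN n)) u)
    (hA' : IsAdaptedFrame ℓ O' A') (hu' : u ∈ O') (hB' : BasisForms A' u)
    {Λ : Matrix (Fin (n - 2)) (Fin (n - 2)) ℝ} {μ : Fin (n - 2) → ℝ} (hΛ : IsAffinor A' u Λ μ) :
    IsSymmetricAffinor A' u Λ := by
  obtain ⟨w₃, h₃⟩ := exists_conn_idxN_ne_zero hn hA hu hA' hu' hB'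
  refine isSymmetricAffinor_of_bil hn hA' hu' hB' hΛ fun w₁ w₂ h₁ h₂ => ?_
  obtain ⟨r, hr, h⟩ := exists_conn_idxN_eq_mul hn hA hu hA' hu'
  rw [h, mul_eq_zero, or_iff_right hr] at h₁ h₂
  refine bil_fderiv_symm_of_change hn hA hu hA' hu' h₁ h₂ ?_
  have := dForm_eq_zero_of_frobeniusAt hF h₁ h₂ h₃
  rw [dForm_conn hn hA hu] at this
  linarith

/-- The roots of `det (x + Λ)` are real if `Λ` is symmetric with respect to a positive definite
form. -/
theorem im_eq_zero_of_isSymm {ι : Type*} [Fintype ι] [DecidableEq ι] {g Λ : Matrix ι ι ℝ}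
    (hg : g.PosDef) (hs : (g * Λ).IsSymm) {x : ℂ}
    (hx : (x • (1 : Matrix ι ι ℂ) + Λ.map (algebraMap ℝ ℂ)).det = 0) : x.im = 0 := by
  obtain ⟨v, hv0, hv⟩ := Matrix.exists_mulVec_eq_zero_iff.2 hx
  let a : ι → ℝ := fun i => (v i).re
  let b : ι → ℝ := fun i => (v i).im
  have hcomp : ∀ i, x * v i + ∑ j, (Λ i j : ℂ) * v j = 0 := fun i => by
    rw [Matrix.add_mulVec, Matrix.smul_mulVec, Matrix.one_mulVec] at hv
    exact congrFun hv i
  -- Real and imaginary parts of Λv = -xv for v = a + ib.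
  have hre : Λ *ᵥ a = x.im • b - x.re • a := by
    funext i
    have := congrArg Complex.re (hcomp i)
    simp only [Complex.add_re, Complex.mul_re, Complex.re_sum, Complex.ofReal_re,
      Complex.ofReal_im, zero_mul, sub_zero, Complex.zero_re] at this
    simp only [Matrix.mulVec, dotProduct, Pi.sub_apply, Pi.smul_apply, smul_eq_mul, a, b]
    linarith
  have him : Λ *ᵥ b = -(x.im • a) - x.re • b := by
    funext i
    have := congrArg Complex.im (hcomp i)
    simp only [Complex.add_im, Complex.mul_im, Complex.im_sum, Complex.ofReal_re,
      Complex.ofReal_im, zero_mul, add_zero, Complex.zero_im] at this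
    simp only [Matrix.mulVec, dotProduct, Pi.sub_apply, Pi.neg_apply, Pi.smul_apply, smul_eq_mul,
      a, b]
    linarith
  have hgs : g.IsSymm := by
    have := hg.isHermitian
    rwa [Matrix.IsHermitian, Matrix.conjTranspose_eq_transpose_of_trivial] at this
  have hsw : ∀ {M : Matrix ι ι ℝ}, M.IsSymm → ∀ p q, p ⬝ᵥ M *ᵥ q = q ⬝ᵥ M *ᵥ p := by
    intro M hM p q
    rw [Matrix.dotProduct_mulVec, ← Matrix.mulVec_transpose, hM, dotProduct_comm]
  -- Comparing b·gΛa with a·gΛb, the terms with Re x cancel and Im x times the positive number a·ga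
  -- + b·gb must vanish.
  have e := hsw hs b a
  rw [← Matrix.mulVec_mulVec, ← Matrix.mulVec_mulVec, hre, him] at e
  simp only [Matrix.mulVec_sub, Matrix.mulVec_smul, Matrix.mulVec_neg, dotProduct_sub,
    dotProduct_smul, dotProduct_neg, smul_eq_mul] at e
  have e' := hsw hgs b a
  rw [e'] at e
  have hnn : ∀ p, 0 ≤ p ⬝ᵥ g *ᵥ p := fun p => by
    by_cases hp : p = 0
    · simp [hp]
    · simpa using (hg.dotProduct_mulVec_pos hp).le
  have hpos : 0 < a ⬝ᵥ g *ᵥ a + b ⬝ᵥ g *ᵥ b := by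
    by_cases ha : a = 0
    · have hb : b ≠ 0 := fun hb => hv0 (funext fun i =>
        Complex.ext (congrFun ha i) (congrFun hb i))
      have := hg.dotProduct_mulVec_pos hb
      simp only [star_trivial] at this
      linarith [hnn a]
    · have := hg.dotProduct_mulVec_pos ha
      simp only [star_trivial] at this
      linarith [hnn b]
  have : x.im * (a ⬝ᵥ g *ᵥ a + b ⬝ᵥ g *ᵥ b) = 0 := by linarith
  exact (mul_eq_zero.1 this).resolve_right hpos.ne'

theorem isRealPoint_of_isSymmetricAffinor (hn : 2 ≤ n) (hA : IsAdaptedFrame ℓ O A) (hu : u ∈ O)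
    (hB : BasisForms A u) {Λ : Matrix (Fin (n - 2)) (Fin (n - 2)) ℝ} {μ : Fin (n - 2) → ℝ}
    (hΛ : IsAffinor A u Λ μ) (hs : IsSymmetricAffinor A u Λ) {P : ℙ ℂ (Vec ℂ n)}
    (hP : IsSingularPoint ℓ u P) : IsRealPoint P := by
  obtain ⟨x, hx, hPx⟩ := (isSingularPoint_iff hn hA hu hB hΛ P).1 hP
  have h0 := (Polynomial.mem_roots'.1 hx).2
  rw [Polynomial.IsRoot, eval_singularPoly] at h0
  have him := im_eq_zero_of_isSymm (hA.sij u hu) hs h0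
  have hpt : emb ℂ (A 1 u + x.re • A 0 u) = pointOn A u x := by
    funext ξ
    have hxr : (x.re : ℂ) = x := Complex.ext rfl (by simp [him])
    simp [emb_apply, pointOn, hxr]
  refine ⟨A 1 u + x.re • A 0 u, fun h => pointOn_ne_zero hn hA hu x ?_, ?_⟩
  · rw [← hpt, h, map_zero]
  · rw [hPx]
    have : emb ℂ (A 1 u + x.re • A 0 u) ∈ Submodule.span ℂ {pointOn A u x} := by
      rw [hpt]; exact Submodule.mem_span_singleton_self _
    exact this

end Integrable

/-! ### The stratification into lightlike hypersurfaces -/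

section Lightlike

variable {n : ℕ} {ℓ : Param n → Submodule ℝ (Vec ℝ n)} {O : Set (Param n)}
  {A : Fin (n + 2) → Param n → Vec ℝ n} {u : Param n}
  {T : Matrix (Fin (n + 2)) (Fin (n + 2)) ℝ}

theorem emb_real (x : Vec ℝ n) : emb ℝ x = x := rfl

theorem emb_chart (x : Fin n → ℝ) :
    emb ℂ (chart T x) = chart T (fun r => (x r : ℂ)) := by
  have hm : mink (fun r => (x r : ℂ)) (fun r => (x r : ℂ)) = ((mink x x : ℝ) : ℂ) := by
    rw [mink, mink, Complex.ofReal_sum]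
    refine Finset.sum_congr rfl fun r _ => ?_
    split_ifs <;> simp
  have hd : darboux (fun r => (x r : ℂ)) = fun ξ => ((darboux x ξ : ℝ) : ℂ) := by
    refine vec_ext ?_ (fun r => ?_) ?_
    · simp [hm]
    · simp [inner]
    · simp [hm]
  funext ξ
  simp [chart, hd, emb_apply, Matrix.mulVec, dotProduct]

theorem IsAdaptedFrame.eventually_isotropic (hA : IsAdaptedFrame ℓ O A) (hu : u ∈ O) :
    ∀ᶠ v in 𝓝 u, ∀ x ∈ ℓ v, ∀ y ∈ ℓ v, scal x y = 0 := by
  filter_upwards [hA.isOpen.mem_nhds hu] with v hv x hx y hy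
  exact bil_eq_zero_of_mem_line hA hv hx hy

/-- At a nonsingular point `a A_0 + b A_1`, the forms `a ω_0^i + b ω_1^i` are independent on the
kernel of `ω_0^n`. -/
theorem eq_zero_of_not_isSingularInChart (hn : 2 ≤ n) (hA : IsAdaptedFrame ℓ O A) (hu : u ∈ O)
    (hT : IsConformal T) {x : Fin n → ℝ}
    (hns : ¬ IsSingularInChart ℓ T u (fun r => (x r : ℂ))) {a b : ℝ}
    (hx : chart T x = a • A 0 u + b • A 1 u) {w : Param n} (hw : conn A u w 0 (idxN n) = 0)
    (hi : ∀ i, a * conn A u w 0 (mid i) + b * conn A u w 1 (mid i) = 0) : w = 0 := by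
  by_contra hw0
  have hX : chart T (fun r => (x r : ℂ)) = (a : ℂ) • emb ℂ (A 0 u) + (b : ℂ) • emb ℂ (A 1 u) := by
    rw [← emb_chart, hx, map_add, emb_smul, emb_smul]
    rfl
  have hmem : chart T (fun r => (x r : ℂ)) ∈ extend ℂ (ℓ u) := by
    rw [hX]
    exact Submodule.add_mem _ (Submodule.smul_mem _ _ (emb_mem_extend (frame_zero_mem hA hu)))
      (Submodule.smul_mem _ _ (emb_mem_extend (frame_one_mem hA hu)))
  have hab : (a : ℂ) ≠ 0 ∨ (b : ℂ) ≠ 0 := by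
    by_contra! h
    have := level_chart hT (fun r => (x r : ℂ))
    rw [hX, h.1, h.2, zero_smul, zero_smul, add_zero, map_zero] at this
    exact zero_ne_one this
  refine hns ⟨hmem, ?_⟩
  have hfr := finrank_ruledTangent_chart (by omega) hT (hA.eventually_isotropic hu)
    (mem_ruledTangent_self hn hA hu hmem)
  have hlt := (finrank_ruledTangent_lt_iff hn hA hu hab).2
    ⟨fun k => algebraMap ℝ ℂ (w k), fun h => hw0 (funext fun k => ?_), ?_, fun i => ?_⟩
  · rw [← hX, hfr] at hlt
    omega
  · have := congrFun h k
    simpa using this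
  · rw [connK_ofReal, hw, map_zero]
  · rw [connK_ofReal, connK_ofReal]
    have := congrArg (algebraMap ℝ ℂ) (hi i)
    simpa using this

/-- The coordinates, in an adapted frame, of the vectors tangent to a slice. -/
theorem sliceTangent_eq_comb (hn : 2 ≤ n) (hA : IsAdaptedFrame ℓ O A) (hu : u ∈ O)
    {w : Param n} (hw : conn A u w 0 (idxN n) = 0) (a b α β : ℝ) :
    α • A 0 u + β • A 1 u + (a • fderiv ℝ (A 0) u w + b • fderiv ℝ (A 1) u w) =
      comb (K := ℝ) A u (ofParts
        (α + (a * conn A u w 0 0 + b * conn A u w 1 0))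
        (β + (a * conn A u w 0 1 + b * conn A u w 1 1))
        (fun i => a * conn A u w 0 (mid i) + b * conn A u w 1 (mid i)) 0 0) := by
  rw [fderiv_frame_comb hn hA hu, fderiv_frame_comb hn hA hu, ← emb_real (A 0 u),
    ← emb_real (A 1 u), ← comb_single, ← comb_single (ξ := 1), ← comb_smul, ← comb_smul,
    ← comb_smul, ← comb_smul, ← comb_add, ← comb_add, ← comb_add]
  congr 1
  have e0 := conn_zero_last hn hA hu w
  have e1 := conn_one_idxN hn hA hu w
  have e2 := conn_one_last hn hA hu w
  rw [hw, neg_zero] at e2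
  funext ξ
  have h01 : (0 : Fin (n + 2)) ≠ 1 := by simp
  have hm0 : ∀ i : Fin (n - 2), (mid i : Fin (n + 2)) ≠ 0 := fun i h => by
    simp [mid, Fin.ext_iff] at h
  have hm1 : ∀ i : Fin (n - 2), (mid i : Fin (n + 2)) ≠ 1 := fun i h => by
    simp [mid, Fin.ext_iff] at h
  have hN0 : idxN n ≠ 0 := fun h => by simp [idxN, Fin.ext_iff] at h; omega
  have hN1 : idxN n ≠ 1 := fun h => by simp [idxN, Fin.ext_iff] at h; omega
  have hl0 : Fin.last (n + 1) ≠ 0 := fun h => by simp [Fin.ext_iff] at h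
  have hl1 : Fin.last (n + 1) ≠ 1 := fun h => by simp [Fin.ext_iff] at h; omega
  rcases frame_index_cases hn ξ with rfl | rfl | ⟨i, rfl⟩ | rfl | rfl
  · simp
  · simp
  · simp [hm0, hm1]
  · simp [ofParts_idxN _ _ _ _ _ hn, hN0, hN1, hw, e1]
  · simp [ofParts_last _ _ _ _ _ hn, hl0, hl1, e0, e2]

/-- A_0 and A_1 pair nontrivially only with A_{n+1} and A_n, which are absent here; the square
depends on the middle components alone. -/
theorem bil_comb_self (hn : 2 ≤ n) (hA : IsAdaptedFrame ℓ O A) (hu : u ∈ O) (α β : ℝ)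
    (m : Fin (n - 2) → ℝ) :
    bil (comb (K := ℝ) A u (ofParts α β m 0 0)) (comb (K := ℝ) A u (ofParts α β m 0 0)) =
      m ⬝ᵥ gMat A u *ᵥ m := by
  have h0 := bil_comb_zero (K := ℝ) hn hA hu (ofParts α β m 0 0)
  have h1 := bil_comb_one (K := ℝ) hn hA hu (ofParts α β m 0 0)
  have hm := bil_comb_mid (K := ℝ) hn hA hu (ofParts α β m 0 0)
  rw [ofParts_last _ _ _ _ _ hn, neg_zero] at h0
  rw [ofParts_idxN _ _ _ _ _ hn, neg_zero] at h1
  set Z := comb (K := ℝ) A u (ofParts α β m 0 0) with hZ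
  have hs : ∀ Y : Vec ℝ n, bil Y Z = ∑ ξ, ofParts α β m 0 0 ξ * bil Y (emb ℝ (A ξ u)) :=
    fun Y => by simp only [hZ, comb, map_sum, map_smul, smul_eq_mul]
  rw [hs, sum_frame hn]
  simp only [ofParts_zero, ofParts_one, ofParts_idxN _ _ _ _ _ hn, ofParts_last _ _ _ _ _ hn,
    zero_mul, mul_zero, add_zero, zero_add, h0, h1, hm]
  simp only [ofParts_mid, dotProduct, Matrix.mulVec]
  refine Finset.sum_congr rfl fun i _ => ?_
  congr 1
  refine Finset.sum_congr rfl fun j _ => ?_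
  simp only [gMat, Matrix.of_apply, scal_eq_bil, bil_comm (A (mid j) u)]
  exact mul_comm _ _

/-- The tangent space of the slice consists of the line and n - 2 further directions, with
independent middle components at a nonsingular point. The form is positive modulo the line and zero
on it; passing to the chart removes the point itself, leaving dimension n - 1 and one null
direction. -/
theorem isLightlikeHyperplane_slice (hn : 3 ≤ n) (hA : IsAdaptedFrame ℓ O A)
    {f : (Fin (n - 2) → ℝ) → Param n} {y : Fin (n - 2) → ℝ} (hf : ContDiffAt ℝ ∞ f y)
    (hy : f y ∈ O) (hinj : Function.Injective (fderiv ℝ f y))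
    (hω : ∀ η, conn A (f y) (fderiv ℝ f y η) 0 (idxN n) = 0) (hT : IsConformal T)
    {x : Fin n → ℝ} (hx : chart T x ∈ ℓ (f y))
    (hns : ¬ IsSingularInChart ℓ T (f y) (fun r => (x r : ℂ))) :
    IsLightlikeHyperplane (chartTangent ℝ (fun y' => ℓ (f y')) T y x) := by
  have hn2 : 2 ≤ n := by omega
  have : Nonempty (Fin (n - 2)) := ⟨⟨0, by omega⟩⟩
  obtain ⟨a, b, hab⟩ : ∃ a b : ℝ, a • A 0 (f y) + b • A 1 (f y) = chart T x := by
    rwa [hA.span_eq _ hy, Submodule.mem_span_pair] at hx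
  have hev : ∀ᶠ y' in 𝓝 y, f y' ∈ O := hf.continuousAt.eventually_mem (hA.isOpen.mem_nhds hy)
  have hsm : ∀ ξ, ContDiffAt ℝ ∞ (fun y' => A ξ (f y')) y := fun ξ =>
    (contDiffAt_frame hA hy ξ).comp y hf
  have hder : ∀ ξ η, fderiv ℝ (fun y' => A ξ (f y')) y η =
      fderiv ℝ (A ξ) (f y) (fderiv ℝ f y η) := fun ξ η => by
    have h : HasFDerivAt (fun y' => A ξ (f y')) _ y :=
      (differentiableAt_frame hA hy ξ).hasFDerivAt.comp y
        (hf.differentiableAt (by simp)).hasFDerivAt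
    rw [h.fderiv]
    rfl
  have hRT : ruledTangent ℝ (fun y' => ℓ (f y')) y (chart T x) =
      Submodule.span ℝ ({A 0 (f y), A 1 (f y)} ∪ Set.range fun η =>
        a • fderiv ℝ (A 0) (f y) (fderiv ℝ f y η) + b • fderiv ℝ (A 1) (f y) (fderiv ℝ f y η)) := by
    have := ruledTangent_eq (K := ℝ) (ℓ := fun y' => ℓ (f y')) (hsm 0) (hsm 1)
      (hsm (Fin.last (n + 1))) (hsm (idxN n))
      (by filter_upwards [hev] with y' hy' using hA.span_eq _ hy')
      (by
        filter_upwards [hev] with y' hy'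
        exact ⟨hA.s0l _ hy', hA.s1l _ hy', hA.s0n _ hy', hA.s1n _ hy'⟩) a b
    simp only [emb_real, hder, hab] at this
    exact this
  let τ : (ℝ × ℝ) × (Fin (n - 2) → ℝ) →ₗ[ℝ] Vec ℝ n :=
    LinearMap.coprod
      (LinearMap.coprod (LinearMap.toSpanSingleton ℝ _ (A 0 (f y)))
        (LinearMap.toSpanSingleton ℝ _ (A 1 (f y))))
      (a • ((fderiv ℝ (A 0) (f y)).comp (fderiv ℝ f y)).toLinearMap +
        b • ((fderiv ℝ (A 1) (f y)).comp (fderiv ℝ f y)).toLinearMap)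
  have hτ : ∀ α β η, τ ((α, β), η) = α • A 0 (f y) + β • A 1 (f y) +
      (a • fderiv ℝ (A 0) (f y) (fderiv ℝ f y η) + b • fderiv ℝ (A 1) (f y) (fderiv ℝ f y η)) :=
    fun α β η => rfl
  have hτc : ∀ α β η, ∃ α' β', τ ((α, β), η) = comb (K := ℝ) A (f y) (ofParts α' β'
      (fun i => a * conn A (f y) (fderiv ℝ f y η) 0 (mid i) +
        b * conn A (f y) (fderiv ℝ f y η) 1 (mid i)) 0 0) := fun α β η =>
    ⟨_, _, (hτ α β η).trans (sliceTangent_eq_comb hn2 hA hy (hω η) a b α β)⟩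
  -- Nonsingularity, combined with injectivity of the differential of the slice.
  have hzero : ∀ η, (fun i => a * conn A (f y) (fderiv ℝ f y η) 0 (mid i) +
        b * conn A (f y) (fderiv ℝ f y η) 1 (mid i)) = 0 → η = 0 := fun η h =>
    hinj ((eq_zero_of_not_isSingularInChart hn2 hA hy hT hns hab.symm (hω η)
      (congrFun h)).trans (map_zero _).symm)
  have hτinj : Function.Injective τ := by
    rw [injective_iff_map_eq_zero]
    rintro ⟨⟨α, β⟩, η⟩ h
    obtain ⟨α', β', h'⟩ := hτc α β η
    rw [h] at h'
    have hc := comb_injective hn2 hA hy h'.symm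
    have hη : η = 0 := hzero η (funext fun i => by
      have := congrFun hc (mid i)
      rwa [ofParts_mid] at this)
    rw [hτ, hη] at h
    simp only [map_zero, smul_zero, add_zero] at h
    have := smul_add_smul_eq_zero (K := ℝ) hn2 hA hy h
    rw [hη, this.1, this.2]
    rfl
  have hrange : LinearMap.range τ = ruledTangent ℝ (fun y' => ℓ (f y')) y (chart T x) := by
    rw [hRT]
    apply le_antisymm
    · rintro _ ⟨⟨⟨α, β⟩, η⟩, rfl⟩
      rw [hτ]
      exact Submodule.add_mem _ (Submodule.add_mem _
        (Submodule.smul_mem _ _ (Submodule.subset_span (Or.inl (Or.inl rfl))))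
        (Submodule.smul_mem _ _ (Submodule.subset_span (Or.inl (Or.inr rfl)))))
        (Submodule.subset_span (Or.inr ⟨η, rfl⟩))
    · refine Submodule.span_le.2 ?_
      rintro _ ((rfl | rfl) | ⟨η, rfl⟩)
      · exact ⟨((1, 0), 0), by simp [hτ]⟩
      · exact ⟨((0, 1), 0), by simp [hτ]⟩
      · exact ⟨((0, 0), η), by simp [hτ]⟩
  have hmemτ : ∀ α β : ℝ, α • A 0 (f y) + β • A 1 (f y) ∈
      ruledTangent ℝ (fun y' => ℓ (f y')) y (chart T x) := fun α β => by
    rw [← hrange]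
    exact ⟨((α, β), 0), by simp [hτ]⟩
  have hXmem : chart T x ∈ ruledTangent ℝ (fun y' => ℓ (f y')) y (chart T x) := by
    have := hmemτ a b
    rwa [hab] at this
  have hiso : ∀ᶠ y' in 𝓝 y, ∀ p ∈ ℓ (f y'), ∀ q ∈ ℓ (f y'), scal p q = 0 := by
    filter_upwards [hev] with y' hy' p hp q hq using bil_eq_zero_of_mem_line hA hy' hp hq
  have hsum := ruledTangent_chart (by omega) hT hiso hXmem
  have hfin : Module.finrank ℝ (ruledTangent ℝ (fun y' => ℓ (f y')) y (chart T x)) = n := by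
    rw [← hrange, LinearMap.finrank_range_of_inj hτinj]
    simp
    omega
  have hfr := finrank_ruledTangent_chart (by omega) hT hiso hXmem
  refine ⟨by omega, ?_⟩
  set l0 := level T (A 0 (f y)) with hl0
  set l1 := level T (A 1 (f y)) with hl1
  have hlev : a * l0 + b * l1 = 1 := by
    have := level_chart hT x
    rwa [← hab, map_add, map_smul, map_smul, smul_eq_mul, smul_eq_mul] at this
  -- l₁A_0 - l₀A_1 is, up to a factor, the vector of the line of level 0: it is tangent to the
  -- isotropic line in the chart and gives the null direction z₀.
  have hZmem := hmemτ l1 (-l0)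
  rw [hsum] at hZmem
  obtain ⟨p, hp, q, ⟨z₀, hz₀, rfl⟩, hpq⟩ := Submodule.mem_sup.1 hZmem
  obtain ⟨r, rfl⟩ := Submodule.mem_span_singleton.1 hp
  have hr : r = 0 := by
    have := congrArg (level T) hpq
    rw [map_add, map_smul, level_chart hT, level_dChart hT, map_add, map_smul, map_smul] at this
    simp only [smul_eq_mul, ← hl0, ← hl1] at this
    linarith
  rw [hr, zero_smul, zero_add] at hpq
  have hz₀ne : z₀ ≠ 0 := by
    rintro rfl
    rw [map_zero] at hpq
    have := smul_add_smul_eq_zero (K := ℝ) hn2 hA hy hpq.symm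
    rw [this.1, neg_eq_zero.1 this.2] at hlev
    simp at hlev
  refine ⟨z₀, hz₀, hz₀ne, fun z hz => ?_⟩
  have hzmem : dChart T x z ∈ LinearMap.range τ := by
    rw [hrange, hsum]
    exact Submodule.mem_sup_right (Submodule.mem_map_of_mem hz)
  obtain ⟨⟨⟨α, β⟩, η⟩, hζ⟩ := hzmem
  obtain ⟨α', β', hζ'⟩ := hτc α β η
  have hmink := bil_dChart (by omega) hT x z
  rw [← hζ, hζ', bil_comb_self hn2 hA hy] at hmink
  have hg := hA.sij _ hy
  refine ⟨?_, fun h => ?_, fun h => ?_⟩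
  · rw [← hmink]
    simpa using hg.posSemidef.dotProduct_mulVec_nonneg
      (fun i => a * conn A (f y) (fderiv ℝ f y η) 0 (mid i) +
        b * conn A (f y) (fderiv ℝ f y η) 1 (mid i))
  · rw [← hmink] at h
    have hη : η = 0 := hzero η (by
      by_contra hne
      have := hg.dotProduct_mulVec_pos hne
      rw [star_trivial, h] at this
      exact lt_irrefl _ this)
    rw [hτ, hη] at hζ
    simp only [map_zero, smul_zero, add_zero] at hζ
    have hl : α * l0 + β * l1 = 0 := by
      have := congrArg (level T) hζ
      rwa [level_dChart hT, map_add, map_smul, map_smul, smul_eq_mul, smul_eq_mul] at this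
    -- A vector of the line of level zero is a multiple of l₁A_0 - l₀A_1; the factor is found from
    -- al₀ + bl₁ = 1.
    have hα : α = (α * b - a * β) * l1 := by linear_combination a * hl - α * hlev
    have hβ : β = (α * b - a * β) * (-l0) := by linear_combination b * hl - β * hlev
    refine Submodule.mem_span_singleton.2 ⟨α * b - a * β, dChart_injective hT x ?_⟩
    rw [map_smul, hpq, ← hζ, smul_add, smul_smul, smul_smul, ← hα, ← hβ]
  · obtain ⟨r, rfl⟩ := Submodule.mem_span_singleton.1 h
    rw [← bil_dChart (by omega) hT x, map_smul, hpq]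
    have hmem : r • (l1 • A 0 (f y) + (-l0) • A 1 (f y)) ∈ ℓ (f y) :=
      Submodule.smul_mem _ _ (Submodule.add_mem _ (Submodule.smul_mem _ _ (frame_zero_mem hA hy))
        (Submodule.smul_mem _ _ (frame_one_mem hA hy)))
    exact bil_eq_zero_of_mem_line hA hy hmem hmem

theorem injective_fderiv_of_symm {E F : Type*} [NormedAddCommGroup E] [NormedSpace ℝ E]
    [NormedAddCommGroup F] [NormedSpace ℝ F] {Φ : OpenPartialHomeomorph E F} {p : E}
    (hp : p ∈ Φ.source) (hΦ : ContDiffOn ℝ ∞ Φ Φ.source)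
    (hΦ' : ContDiffOn ℝ ∞ Φ.symm Φ.target) : Function.Injective (fderiv ℝ Φ p) := by
  have h1 := (hΦ.contDiffAt (Φ.open_source.mem_nhds hp)).differentiableAt (by simp)
  have h2 := (hΦ'.contDiffAt (Φ.open_target.mem_nhds (Φ.map_source hp))).differentiableAt
    (by simp)
  have hid : (Φ.symm ∘ Φ) =ᶠ[𝓝 p] id := Φ.eventually_left_inverse hp
  have h3 := (h2.hasFDerivAt.comp p h1.hasFDerivAt).unique
    ((hasFDerivAt_id p).congr_of_eventuallyEq hid)
  intro v w hvw
  have h4 := congrArg (fun L : E →L[ℝ] E => L v) h3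
  have h5 := congrArg (fun L : E →L[ℝ] E => L w) h3
  simp only [ContinuousLinearMap.comp_apply, ContinuousLinearMap.id_apply] at h4 h5
  rw [← h4, ← h5, hvw]

/-- The leaves of ω_0^n = 0 are supplied by Frobenius; the previous theorem treats each leaf, and
proportionality of ω_0^n makes the leaves independent of the frame. -/
theorem stratifiedIntoLightlike (hn : 3 ≤ n) {Ω : Set (Param n)} (hΩ : IsCongruence Ω ℓ)
    (hci : CompletelyIntegrable Ω ℓ) : StratifiedIntoLightlike Ω ℓ := by
  have hn2 : 2 ≤ n := by omega
  intro u hu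
  obtain ⟨O, hO, huO, A, hA, hF⟩ := hci u hu
  obtain ⟨O', -, huO', A', hA', hB'⟩ := exists_adaptedFrame_basisForms hn2 hΩ hu
  obtain ⟨r, hr, hrel⟩ := exists_conn_idxN_eq_mul hn2 hA' huO' hA huO
  -- Linear coordinates dual to the basis forms at u, so that the last one is transverse to the
  -- kernel of ω_0^n.
  let L : ((Fin (n - 2) → ℝ) × ℝ) ≃L[ℝ] Param n :=
    (LinearEquiv.ofBijective (basisMap A' u) (bijective_basisMap hn2 hB')).symm.toContinuousLinearEquiv
  have hL : omegaN A u (L (0, 1)) ≠ 0 := by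
    have h1 : basisMap A' u (L (0, 1)) = (0, 1) :=
      (LinearEquiv.ofBijective (basisMap A' u) (bijective_basisMap hn2 hB')).apply_symm_apply _
    rw [omegaN_apply hn2 hA huO, hrel, ← basisMap_snd, h1, mul_one]
    exact hr
  have hinv : ∀ v ∈ O, ∀ w₁ w₂, omegaN A v w₁ = 0 → omegaN A v w₂ = 0 →
      fderiv ℝ (omegaN A) v w₁ w₂ = fderiv ℝ (omegaN A) v w₂ w₁ := by
    intro v hv w₁ w₂ h₁ h₂
    obtain ⟨O'', -, hvO'', A'', hA'', hB''⟩ := exists_adaptedFrame_basisForms hn2 hΩ (hO hv)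
    obtain ⟨w₃, h₃⟩ := exists_conn_idxN_ne_zero hn2 hA hv hA'' hvO'' hB''
    rw [omegaN_apply hn2 hA hv] at h₁ h₂
    have := dForm_eq_zero_of_frobeniusAt (hF v hv) h₁ h₂ h₃
    rw [dForm_eq_fderiv_omegaN hn2 hA hv] at this
    linarith
  obtain ⟨Φ, huΦ, hΦO, hΦ, hΦ', hker⟩ :=
    exists_foliated_chart hA.isOpen (contDiffOn_omegaN hA) huO L hL hinv
  refine ⟨Φ, huΦ, hΦO.trans hO, hΦ, hΦ', fun y c hyc => ?_⟩
  have hp : Φ (y, c) ∈ O := hΦO (Φ.map_source hyc)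
  have hker' : ∀ η, conn A (Φ (y, c)) (fderiv ℝ Φ (y, c) (η, 0)) 0 (idxN n) = 0 := fun η => by
    rw [← omegaN_apply hn2 hA hp]
    exact hker _ hyc η
  refine ⟨fun O₁ A₁ hA₁ hu₁ η => ?_, fun T hT x hx hns => ?_⟩
  · obtain ⟨s, -, hs⟩ := exists_conn_idxN_eq_mul hn2 hA hp hA₁ hu₁
    rw [hs, hker', mul_zero]
  · have hΦat := hΦ.contDiffAt (Φ.open_source.mem_nhds hyc)
    have hpair : HasFDerivAt (fun y' : Fin (n - 2) → ℝ => (y', c))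
        (ContinuousLinearMap.inl ℝ (Fin (n - 2) → ℝ) ℝ) y := hasFDerivAt_prodMk_left y c
    have hf : ContDiffAt ℝ ∞ (fun y' => Φ (y', c)) y :=
      hΦat.comp y (contDiffAt_id.prodMk contDiffAt_const)
    have hd : HasFDerivAt (fun y' => Φ (y', c)) _ y :=
      (hΦat.differentiableAt (by simp)).hasFDerivAt.comp y hpair
    have hd' : ∀ η, fderiv ℝ (fun y' => Φ (y', c)) y η = fderiv ℝ Φ (y, c) (η, 0) := fun η => by
      rw [hd.fderiv]
      rfl
    refine isLightlikeHyperplane_slice (f := fun y' => Φ (y', c)) hn hA hf hp ?_ ?_ hT hx hns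
    · intro η₁ η₂ h
      rw [hd', hd'] at h
      exact congrArg Prod.fst (injective_fderiv_of_symm hyc hΦ hΦ' h)
    · intro η
      rw [hd']
      exact hker' η

end Lightlike

/-! ### Congruences with a prescribed affinor -/

section Example

variable {n : ℕ}

/-- The vector `α E_0 + β E_1 + m^i E_i + γ E_n + δ E_{n+1}`, where `E_ξ` is a constant adapted
frame. -/
def nullVec : ((ℝ × ℝ) × (Fin (n - 2) → ℝ) × (ℝ × ℝ)) →L[ℝ] Vec ℝ n :=
  LinearMap.toContinuousLinearMap
    -- E_0 and E_{n+1} are (1/2, 1/2) and (-1, 1) in the plane of the coordinates 0 and n+1, both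
    -- null with product -1; likewise E_1 and E_n in the coordinates 1 and n.
    { toFun := fun p => ofParts (p.1.1 / 2 - p.2.2.2) (p.1.2 / 2 - p.2.2.1) p.2.1
        (p.1.2 / 2 + p.2.2.1) (p.1.1 / 2 + p.2.2.2)
      map_add' := fun p q => by
        funext ξ
        simp only [ofParts, Prod.fst_add, Prod.snd_add, Pi.add_apply]
        split_ifs <;> ring
      map_smul' := fun r p => by
        funext ξ
        simp only [ofParts, Prod.smul_fst, Prod.smul_snd, Pi.smul_apply, smul_eq_mul,
          RingHom.id_apply]
        split_ifs <;> ring }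

theorem nullVec_apply (α β γ δ : ℝ) (m : Fin (n - 2) → ℝ) :
    nullVec ((α, β), m, (γ, δ)) = ofParts (α / 2 - δ) (β / 2 - γ) m (β / 2 + γ) (α / 2 + δ) := rfl

theorem bil_nullVec (hn : 2 ≤ n) (α β γ δ α' β' γ' δ' : ℝ) (m m' : Fin (n - 2) → ℝ) :
    bil (nullVec ((α, β), m, (γ, δ))) (nullVec ((α', β'), m', (γ', δ'))) =
      m ⬝ᵥ m' - (α * δ' + δ * α') - (β * γ' + γ * β') := by
  rw [bil_eq_frame_sum hn]
  simp only [nullVec_apply, ofParts_zero, ofParts_one, ofParts_mid, ofParts_idxN _ _ _ _ _ hn,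
    ofParts_last _ _ _ _ _ hn, dotProduct]
  ring

variable (e : Param n ≃L[ℝ] (Fin (n - 2) → ℝ) × ℝ) (Λ : Matrix (Fin (n - 2)) (Fin (n - 2)) ℝ)

/-- An adapted frame over the whole parameter space with the affinor `Λ`. In terms of the
coordinates `(s, t)` of a point, `A_0 = E_0 + s^i E_i + t E_n + ½ |s|² E_{n+1}` and
`A_1 = E_1 + (Λ s)^i E_i + ½ |Λ s|² E_n + (s · Λ s - t) E_{n+1}`. -/
def modelFrame : Fin (n + 2) → Param n → Vec ℝ n :=
  ofParts
    (fun v => nullVec ((1, 0), (e v).1, ((e v).2, (e v).1 ⬝ᵥ (e v).1 / 2)))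
    (fun v => nullVec ((0, 1), Λ *ᵥ (e v).1,
      ((Λ *ᵥ (e v).1) ⬝ᵥ (Λ *ᵥ (e v).1) / 2, (e v).1 ⬝ᵥ Λ *ᵥ (e v).1 - (e v).2)))
    (fun i v => nullVec ((0, 0), Pi.single i 1, ((Λ *ᵥ (e v).1) i, (e v).1 i)))
    (fun _ => nullVec ((0, 0), 0, (1, 0)))
    (fun _ => nullVec ((0, 0), 0, (0, 1)))

theorem modelFrame_zero : modelFrame e Λ 0 =
    fun v => nullVec ((1, 0), (e v).1, ((e v).2, (e v).1 ⬝ᵥ (e v).1 / 2)) :=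
  ofParts_zero ..

theorem modelFrame_one : modelFrame e Λ 1 = fun v => nullVec ((0, 1), Λ *ᵥ (e v).1,
    ((Λ *ᵥ (e v).1) ⬝ᵥ (Λ *ᵥ (e v).1) / 2, (e v).1 ⬝ᵥ Λ *ᵥ (e v).1 - (e v).2)) :=
  ofParts_one ..

theorem modelFrame_mid (i : Fin (n - 2)) : modelFrame e Λ (mid i) =
    fun v => nullVec ((0, 0), Pi.single i 1, ((Λ *ᵥ (e v).1) i, (e v).1 i)) :=
  ofParts_mid ..

theorem modelFrame_idxN (hn : 2 ≤ n) :
    modelFrame e Λ (idxN n) = fun _ => nullVec ((0, 0), 0, (1, 0)) :=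
  ofParts_idxN _ _ _ _ _ hn

theorem modelFrame_last (hn : 2 ≤ n) :
    modelFrame e Λ (Fin.last (n + 1)) = fun _ => nullVec ((0, 0), 0, (0, 1)) :=
  ofParts_last _ _ _ _ _ hn

theorem contDiff_coord_fst : ContDiff ℝ ∞ fun v => (e v).1 := contDiff_fst.comp e.contDiff

theorem contDiff_coord_snd : ContDiff ℝ ∞ fun v => (e v).2 := contDiff_snd.comp e.contDiff

theorem contDiff_dotProduct {F : Type*} [NormedAddCommGroup F] [NormedSpace ℝ F] {ι : Type*}
    [Fintype ι] {f g : F → ι → ℝ} (hf : ContDiff ℝ ∞ f) (hg : ContDiff ℝ ∞ g) :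
    ContDiff ℝ ∞ fun v => f v ⬝ᵥ g v :=
  ContDiff.sum fun i _ => (contDiff_pi.1 hf i).mul (contDiff_pi.1 hg i)

theorem contDiff_mulVec_fst : ContDiff ℝ ∞ fun v => Λ *ᵥ (e v).1 :=
  contDiff_pi.2 fun _ => contDiff_dotProduct contDiff_const (contDiff_coord_fst e)

theorem contDiff_modelFrame (hn : 2 ≤ n) (ξ : Fin (n + 2)) : ContDiff ℝ ∞ (modelFrame e Λ ξ) := by
  have h1 := contDiff_coord_fst e
  have h2 := contDiff_coord_snd e
  have h3 := contDiff_mulVec_fst e Λ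
  rcases frame_index_cases hn ξ with rfl | rfl | ⟨i, rfl⟩ | rfl | rfl
  · rw [modelFrame_zero]
    exact nullVec.contDiff.comp (contDiff_const.prodMk
      (h1.prodMk (h2.prodMk ((contDiff_dotProduct h1 h1).div_const 2))))
  · rw [modelFrame_one]
    exact nullVec.contDiff.comp (contDiff_const.prodMk
      (h3.prodMk (((contDiff_dotProduct h3 h3).div_const 2).prodMk
        ((contDiff_dotProduct h1 h3).sub h2))))
  · rw [modelFrame_mid]
    exact nullVec.contDiff.comp (contDiff_const.prodMk
      (contDiff_const.prodMk ((contDiff_pi.1 h3 i).prodMk (contDiff_pi.1 h1 i))))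
  · rw [modelFrame_idxN e Λ hn]
    exact contDiff_const
  · rw [modelFrame_last e Λ hn]
    exact contDiff_const

/-- The congruence of the lines `A_0 A_1` of the model frame. -/
def modelLine (v : Param n) : Submodule ℝ (Vec ℝ n) :=
  Submodule.span ℝ {modelFrame e Λ 0 v, modelFrame e Λ 1 v}

theorem gMat_modelFrame (hn : 2 ≤ n) (v : Param n) : gMat (modelFrame e Λ) v = 1 := by
  ext i j
  simp only [gMat, Matrix.of_apply, scal_eq_bil, modelFrame_mid, bil_nullVec hn]
  simp [Matrix.one_apply, Pi.single_apply, eq_comm]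

theorem isAdaptedFrame_modelFrame (hn : 2 ≤ n) :
    IsAdaptedFrame (modelLine e Λ) Set.univ (modelFrame e Λ) := by
  constructor
  case isOpen => exact isOpen_univ
  case smooth => exact fun ξ => (contDiff_modelFrame e Λ hn ξ).contDiffOn
  case span_eq => exact fun _ _ => rfl
  case sij =>
    intro v _
    rw [gMat_modelFrame e Λ hn]
    exact Matrix.PosDef.one
  all_goals
    intros
    simp only [scal_eq_bil, modelFrame_zero, modelFrame_one, modelFrame_mid,
      modelFrame_idxN e Λ hn, modelFrame_last e Λ hn, bil_nullVec hn]
    simp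

theorem fderiv_nullVec {α β γ δ : Param n → ℝ} {m : Param n → Fin (n - 2) → ℝ} {v : Param n}
    (hα : DifferentiableAt ℝ α v) (hβ : DifferentiableAt ℝ β v) (hγ : DifferentiableAt ℝ γ v)
    (hδ : DifferentiableAt ℝ δ v) (hm : DifferentiableAt ℝ m v) (w : Param n) :
    fderiv ℝ (fun v => nullVec ((α v, β v), m v, (γ v, δ v))) v w =
      nullVec ((fderiv ℝ α v w, fderiv ℝ β v w), fderiv ℝ m v w,
        (fderiv ℝ γ v w, fderiv ℝ δ v w)) := by
  have h : HasFDerivAt (fun v => nullVec ((α v, β v), m v, (γ v, δ v))) _ v :=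
    (nullVec (n := n)).hasFDerivAt.comp v ((hα.hasFDerivAt.prodMk hβ.hasFDerivAt).prodMk
      (hm.hasFDerivAt.prodMk (hγ.hasFDerivAt.prodMk hδ.hasFDerivAt)))
  rw [h.fderiv]
  rfl

theorem fderiv_coord_fst (v w : Param n) : fderiv ℝ (fun v => (e v).1) v w = (e w).1 := by
  have h : HasFDerivAt (fun v => (e v).1) _ v :=
    ((ContinuousLinearMap.fst ℝ (Fin (n - 2) → ℝ) ℝ).comp e.toContinuousLinearMap).hasFDerivAt
  rw [h.fderiv]
  rfl

theorem fderiv_coord_snd (v w : Param n) : fderiv ℝ (fun v => (e v).2) v w = (e w).2 := by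
  have h : HasFDerivAt (fun v => (e v).2) _ v :=
    ((ContinuousLinearMap.snd ℝ (Fin (n - 2) → ℝ) ℝ).comp e.toContinuousLinearMap).hasFDerivAt
  rw [h.fderiv]
  rfl

theorem fderiv_mulVec_fst (v w : Param n) :
    fderiv ℝ (fun v => Λ *ᵥ (e v).1) v w = Λ *ᵥ (e w).1 := by
  have h : HasFDerivAt (fun v => Λ *ᵥ (e v).1) _ v :=
    ((LinearMap.toContinuousLinearMap Λ.mulVecLin).comp
      ((ContinuousLinearMap.fst ℝ (Fin (n - 2) → ℝ) ℝ).comp e.toContinuousLinearMap)).hasFDerivAt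
  rw [h.fderiv]
  rfl

/-- The E_{n+1} component is left unspecified: it is invisible in the products with A_1 and the A_i
that give ω_0^n and ω_0^i. -/
theorem exists_fderiv_modelFrame_zero (v w : Param n) : ∃ δ : ℝ,
    fderiv ℝ (modelFrame e Λ 0) v w = nullVec ((0, 0), (e w).1, ((e w).2, δ)) := by
  have h1 := (contDiff_coord_fst e).differentiable (by simp) v
  have h2 := (contDiff_coord_snd e).differentiable (by simp) v
  have h3 := ((contDiff_dotProduct (contDiff_coord_fst e) (contDiff_coord_fst e)).div_const 2).differentiable
    (by simp) v
  refine ⟨fderiv ℝ (fun v => (e v).1 ⬝ᵥ (e v).1 / 2) v w, ?_⟩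
  rw [modelFrame_zero, fderiv_nullVec (differentiableAt_const _) (differentiableAt_const _) h2 h3
    h1, fderiv_coord_fst, fderiv_coord_snd]
  simp

theorem exists_fderiv_modelFrame_one (v w : Param n) : ∃ γ δ : ℝ,
    fderiv ℝ (modelFrame e Λ 1) v w = nullVec ((0, 0), Λ *ᵥ (e w).1, (γ, δ)) := by
  have h1 := (contDiff_mulVec_fst e Λ).differentiable (by simp) v
  have h2 := ((contDiff_dotProduct (contDiff_mulVec_fst e Λ)
    (contDiff_mulVec_fst e Λ)).div_const 2).differentiable (by simp) v
  have h3 := ((contDiff_dotProduct (contDiff_coord_fst e)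
    (contDiff_mulVec_fst e Λ)).sub (contDiff_coord_snd e)).differentiable (by simp) v
  refine ⟨fderiv ℝ (fun v => (Λ *ᵥ (e v).1) ⬝ᵥ (Λ *ᵥ (e v).1) / 2) v w,
    fderiv ℝ (fun v => (e v).1 ⬝ᵥ Λ *ᵥ (e v).1 - (e v).2) v w, ?_⟩
  rw [modelFrame_one, fderiv_nullVec (differentiableAt_const _) (differentiableAt_const _) h2 h3
    h1, fderiv_mulVec_fst]
  simp

theorem conn_modelFrame_mid (hn : 2 ≤ n) (v w : Param n) (ξ : Fin (n + 2)) (j : Fin (n - 2)) :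
    conn (modelFrame e Λ) v w ξ (mid j) =
      bil (fderiv ℝ (modelFrame e Λ ξ) v w) (modelFrame e Λ (mid j) v) := by
  rw [bil_fderiv_mid hn (isAdaptedFrame_modelFrame e Λ hn) (Set.mem_univ v), gMat_modelFrame e Λ hn]
  simp [Matrix.one_apply]

theorem conn_modelFrame_zero_mid (hn : 2 ≤ n) (v w : Param n) (j : Fin (n - 2)) :
    conn (modelFrame e Λ) v w 0 (mid j) = (e w).1 j := by
  obtain ⟨δ, h⟩ := exists_fderiv_modelFrame_zero e Λ v w
  rw [conn_modelFrame_mid e Λ hn, h, modelFrame_mid, bil_nullVec hn]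
  simp

theorem conn_modelFrame_one_mid (hn : 2 ≤ n) (v w : Param n) (j : Fin (n - 2)) :
    conn (modelFrame e Λ) v w 1 (mid j) = (Λ *ᵥ (e w).1) j := by
  obtain ⟨γ, δ, h⟩ := exists_fderiv_modelFrame_one e Λ v w
  rw [conn_modelFrame_mid e Λ hn, h, modelFrame_mid, bil_nullVec hn]
  simp

/-- In coordinates ω_0^n = dt - ds·Λs, so its exterior derivative is the antisymmetric part of Λ. -/
theorem conn_modelFrame_zero_idxN (hn : 2 ≤ n) (v w : Param n) :
    conn (modelFrame e Λ) v w 0 (idxN n) = (e w).2 - (e w).1 ⬝ᵥ Λ *ᵥ (e v).1 := by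
  obtain ⟨δ, h⟩ := exists_fderiv_modelFrame_zero e Λ v w
  have h1 := bil_fderiv_one hn (isAdaptedFrame_modelFrame e Λ hn) (Set.mem_univ v) w 0
  rw [h, modelFrame_one, bil_nullVec hn] at h1
  simp only [zero_mul, mul_zero, mul_one, add_zero, zero_add, sub_zero] at h1
  linarith

theorem basisForms_modelFrame (hn : 2 ≤ n) (v : Param n) : BasisForms (modelFrame e Λ) v := by
  intro w h1 h2
  have hs : (e w).1 = 0 := funext fun j => by rw [← conn_modelFrame_zero_mid e Λ hn v, h1]; rfl
  rw [conn_modelFrame_zero_idxN e Λ hn, hs, zero_dotProduct, sub_zero] at h2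
  exact e.map_eq_zero_iff.1 (Prod.ext hs h2)

theorem isAffinor_modelFrame (hn : 2 ≤ n) (v : Param n) : IsAffinor (modelFrame e Λ) v Λ 0 := by
  intro w i
  rw [conn_modelFrame_one_mid e Λ hn]
  simp [conn_modelFrame_zero_mid e Λ hn, Matrix.mulVec, dotProduct]

theorem isCongruence_modelLine (hn : 2 ≤ n) : IsCongruence Set.univ (modelLine e Λ) where
  isOpen := isOpen_univ
  finrank_eq u hu := by
    have hli : LinearIndependent ℝ ![modelFrame e Λ 0 u, modelFrame e Λ 1 u] :=
      LinearIndependent.pair_iff.2 fun s t h =>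
        smul_add_smul_eq_zero (K := ℝ) hn (isAdaptedFrame_modelFrame e Λ hn) hu h
    have := finrank_span_eq_card hli
    rwa [Matrix.range_cons_cons_empty, Fintype.card_fin] at this
  isotropic u hu x hx y hy := bil_eq_zero_of_mem_line (isAdaptedFrame_modelFrame e Λ hn) hu hx hy
  smooth u _ := ⟨Set.univ, subset_rfl, isOpen_univ, Set.mem_univ u, modelFrame e Λ 0,
    modelFrame e Λ 1, (contDiff_modelFrame e Λ hn 0).contDiffOn,
    (contDiff_modelFrame e Λ hn 1).contDiffOn, fun _ _ => rfl⟩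
  regular u hu := by
    have hA := isAdaptedFrame_modelFrame e Λ hn
    have hne : modelFrame e Λ 0 u ≠ 0 := fun h => by
      have := smul_add_smul_eq_zero (K := ℝ) (p := 1) (q := 0) hn hA hu (by
        rw [h, map_zero, smul_zero, zero_smul, add_zero])
      exact one_ne_zero this.1
    have hne' : emb ℂ (modelFrame e Λ 0 u) ≠ 0 := fun h =>
      hne (emb_injective (h.trans (map_zero _).symm))
    have hsub : (Projectivization.mk ℂ _ hne').submodule =
        Submodule.span ℂ {emb ℂ (modelFrame e Λ 0 u)} := Projectivization.submodule_mk _ _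
    have hmem : emb ℂ (modelFrame e Λ 0 u) ∈ (Projectivization.mk ℂ _ hne').submodule := by
      rw [hsub]; exact Submodule.mem_span_singleton_self _
    refine ⟨Projectivization.mk ℂ _ hne', ⟨_, hne, hmem⟩, ?_, fun h => ?_⟩
    · rw [hsub, Submodule.span_singleton_le_iff_mem]
      exact emb_mem_extend (frame_zero_mem hA hu)
    · obtain ⟨c, hc, hrep⟩ := exists_rep_smul hne' hmem
      have h2 := h.2
      rw [hrep, ← add_zero (c • emb ℂ (modelFrame e Λ 0 u)),
        ← zero_smul ℂ (emb ℂ (modelFrame e Λ 1 u)),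
        finrank_ruledTangent_lt_iff_det hn hA hu (basisForms_modelFrame e Λ hn u)
          (isAffinor_modelFrame e Λ hn u) (Or.inl hc)] at h2
      -- At the point A_0 the determinant is a power of c ≠ 0, so A_0 is the required real
      -- nonsingular point.
      simp [hc] at h2

end Example

/-! ### Congruences with non-real singular points. -/

section NonReal

variable {n : ℕ} {ℓ : Param n → Submodule ℝ (Vec ℝ n)} {O : Set (Param n)}
  {A : Fin (n + 2) → Param n → Vec ℝ n} {u : Param n}

/-- A congruence, with an adapted frame at a line, whose affinor is a given matrix. -/
theorem exists_isCongruence_isAffinor (hn : 2 ≤ n) (Λ : Matrix (Fin (n - 2)) (Fin (n - 2)) ℝ) :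
    ∃ (ℓ : Param n → Submodule ℝ (Vec ℝ n)) (A : Fin (n + 2) → Param n → Vec ℝ n),
      IsCongruence Set.univ ℓ ∧ IsAdaptedFrame ℓ Set.univ A ∧ BasisForms A 0 ∧
        IsAffinor A 0 Λ 0 := by
  have hfin : Module.finrank ℝ (Param n) = Module.finrank ℝ ((Fin (n - 2) → ℝ) × ℝ) := by
    simp
    omega
  let e := ContinuousLinearEquiv.ofFinrankEq hfin
  exact ⟨modelLine e Λ, modelFrame e Λ, isCongruence_modelLine e Λ hn,
    isAdaptedFrame_modelFrame e Λ hn, basisForms_modelFrame e Λ hn 0,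
    isAffinor_modelFrame e Λ hn 0⟩

/-- If c(A_1 + xA_0) is a real vector, its products with A_n and A_{n+1} show that c and cx are
real. -/
theorem im_eq_zero_of_isRealPoint (hA : IsAdaptedFrame ℓ O A) (hu : u ∈ O) {P : ℙ ℂ (Vec ℂ n)}
    {x : ℂ} (hP : P.submodule = Submodule.span ℂ {pointOn A u x}) (hr : IsRealPoint P) :
    x.im = 0 := by
  obtain ⟨y, hy0, hy⟩ := hr
  have hy' : emb ℂ y ∈ P.submodule := hy
  rw [hP, Submodule.mem_span_singleton] at hy'
  obtain ⟨c, hc⟩ := hy'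
  have hN := congrArg (fun z => bil z (emb ℂ (A (idxN n) u))) hc
  have hL := congrArg (fun z => bil z (emb ℂ (A (Fin.last (n + 1)) u))) hc
  have e1 := hA.s0n u hu
  have e2 := hA.s1n u hu
  have e3 := hA.s0l u hu
  have e4 := hA.s1l u hu
  simp only [scal_eq_bil] at e1 e2 e3 e4
  simp only [pointOn_eq, map_smul, map_add, LinearMap.smul_apply, LinearMap.add_apply, bil_emb, e1,
    e2, e3, e4, smul_eq_mul, map_zero, map_neg, map_one] at hN hL
  have hcne : c ≠ 0 := by
    rintro rfl
    rw [zero_smul] at hc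
    exact hy0 (emb_injective (hc.symm.trans (map_zero _).symm))
  have hcr : c = ((-bil y (A (idxN n) u) : ℝ) : ℂ) := by
    have : (algebraMap ℝ ℂ) (bil y (A (idxN n) u)) = ((bil y (A (idxN n) u) : ℝ) : ℂ) := rfl
    rw [this] at hN
    push_cast
    linear_combination -hN
  set a := -bil y (A (idxN n) u) with ha
  have h1 : c * x = ((-bil y (A (Fin.last (n + 1)) u) : ℝ) : ℂ) := by
    have : (algebraMap ℝ ℂ) (bil y (A (Fin.last (n + 1)) u)) =
      ((bil y (A (Fin.last (n + 1)) u) : ℝ) : ℂ) := rfl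
    rw [this] at hL
    push_cast
    linear_combination -hL
  have h2 := congrArg Complex.im h1
  rw [hcr, Complex.im_ofReal_mul, Complex.ofReal_im] at h2
  refine (mul_eq_zero.1 h2).resolve_left fun h => hcne ?_
  rw [hcr, h, Complex.ofReal_zero]

theorem exists_isSingularPoint_not_isRealPoint (hn : 2 ≤ n) (hA : IsAdaptedFrame ℓ O A)
    (hu : u ∈ O) (hB : BasisForms A u) {Λ : Matrix (Fin (n - 2)) (Fin (n - 2)) ℝ}
    {μ : Fin (n - 2) → ℝ} (hΛ : IsAffinor A u Λ μ) {x : ℂ} (hx : x.im ≠ 0)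
    (hdet : (x • (1 : Matrix (Fin (n - 2)) (Fin (n - 2)) ℂ) + Λ.map (algebraMap ℝ ℂ)).det = 0) :
    ∃ P, IsSingularPoint ℓ u P ∧ ¬ IsRealPoint P := by
  have hsub := Projectivization.submodule_mk (K := ℂ) _ (pointOn_ne_zero hn hA hu x)
  refine ⟨Projectivization.mk ℂ _ (pointOn_ne_zero hn hA hu x),
    (isSingularPoint_iff hn hA hu hB hΛ _).2 ⟨x, ?_, hsub⟩,
    fun h => hx (im_eq_zero_of_isRealPoint hA hu hsub h)⟩
  rw [Polynomial.mem_roots (singularPoly_ne_zero Λ), Polynomial.IsRoot, eval_singularPoly]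
  exact hdet

/-- The affinor is a quarter turn in one coordinate plane, which needs n - 2 ≥ 2. Asymmetry in every
frame follows from the non-real point: a symmetric affinor would make all singular points real. -/
theorem exists_isCongruence_nonreal (hn : 4 ≤ n) :
    ∃ (Ω : Set (Param n)) (ℓ : Param n → Submodule ℝ (Vec ℝ n)), IsCongruence Ω ℓ ∧
      ∃ u ∈ Ω, (∃ P, IsSingularPoint ℓ u P ∧ ¬ IsRealPoint P) ∧
        ∀ O A, IsAdaptedFrame ℓ O A → u ∈ O → BasisForms A u →
          ∀ Λ μ, IsAffinor A u Λ μ → ¬ IsSymmetricAffinor A u Λ := by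
  have hn2 : 2 ≤ n := by omega
  let i₀ : Fin (n - 2) := ⟨0, by omega⟩
  let i₁ : Fin (n - 2) := ⟨1, by omega⟩
  have hne : i₀ ≠ i₁ := fun h => by simp [i₀, i₁, Fin.ext_iff] at h
  let Λ : Matrix (Fin (n - 2)) (Fin (n - 2)) ℝ :=
    Matrix.of fun i j => if i = i₀ ∧ j = i₁ then 1 else if i = i₁ ∧ j = i₀ then -1 else 0
  obtain ⟨ℓ, A, hΩ, hA, hB, hΛ⟩ := exists_isCongruence_isAffinor hn2 Λ
  have hdet : (Complex.I • (1 : Matrix (Fin (n - 2)) (Fin (n - 2)) ℂ) +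
      Λ.map (algebraMap ℝ ℂ)).det = 0 := by
    refine Matrix.exists_mulVec_eq_zero_iff.1
      -- (1, -i) is an eigenvector of the quarter turn with eigenvalue -i, hence in the kernel of i
      -- + Λ.
      ⟨Pi.single i₀ 1 + Pi.single i₁ (-Complex.I), fun h => ?_, ?_⟩
    · have := congrFun h i₀
      simp [hne] at this
    · funext k
      simp only [Matrix.mulVec_add, Matrix.mulVec_single, Pi.add_apply]
      by_cases h0 : k = i₀
      · subst h0
        simp [Λ, hne]
      · by_cases h1 : k = i₁
        · subst h1
          simp [Λ, hne, hne.symm]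
        · simp [Λ, h0, h1]
  obtain ⟨P, hP, hPr⟩ := exists_isSingularPoint_not_isRealPoint hn2 hA (Set.mem_univ 0) hB hΛ
    (by simp) hdet
  exact ⟨Set.univ, ℓ, hΩ, 0, Set.mem_univ 0, ⟨P, hP, hPr⟩, fun O A' hA' hu' hB' Λ' μ' hΛ' hs =>
    hPr (isRealPoint_of_isSymmetricAffinor hn2 hA' hu' hB' hΛ' hs hP)⟩

/-- An eigenvalue -x of Λ satisfies x² = -1. -/
theorem im_ne_zero_of_sq_eq_neg_one {ι : Type*} [Fintype ι] [DecidableEq ι] {Λ : Matrix ι ι ℝ}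
    (hsq : Λ * Λ = -1) {x : ℂ}
    (hdet : (x • (1 : Matrix ι ι ℂ) + Λ.map (algebraMap ℝ ℂ)).det = 0) : x.im ≠ 0 := by
  obtain ⟨v, hv0, hv⟩ := Matrix.exists_mulVec_eq_zero_iff.2 hdet
  rw [Matrix.add_mulVec, Matrix.smul_mulVec, Matrix.one_mulVec] at hv
  have h1 : Λ.map (algebraMap ℝ ℂ) *ᵥ v = -(x • v) := eq_neg_of_add_eq_zero_right hv
  have h2 : Λ.map (algebraMap ℝ ℂ) * Λ.map (algebraMap ℝ ℂ) = -1 := by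
    rw [← Matrix.map_mul, hsq]
    ext i j
    simp [Matrix.one_apply]
    split_ifs <;> simp
  have h3 : (x * x) • v = -v := by
    have := congrArg (fun M => M *ᵥ v) h2
    simp only [← Matrix.mulVec_mulVec, h1, Matrix.mulVec_neg, Matrix.mulVec_smul, smul_neg, neg_neg,
      smul_smul, Matrix.neg_mulVec, Matrix.one_mulVec] at this
    exact this
  obtain ⟨i, hi⟩ := Function.ne_iff.1 hv0
  have h4 : x * x = -1 := by
    have := congrFun h3 i
    simp only [Pi.smul_apply, smul_eq_mul, Pi.neg_apply] at this
    exact mul_right_cancel₀ hi (by rw [this, neg_one_mul])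
  intro him
  have := congrArg Complex.re h4
  simp [him] at this
  nlinarith [mul_self_nonneg x.re]

/-- For n = 2m the space ℝ^{n-2} splits into two copies of ℝ^{m-1} and carries the standard complex
structure, which has no real eigenvalue. -/
theorem exists_isCongruence_all_nonreal (hn : 4 ≤ n) (heven : Even n) :
    ∃ (Ω : Set (Param n)) (ℓ : Param n → Submodule ℝ (Vec ℝ n)),
      IsCongruence Ω ℓ ∧ ∃ u ∈ Ω, ∀ P, IsSingularPoint ℓ u P → ¬ IsRealPoint P := by
  have hn2 : 2 ≤ n := by omega
  obtain ⟨m, hm⟩ := heven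
  have hcard : m - 1 + (m - 1) = n - 2 := by omega
  let ε : Fin (m - 1) ⊕ Fin (m - 1) ≃ Fin (n - 2) := finSumFinEquiv.trans (finCongr hcard)
  let J : Matrix (Fin (m - 1) ⊕ Fin (m - 1)) (Fin (m - 1) ⊕ Fin (m - 1)) ℝ :=
    Matrix.fromBlocks 0 1 (-1) 0
  have hJ : J * J = -1 := by
    simp [J, Matrix.fromBlocks_multiply, ← Matrix.fromBlocks_one, Matrix.fromBlocks_neg]
  have hsq : J.submatrix ε.symm ε.symm * J.submatrix ε.symm ε.symm = -1 := by
    rw [Matrix.submatrix_mul_equiv, hJ]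
    ext i j
    simp [Matrix.one_apply]
  obtain ⟨ℓ, A, hΩ, hA, hB, hΛ⟩ := exists_isCongruence_isAffinor hn2 (J.submatrix ε.symm ε.symm)
  refine ⟨Set.univ, ℓ, hΩ, 0, Set.mem_univ 0, fun P hP hr => ?_⟩
  obtain ⟨x, hx, hPx⟩ := (isSingularPoint_iff hn2 hA (Set.mem_univ 0) hB hΛ P).1 hP
  have h0 := (Polynomial.mem_roots'.1 hx).2
  rw [Polynomial.IsRoot, eval_singularPoly] at h0
  exact im_ne_zero_of_sq_eq_neg_one hsq h0
    (im_eq_zero_of_isRealPoint hA (Set.mem_univ 0) hPx hr)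

end NonReal

end

end IsotropicCongruence

open IsotropicCongruence in
theorem theorem2 (n : ℕ) (hn : 3 ≤ n) :
    (∀ (Ω : Set (Param n)) (ℓ : Param n → Submodule ℝ (Vec ℝ n)), IsCongruence Ω ℓ →
      -- the singular points of each line, counted with multiplicity
      (∀ u ∈ Ω,
        (∃ O ⊆ Ω, u ∈ O ∧ ∃ A, IsAdaptedFrame ℓ O A ∧ BasisForms A u) ∧
        ∃ D : Multiset (ℙ ℂ (Vec ℂ n)),
          D.card = n - 2 ∧
          (∀ P, P ∈ D ↔ IsSingularPoint ℓ u P) ∧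
          ∀ O A, IsAdaptedFrame ℓ O A → u ∈ O → BasisForms A u →
            (∃! p : Matrix (Fin (n - 2)) (Fin (n - 2)) ℝ × (Fin (n - 2) → ℝ),
              IsAffinor A u p.1 p.2) ∧
            ∀ Λ μ, IsAffinor A u Λ μ → IsRootDivisor A u Λ D) ∧
      -- they are the Darboux images of the singular points of the congruence of `C^n_1`
      (∀ u ∈ Ω,
        (∀ P : ℙ ℂ (Vec ℂ n), P.submodule ≤ extend ℂ (ℓ u) →
          ∃ T, IsConformal T ∧ ∃ x : Fin n → ℂ, P.submodule = Submodule.span ℂ {chart T x}) ∧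
        ∀ T, IsConformal T → ∀ (x : Fin n → ℂ) (P : ℙ ℂ (Vec ℂ n)),
          P.submodule = Submodule.span ℂ {chart T x} →
            (IsSingularPoint ℓ u P ↔ IsSingularInChart ℓ T u x)) ∧
      -- the completely integrable case
      (CompletelyIntegrable Ω ℓ →
        StratifiedIntoLightlike Ω ℓ ∧
        (∀ u ∈ Ω, ∀ O A, IsAdaptedFrame ℓ O A → u ∈ O → BasisForms A u →
          ∀ Λ μ, IsAffinor A u Λ μ → IsSymmetricAffinor A u Λ) ∧
        ∀ u ∈ Ω, ∀ P, IsSingularPoint ℓ u P → IsRealPoint P)) ∧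
    -- some singular points can be non-real, and then the affinor is not symmetric
    (4 ≤ n → ∃ (Ω : Set (Param n)) (ℓ : Param n → Submodule ℝ (Vec ℝ n)), IsCongruence Ω ℓ ∧
      ∃ u ∈ Ω, (∃ P, IsSingularPoint ℓ u P ∧ ¬ IsRealPoint P) ∧
        ∀ O A, IsAdaptedFrame ℓ O A → u ∈ O → BasisForms A u →
          ∀ Λ μ, IsAffinor A u Λ μ → ¬ IsSymmetricAffinor A u Λ) ∧
    -- all singular points can be non-real, when `n` is even
    (4 ≤ n → Even n → ∃ (Ω : Set (Param n)) (ℓ : Param n → Submodule ℝ (Vec ℝ n)),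
      IsCongruence Ω ℓ ∧ ∃ u ∈ Ω, ∀ P, IsSingularPoint ℓ u P → ¬ IsRealPoint P) := by
  have hn2 : 2 ≤ n := by omega
  refine ⟨fun Ω ℓ hΩ => ⟨fun u hu => ⟨exists_adaptedFrame_basisForms hn2 hΩ hu,
      exists_singular_divisor hn2 hΩ hu⟩, fun u hu => ⟨fun P hP => exists_chart (by omega) hΩ hu hP,
      fun T hT x P hP => isSingularPoint_iff_isSingularInChart hn2 hΩ hu hT hP⟩, fun hci => ?_⟩,
    exists_isCongruence_nonreal, exists_isCongruence_all_nonreal⟩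
  have hsymm : ∀ u ∈ Ω, ∀ O A, IsAdaptedFrame ℓ O A → u ∈ O → BasisForms A u →
      ∀ Λ μ, IsAffinor A u Λ μ → IsSymmetricAffinor A u Λ := by
    intro u hu O A hA huO hB Λ μ hΛ
    obtain ⟨O', -, huO', A', hA', hF⟩ := hci u hu
    exact isSymmetricAffinor_of_frobeniusAt hn2 hA' huO' (hF u huO') hA huO hB hΛ
  refine ⟨stratifiedIntoLightlike hn hΩ hci, hsymm, fun u hu P hP => ?_⟩
  obtain ⟨O, -, huO, A, hA, hB⟩ := exists_adaptedFrame_basisForms hn2 hΩ hu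
  obtain ⟨p, hp, -⟩ := existsUnique_affinor hn2 hB
  exact isRealPoint_of_isSymmetricAffinor hn2 hA huO hB hp (hsymm u hu O A hA huO hB _ _ hp) hP
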